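/- Let $N\ge 2$ and let $\Omega\subset\mathbb{R}^N$ be a bounded domain (non-empty, open and connected) whose boundary $\Gamma$ is of class $C^2$ (locally, $\Omega$ is the region on one side of the graph of a $C^2$ function). Let $\nu$ be the exterior unit normal on $\Gamma$, let $\nabla\nu$ be the Jacobian of a $C^1$ extension of $\nu$ to a neighborhood of $\Gamma$ by unit vectors, let $H=\frac1{N-1}\sum_{j=1}^{N-1}\kappa_j$ be the mean curvature of $\Gamma$, where the $\kappa_j$ are the principal curvatures with respect to the interior normal (positive for a ball), and set $$R=\frac{N\,|\Omega|}{|\Gamma|},$$ where $|\Omega|$ is the volume of $\Omega$ and $|\Gamma|$ is the surface measure of $\Gamma$. Let $u\in C^2(\overline\Omega)$ satisfy $$\Delta u=N\ \text{ in }\ \Omega,\qquad u_\nu=R\ \text{ on }\ \Gamma,$$ and put $\overline u=\max_{\overline\Omega}u$ and $\nabla_\Gamma u=\nabla u-u_\nu\,\nu$ on $\Gamma$. Let $z\in\mathbb{R}^N$, $a\in\mathbb{R}$, $q(x)=\frac12|x-z|^2+a$ and $h=q-u$. If $$\frac12\int_\Gamma|\nabla_\Gamma u|^2\,h_\nu\,dS_x+\int_\Gamma(\overline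 u-u)\bigl[(N-1)RH-N\bigr]h_\nu\,dS_x-\int_\Gamma(\overline u-u)\,\langle(\nabla\nu)\nabla_\Gamma u,\nabla_\Gamma u\rangle\,dS_x\ \le\ 0,$$ then $h$ is affine on $\overline\Omega$, and hence $u$ is a quadratic polynomial: there are $z_0\in\mathbb{R}^N$ and $a_0\in\mathbb{R}$ with $u(x)=\frac12|x-z_0|^2+a_0$ for all $x\in\overline\Omega$. As a result, $\Omega$ is the ball of radius $R$ centered at $z_0$. -/

import Mathlib

open scoped MeasureTheory InnerProductSpace Topology

noncomputable section

namespace NeumannRigidity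

variable {N : ℕ}

/-- The boundary of `Ω` is of class `C²`: after a rigid motion, `Ω` is near each of its boundary
points the set below the graph of a `C²` function of `N - 1` variables. The vertical axis is spanned
by the unit vector `e`; a function of the remaining `N - 1` coordinates is a function `g` on the
whole space which is constant along `e`. -/
def HasC2Boundary (Ω : Set (EuclideanSpace ℝ (Fin N))) : Prop :=
  ∀ x ∈ frontier Ω, ∃ e : EuclideanSpace ℝ (Fin N), ‖e‖ = 1 ∧
    ∃ g : EuclideanSpace ℝ (Fin N) → ℝ, ContDiff ℝ 2 g ∧
      (∀ (y : EuclideanSpace ℝ (Fin N)) (t : ℝ), g (y + t • e) = g y) ∧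
      ∀ᶠ y in 𝓝 x, (y ∈ Ω ↔ ⟪e, y⟫_ℝ < g y)

/-- `w` is the exterior unit normal of `Ω` at `y`: every direction that makes an obtuse angle with
`w` points into `Ω`, every direction that makes an acute angle with `w` points out of `Ω`. -/
def IsOuterUnitNormal (Ω : Set (EuclideanSpace ℝ (Fin N))) (y w : EuclideanSpace ℝ (Fin N)) :
    Prop :=
  ‖w‖ = 1 ∧
  (∀ v : EuclideanSpace ℝ (Fin N), ⟪v, w⟫_ℝ < 0 → ∀ᶠ t : ℝ in 𝓝[>] 0, y + t • v ∈ Ω) ∧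
  (∀ v : EuclideanSpace ℝ (Fin N), 0 < ⟪v, w⟫_ℝ → ∀ᶠ t : ℝ in 𝓝[>] 0, y + t • v ∉ Ω)

/-- `n` is a unit vector field of class `C¹` near `x` which extends the exterior unit normal field
of the boundary of `Ω`. -/
def IsNormalExtensionAt (Ω : Set (EuclideanSpace ℝ (Fin N))) (x : EuclideanSpace ℝ (Fin N))
    (n : EuclideanSpace ℝ (Fin N) → EuclideanSpace ℝ (Fin N)) : Prop :=
  ContDiffAt ℝ 1 n x ∧
    ∀ᶠ y in 𝓝 x, ‖n y‖ = 1 ∧ (y ∈ frontier Ω → IsOuterUnitNormal Ω y (n y))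

/-- The exterior unit normal `ν`; it is unique by `IsOuterUnitNormal.unique`, and it exists on a
`C²` boundary by `exists_isNormalExtensionAt`. -/
def outerNormal (Ω : Set (EuclideanSpace ℝ (Fin N))) (x : EuclideanSpace ℝ (Fin N)) :
    EuclideanSpace ℝ (Fin N) :=
  Classical.epsilon (IsOuterUnitNormal Ω x)

/-- The Jacobian `∇ν` at a boundary point `x` of a unit extension of the exterior normal field
(which exists on a `C²` boundary by `exists_isNormalExtensionAt`). Its values on tangent vectors and
its trace do not depend on the extension: see `IsNormalExtensionAt.fderiv_eq_of_inner_eq_zero` and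
`IsNormalExtensionAt.trace_fderiv_eq`. -/
def normalJacobian (Ω : Set (EuclideanSpace ℝ (Fin N))) (x : EuclideanSpace ℝ (Fin N)) :
    EuclideanSpace ℝ (Fin N) →L[ℝ] EuclideanSpace ℝ (Fin N) :=
  fderiv ℝ (Classical.epsilon (IsNormalExtensionAt Ω x)) x

/-- The mean curvature `H = (κ₁ + ⋯ + κ_{N-1}) / (N - 1)`. The principal curvatures `κⱼ` with
respect to the interior normal (positive for a ball) are the eigenvalues of `∇ν` on the tangent
space, and `⟨(∇ν) ν, ν⟩ = 0` because the extension is unitary, so that `∑ κⱼ` is the trace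
of `∇ν`. -/
def meanCurvature (Ω : Set (EuclideanSpace ℝ (Fin N))) (x : EuclideanSpace ℝ (Fin N)) : ℝ :=
  ((N : ℝ) - 1)⁻¹ *
    LinearMap.trace ℝ (EuclideanSpace ℝ (Fin N)) (normalJacobian Ω x).toLinearMap

/-- The normal derivative `f_ν` on the boundary of `Ω` of a function `f` on the closure of `Ω`. -/
def normalDeriv (Ω : Set (EuclideanSpace ℝ (Fin N))) (f : EuclideanSpace ℝ (Fin N) → ℝ)
    (x : EuclideanSpace ℝ (Fin N)) : ℝ :=
  ⟪gradientWithin f (closure Ω) x, outerNormal Ω x⟫_ℝ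

/-- The tangential gradient `∇_Γ f = ∇f - f_ν ν` on the boundary `Γ` of `Ω`. -/
def tangentialGradient (Ω : Set (EuclideanSpace ℝ (Fin N))) (f : EuclideanSpace ℝ (Fin N) → ℝ)
    (x : EuclideanSpace ℝ (Fin N)) : EuclideanSpace ℝ (Fin N) :=
  gradientWithin f (closure Ω) x - normalDeriv Ω f x • outerNormal Ω x

/-- The quadratic polynomial `q(x) = |x - z|² / 2 + a`. -/
def quadratic (z : EuclideanSpace ℝ (Fin N)) (a : ℝ) (x : EuclideanSpace ℝ (Fin N)) : ℝ :=
  ‖x - z‖ ^ 2 / 2 + a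

/-- The constant `R = N |Ω| / |Γ|`, where `|Γ|` is the surface measure of the boundary, i.e. its
`(N - 1)`-dimensional Hausdorff measure in the Euclidean normalization. -/
def neumannConstant (Ω : Set (EuclideanSpace ℝ (Fin N))) : ℝ :=
  N * MeasureTheory.volume.real Ω /
    (μHE[N - 1] : MeasureTheory.Measure (EuclideanSpace ℝ (Fin N))).real (frontier Ω)

/-- The maximum `ū` of `u` over the closure of `Ω`. -/
def maxOnClosure (Ω : Set (EuclideanSpace ℝ (Fin N))) (u : EuclideanSpace ℝ (Fin N) → ℝ) : ℝ :=
  sSup (u '' closure Ω)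

/-- The boundary side of the Neumann identity: with `h = q - u`,
`½ ∫_Γ |∇_Γ u|² h_ν dS + ∫_Γ (ū - u) [(N - 1) R H - N] h_ν dS
  - ∫_Γ (ū - u) ⟨(∇ν) ∇_Γ u, ∇_Γ u⟩ dS`. -/
def neumannBoundarySide (Ω : Set (EuclideanSpace ℝ (Fin N)))
    (u : EuclideanSpace ℝ (Fin N) → ℝ) (z : EuclideanSpace ℝ (Fin N)) (a : ℝ) : ℝ :=
  1 / 2 * (∫ x in frontier Ω,
      ‖tangentialGradient Ω u x‖ ^ 2 * normalDeriv Ω (fun y => quadratic z a y - u y) x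
        ∂μHE[N - 1])
  + (∫ x in frontier Ω,
      (maxOnClosure Ω u - u x) * (((N : ℝ) - 1) * neumannConstant Ω * meanCurvature Ω x - N) *
        normalDeriv Ω (fun y => quadratic z a y - u y) x ∂μHE[N - 1])
  - ∫ x in frontier Ω,
      (maxOnClosure Ω u - u x) *
        ⟪normalJacobian Ω x (tangentialGradient Ω u x), tangentialGradient Ω u x⟫_ℝ ∂μHE[N - 1]

/-! The remaining facts show that the definitions above are well posed. -/

theorem IsOuterUnitNormal.unique {Ω : Set (EuclideanSpace ℝ (Fin N))}
    {y w w' : EuclideanSpace ℝ (Fin N)} (h : IsOuterUnitNormal Ω y w)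
    (h' : IsOuterUnitNormal Ω y w') : w = w' := by
  by_contra hne
  have hlt : ⟪w, w'⟫_ℝ < 1 := (inner_lt_one_iff_real_of_norm_eq_one h.1 h'.1).2 hne
  have h1 : ⟪w' - w, w⟫_ℝ < 0 := by
    rw [inner_sub_left, real_inner_self_eq_norm_sq, h.1, real_inner_comm]; linarith
  have h2 : 0 < ⟪w' - w, w'⟫_ℝ := by
    rw [inner_sub_left, real_inner_self_eq_norm_sq, h'.1]; linarith
  obtain ⟨t, ht, ht'⟩ := ((h.2.1 _ h1).and (h'.2.2 _ h2)).exists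
  exact ht' ht

theorem inner_gradient_eq_zero {e : EuclideanSpace ℝ (Fin N)}
    {g : EuclideanSpace ℝ (Fin N) → ℝ} (hg : ContDiff ℝ 2 g)
    (hinv : ∀ (y : EuclideanSpace ℝ (Fin N)) (t : ℝ), g (y + t • e) = g y)
    (y : EuclideanSpace ℝ (Fin N)) : ⟪gradient g y, e⟫_ℝ = 0 := by
  have hd : DifferentiableAt ℝ g y := (hg.differentiable (by norm_num)) y
  have h1 : HasLineDerivAt ℝ g (fderiv ℝ g y e) y e := hd.hasFDerivAt.hasLineDerivAt e
  have h2 : HasLineDerivAt ℝ g 0 y e := by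
    unfold HasLineDerivAt
    simp only [hinv]
    exact hasDerivAt_const _ _
  have h3 := HasDerivAt.unique h1 h2
  rw [gradient, InnerProductSpace.toDual_symm_apply, h3]

/-- In a graph representation, the boundary is the graph. -/
theorem eventually_mem_frontier_iff {Ω : Set (EuclideanSpace ℝ (Fin N))}
    {x e : EuclideanSpace ℝ (Fin N)} {g : EuclideanSpace ℝ (Fin N) → ℝ} (he : ‖e‖ = 1)
    (hg : Continuous g)
    (hinv : ∀ (y : EuclideanSpace ℝ (Fin N)) (t : ℝ), g (y + t • e) = g y)
    (hΩ : ∀ᶠ y in 𝓝 x, (y ∈ Ω ↔ ⟪e, y⟫_ℝ < g y)) :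
    ∀ᶠ y in 𝓝 x, (y ∈ frontier Ω ↔ ⟪e, y⟫_ℝ = g y) := by
  have hin : Continuous fun y : EuclideanSpace ℝ (Fin N) => ⟪e, y⟫_ℝ := by fun_prop
  filter_upwards [hΩ.eventually_nhds] with y hy
  have hline : ∀ c : ℝ, Filter.Tendsto (fun t : ℝ => y + (c * t) • e) (𝓝[>] 0) (𝓝 y) := by
    intro c
    have : Continuous fun t : ℝ => y + (c * t) • e := by fun_prop
    have h0 := this.tendsto 0
    rw [mul_zero, zero_smul, add_zero] at h0
    exact h0.mono_left nhdsWithin_le_nhds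
  constructor
  · intro hf
    rcases lt_trichotomy ⟪e, y⟫_ℝ (g y) with hlt | heq | hgt
    · exfalso
      have : Ω ∈ 𝓝 y := by
        filter_upwards [hy, hin.continuousAt.eventually_lt hg.continuousAt hlt] with v hv hv'
        exact hv.2 hv'
      exact hf.2 (mem_interior_iff_mem_nhds.2 this)
    · exact heq
    · exfalso
      have : Ωᶜ ∈ 𝓝 y := by
        filter_upwards [hy, hg.continuousAt.eventually_lt hin.continuousAt hgt] with v hv hv'
        exact fun hc => lt_asymm (hv.1 hc) hv'
      obtain ⟨v, hv, hv'⟩ := mem_closure_iff_nhds.1 hf.1 _ this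
      exact hv hv'
  · intro heq
    refine ⟨?_, fun hi => ?_⟩
    · refine mem_closure_of_tendsto (hline (-1)) ?_
      filter_upwards [(hline (-1)).eventually hy, self_mem_nhdsWithin] with t ht htpos
      rw [ht, hinv, inner_add_right, inner_smul_right, real_inner_self_eq_norm_sq, he, heq]
      have : (0 : ℝ) < t := htpos
      linarith
    · have hmem := (hline 1).eventually (mem_interior_iff_mem_nhds.1 hi)
      obtain ⟨t, ⟨ht, htpos⟩, htm⟩ :=
        (((hline 1).eventually hy).and self_mem_nhdsWithin |>.and hmem).exists
      have := ht.1 htm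
      rw [hinv, inner_add_right, inner_smul_right, real_inner_self_eq_norm_sq, he, heq] at this
      have h0 : (0 : ℝ) < t := htpos
      linarith

theorem inner_sub_gradient_eq_one {e : EuclideanSpace ℝ (Fin N)} (he : ‖e‖ = 1)
    {g : EuclideanSpace ℝ (Fin N) → ℝ} (hg : ContDiff ℝ 2 g)
    (hinv : ∀ (y : EuclideanSpace ℝ (Fin N)) (t : ℝ), g (y + t • e) = g y)
    (y : EuclideanSpace ℝ (Fin N)) : ⟪e - gradient g y, e⟫_ℝ = 1 := by
  simp [inner_sub_left, inner_gradient_eq_zero hg hinv, he]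

theorem hasDerivAt_graph (e : EuclideanSpace ℝ (Fin N))
    {g : EuclideanSpace ℝ (Fin N) → ℝ} (hg : ContDiff ℝ 2 g) (y v : EuclideanSpace ℝ (Fin N)) :
    HasDerivAt (fun t : ℝ => ⟪e, y + t • v⟫_ℝ - g (y + t • v)) ⟪v, e - gradient g y⟫_ℝ 0 := by
  have hd : DifferentiableAt ℝ g y := (hg.differentiable (by norm_num)) y
  have h1 : HasDerivAt (fun t : ℝ => g (y + t • v)) (fderiv ℝ g y v) 0 :=
    hd.hasFDerivAt.hasLineDerivAt v
  have h2 : HasDerivAt (fun t : ℝ => ⟪e, y + t • v⟫_ℝ) ⟪e, v⟫_ℝ 0 := by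
    have : HasDerivAt (fun t : ℝ => ⟪e, y⟫_ℝ + t * ⟪e, v⟫_ℝ) (1 * ⟪e, v⟫_ℝ) 0 :=
      ((hasDerivAt_id (0 : ℝ)).mul_const _).const_add _
    simpa [inner_add_right, inner_smul_right] using this
  have h3 : ⟪v, e - gradient g y⟫_ℝ = ⟪e, v⟫_ℝ - fderiv ℝ g y v := by
    rw [inner_sub_right, real_inner_comm e v, real_inner_comm (gradient g y) v, gradient,
      InnerProductSpace.toDual_symm_apply]
  rw [h3]
  exact h2.sub h1

/-- In a graph representation, the exterior unit normal is the normalized vector `e - ∇g`. -/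
theorem eventually_isOuterUnitNormal {Ω : Set (EuclideanSpace ℝ (Fin N))}
    {x e : EuclideanSpace ℝ (Fin N)} {g : EuclideanSpace ℝ (Fin N) → ℝ} (he : ‖e‖ = 1)
    (hg : ContDiff ℝ 2 g)
    (hinv : ∀ (y : EuclideanSpace ℝ (Fin N)) (t : ℝ), g (y + t • e) = g y)
    (hΩ : ∀ᶠ y in 𝓝 x, (y ∈ Ω ↔ ⟪e, y⟫_ℝ < g y)) :
    ∀ᶠ y in 𝓝 x, ‖‖e - gradient g y‖⁻¹ • (e - gradient g y)‖ = 1 ∧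
      (y ∈ frontier Ω →
        IsOuterUnitNormal Ω y (‖e - gradient g y‖⁻¹ • (e - gradient g y))) := by
  have hG0 : ∀ y, e - gradient g y ≠ 0 := fun y h0 => by
    have := inner_sub_gradient_eq_one he hg hinv y
    rw [h0, inner_zero_left] at this
    exact zero_ne_one this
  filter_upwards [eventually_mem_frontier_iff he hg.continuous hinv hΩ,
    hΩ.eventually_nhds] with y hfr hy
  have hn : ‖‖e - gradient g y‖⁻¹ • (e - gradient g y)‖ = 1 := by
    rw [norm_smul, norm_inv, norm_norm, inv_mul_cancel₀ (norm_ne_zero_iff.2 (hG0 y))]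
  refine ⟨hn, fun hyf => ?_⟩
  have hy0 := hfr.1 hyf
  have hpos : 0 < ‖e - gradient g y‖⁻¹ := inv_pos.2 (norm_pos_iff.2 (hG0 y))
  have hline : ∀ v : EuclideanSpace ℝ (Fin N),
      Filter.Tendsto (fun t : ℝ => y + t • v) (𝓝[>] 0) (𝓝 y) := by
    intro v
    have : Continuous fun t : ℝ => y + t • v := by fun_prop
    have h0 := this.tendsto 0
    rw [zero_smul, add_zero] at h0
    exact h0.mono_left nhdsWithin_le_nhds
  have hslope : ∀ v : EuclideanSpace ℝ (Fin N), Filter.Tendsto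
      (fun t : ℝ => t⁻¹ * (⟪e, y + t • v⟫_ℝ - g (y + t • v))) (𝓝[>] 0)
      (𝓝 ⟪v, e - gradient g y⟫_ℝ) := by
    intro v
    have := (hasDerivAt_graph e hg y v).tendsto_slope_zero_right
    simpa [hy0] using this
  refine ⟨hn, fun v hv => ?_, fun v hv => ?_⟩
  · rw [inner_smul_right] at hv
    have hv' : ⟪v, e - gradient g y⟫_ℝ < 0 := by
      by_contra hc
      exact absurd hv (not_lt.2 (mul_nonneg hpos.le (not_lt.1 hc)))
    filter_upwards [(hslope v).eventually_lt_const hv', (hline v).eventually hy,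
      self_mem_nhdsWithin] with t ht hty htpos
    rw [hty]
    have h0 : (0 : ℝ) < t⁻¹ := inv_pos.2 htpos
    by_contra hc
    exact absurd ht (not_lt.2 (mul_nonneg h0.le (by linarith)))
  · rw [inner_smul_right] at hv
    have hv' : 0 < ⟪v, e - gradient g y⟫_ℝ := by
      by_contra hc
      exact absurd hv (not_lt.2 (mul_nonpos_of_nonneg_of_nonpos hpos.le (not_lt.1 hc)))
    filter_upwards [(hslope v).eventually_const_lt hv', (hline v).eventually hy,
      self_mem_nhdsWithin] with t ht hty htpos
    rw [hty]
    have h0 : (0 : ℝ) < t⁻¹ := inv_pos.2 htpos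
    intro hc
    exact absurd ht (not_lt.2 (mul_nonpos_of_nonneg_of_nonpos h0.le (by linarith)))

theorem exists_isNormalExtensionAt {Ω : Set (EuclideanSpace ℝ (Fin N))} (hΩ : HasC2Boundary Ω)
    {x : EuclideanSpace ℝ (Fin N)} (hx : x ∈ frontier Ω) : ∃ n, IsNormalExtensionAt Ω x n := by
  obtain ⟨e, he, g, hg, hinv, hloc⟩ := hΩ x hx
  have hGC : ContDiff ℝ 1 fun y => e - gradient g y := by
    have h1 : ContDiff ℝ 1 (fderiv ℝ g) := hg.fderiv_right (by norm_num)
    have h2 : ContDiff ℝ 1 (gradient g) :=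
      ((InnerProductSpace.toDual ℝ (EuclideanSpace ℝ (Fin N))).symm.toContinuousLinearEquiv
        |>.contDiff.comp h1)
    exact contDiff_const.sub h2
  have hG0 : e - gradient g x ≠ 0 := fun h0 => by
    have := inner_sub_gradient_eq_one he hg hinv x
    rw [h0, inner_zero_left] at this
    exact zero_ne_one this
  exact ⟨fun y => ‖e - gradient g y‖⁻¹ • (e - gradient g y),
    ((hGC.contDiffAt.norm ℝ hG0).inv (norm_ne_zero_iff.2 hG0)).smul hGC.contDiffAt,
    eventually_isOuterUnitNormal he hg hinv hloc⟩

theorem isOuterUnitNormal_outerNormal {Ω : Set (EuclideanSpace ℝ (Fin N))}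
    (hΩ : HasC2Boundary Ω) {x : EuclideanSpace ℝ (Fin N)} (hx : x ∈ frontier Ω) :
    IsOuterUnitNormal Ω x (outerNormal Ω x) := by
  obtain ⟨n, hn⟩ := exists_isNormalExtensionAt hΩ hx
  exact Classical.epsilon_spec ⟨n x, hn.2.self_of_nhds.2 hx⟩

theorem IsNormalExtensionAt.apply_eq {Ω : Set (EuclideanSpace ℝ (Fin N))}
    (hΩ : HasC2Boundary Ω) {x : EuclideanSpace ℝ (Fin N)} (hx : x ∈ frontier Ω)
    {n : EuclideanSpace ℝ (Fin N) → EuclideanSpace ℝ (Fin N)} (hn : IsNormalExtensionAt Ω x n) :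
    n x = outerNormal Ω x :=
  (hn.2.self_of_nhds.2 hx).unique (isOuterUnitNormal_outerNormal hΩ hx)

/-- On tangent vectors, the Jacobian does not depend on the extension of the normal. -/
theorem IsNormalExtensionAt.fderiv_eq_of_inner_eq_zero {Ω : Set (EuclideanSpace ℝ (Fin N))}
    (hΩ : HasC2Boundary Ω) {x : EuclideanSpace ℝ (Fin N)} (hx : x ∈ frontier Ω)
    {n n' : EuclideanSpace ℝ (Fin N) → EuclideanSpace ℝ (Fin N)}
    (hn : IsNormalExtensionAt Ω x n) (hn' : IsNormalExtensionAt Ω x n')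
    {τ : EuclideanSpace ℝ (Fin N)} (hτ : ⟪τ, outerNormal Ω x⟫_ℝ = 0) :
    fderiv ℝ n x τ = fderiv ℝ n' x τ := by
  obtain ⟨e, he, g, hg, hinv, hloc⟩ := hΩ x hx
  have hfr := eventually_mem_frontier_iff he hg.continuous hinv hloc
  have hnu := ((eventually_isOuterUnitNormal he hg hinv hloc).self_of_nhds.2 hx).unique
    (isOuterUnitNormal_outerNormal hΩ hx)
  have hG0 : e - gradient g x ≠ 0 := fun h0 => by
    have := inner_sub_gradient_eq_one he hg hinv x
    rw [h0, inner_zero_left] at this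
    exact zero_ne_one this
  have hτ0 : ⟪τ, e - gradient g x⟫_ℝ = 0 := by
    rw [← hnu, inner_smul_right] at hτ
    exact (mul_eq_zero.1 hτ).resolve_left (inv_ne_zero (norm_ne_zero_iff.2 hG0))
  set γ : ℝ → EuclideanSpace ℝ (Fin N) :=
    fun t => x + t • τ - (⟪e, x + t • τ⟫_ℝ - g (x + t • τ)) • e with hγ
  have hγ0 : γ 0 = x := by
    have := hfr.self_of_nhds.1 hx
    simp [hγ, this]
  have hγd : HasDerivAt γ τ 0 := by
    have h1 := hasDerivAt_graph e hg x τ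
    rw [hτ0] at h1
    have h2 : HasDerivAt (fun t : ℝ => x + t • τ) ((1 : ℝ) • τ) 0 :=
      ((hasDerivAt_id (0 : ℝ)).smul_const τ).const_add x
    have h3 := h2.sub (h1.smul_const e)
    rw [one_smul, zero_smul, sub_zero] at h3
    exact h3
  have hγt : Filter.Tendsto γ (𝓝 0) (𝓝 x) := by
    have := hγd.continuousAt.tendsto
    rwa [hγ0] at this
  have hγf : ∀ᶠ t in 𝓝 (0 : ℝ), γ t ∈ frontier Ω := by
    filter_upwards [hγt.eventually hfr] with t ht
    rw [ht]
    have hgt : g (γ t) = g (x + t • τ) := by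
      have := hinv (x + t • τ) (-(⟪e, x + t • τ⟫_ℝ - g (x + t • τ)))
      rwa [neg_smul, ← sub_eq_add_neg] at this
    rw [hgt, hγ]
    simp only [inner_sub_right, inner_smul_right, real_inner_self_eq_norm_sq, he]
    ring
  have heq : (fun t => n (γ t)) =ᶠ[𝓝 0] fun t => n' (γ t) := by
    filter_upwards [hγf, hγt.eventually hn.2, hγt.eventually hn'.2] with t h1 h2 h3
    exact (h2.2 h1).unique (h3.2 h1)
  have hd : ∀ m, IsNormalExtensionAt Ω x m →
      HasDerivAt (fun t => m (γ t)) (fderiv ℝ m x τ) 0 := by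
    intro m hm
    have h1 : HasFDerivAt m (fderiv ℝ m x) (γ 0) := by
      rw [hγ0]; exact (hm.1.differentiableAt (by norm_num)).hasFDerivAt
    exact h1.comp_hasDerivAt 0 hγd
  exact (hd n hn).unique ((hd n' hn').congr_of_eventuallyEq heq)

/-- The Jacobian of a unit extension of the normal takes values in the tangent space. -/
theorem IsNormalExtensionAt.inner_fderiv_eq_zero {Ω : Set (EuclideanSpace ℝ (Fin N))}
    {x : EuclideanSpace ℝ (Fin N)}
    {n : EuclideanSpace ℝ (Fin N) → EuclideanSpace ℝ (Fin N)}
    (hn : IsNormalExtensionAt Ω x n) (v : EuclideanSpace ℝ (Fin N)) :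
    ⟪n x, fderiv ℝ n x v⟫_ℝ = 0 := by
  have hd := (hn.1.differentiableAt (by norm_num)).hasFDerivAt
  have h1 := (hd.norm_sq)
  have h2 : HasFDerivAt (fun y => ‖n y‖ ^ 2) (0 : EuclideanSpace ℝ (Fin N) →L[ℝ] ℝ) x := by
    refine (hasFDerivAt_const (1 : ℝ) x).congr_of_eventuallyEq ?_
    filter_upwards [hn.2] with y hy
    simp [hy.1]
  have h3 := congrArg (fun L => L v) (h1.unique h2)
  simpa using h3

/-- The trace of the Jacobian does not depend on the extension of the normal. -/
theorem IsNormalExtensionAt.trace_fderiv_eq {Ω : Set (EuclideanSpace ℝ (Fin N))}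
    (hΩ : HasC2Boundary Ω) {x : EuclideanSpace ℝ (Fin N)} (hx : x ∈ frontier Ω)
    {n n' : EuclideanSpace ℝ (Fin N) → EuclideanSpace ℝ (Fin N)}
    (hn : IsNormalExtensionAt Ω x n) (hn' : IsNormalExtensionAt Ω x n') :
    LinearMap.trace ℝ (EuclideanSpace ℝ (Fin N)) (fderiv ℝ n x).toLinearMap =
      LinearMap.trace ℝ (EuclideanSpace ℝ (Fin N)) (fderiv ℝ n' x).toLinearMap := by
  set ν := outerNormal Ω x with hν
  have hν1 : ‖ν‖ = 1 := (isOuterUnitNormal_outerNormal hΩ hx).1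
  set w := fderiv ℝ n x ν - fderiv ℝ n' x ν with hw
  have hνw : ⟪ν, w⟫_ℝ = 0 := by
    have h1 := hn.inner_fderiv_eq_zero ν
    have h2 := hn'.inner_fderiv_eq_zero ν
    rw [hn.apply_eq hΩ hx] at h1
    rw [hn'.apply_eq hΩ hx] at h2
    rw [hw, inner_sub_right, h1, h2, sub_zero]
  rw [← sub_eq_zero, ← map_sub]
  have hD : (fderiv ℝ n x).toLinearMap - (fderiv ℝ n' x).toLinearMap =
      (innerSL ℝ ν).toLinearMap.smulRight w := by
    ext1 y
    have h0 : ⟪y - ⟪ν, y⟫_ℝ • ν, ν⟫_ℝ = 0 := by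
      rw [inner_sub_left, inner_smul_left, real_inner_self_eq_norm_sq, hν1, real_inner_comm]
      simp
    have := hn.fderiv_eq_of_inner_eq_zero hΩ hx hn' h0
    simp only [map_sub, map_smul] at this
    simp only [LinearMap.sub_apply, ContinuousLinearMap.coe_coe, LinearMap.smulRight_apply,
      innerSL_apply_apply, hw, smul_sub]
    rw [sub_eq_sub_iff_sub_eq_sub] at this
    rw [this]
  rw [hD, LinearMap.trace_smulRight]
  simpa using hνw

end NeumannRigidity

end

open NeumannRigidity

/-!
The proof computes `∫_Ω (ū - u) |∇²h|²` as a boundary integral. Write `p = ∇u`, `P = ∇h`, `w = ū - u`,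
and let `n` be a global `C¹` field which extends the exterior normal `ν`. Since `Δh = 0`, the field

`V = -w (∇²h) p + (|p|² / 2 - N w + R² / 2) P - ⟨p, P⟩ p + R div (w n ∧ P)`

(`neumannField`) has divergence `w |∇²h|²`. On the boundary, its normal component only contains
second derivatives of `u` in the combination `⟨(∇²u) ∇_Γ u, ν⟩`, and differentiating the Neumann
condition `⟨∇u, ν⟩ = R` along the boundary turns this number into `-⟨(∇ν) ∇_Γ u, ∇_Γ u⟩`. So the
normal component of `V` is the integrand of the given boundary expression (`inner_neumannField`), and
the divergence theorem gives

`∫_Ω (ū - u) |∇²h|² = ½ ∫_Γ |∇_Γ u|² h_ν + ∫_Γ (ū - u) [(N - 1) R H - N] h_ν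
  - ∫_Γ (ū - u) ⟨(∇ν) ∇_Γ u, ∇_Γ u⟩`

(`integral_mul_tr_hessDiff_sq`). If the right side is nonpositive, then `∇²h = 0`, because `u < ū` in
`Ω` by the maximum principle (`lt_maxOnClosure`). Thus `h` is affine and `∇u = x - z₀`, and the
Neumann condition says that `⟨x - z₀, ν⟩ = R` on the boundary. At a boundary point farthest from `z₀`
the vector `x - z₀` is normal, so that all of `Ω` has distance less than `R` from `z₀`, while the
boundary has distance at least `R` (`eq_ball_of_inner_outerNormal_eq`).

Two points need care. As `u` is only of class `C²`, the field `V` is only continuous; its divergence is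
taken in the weak sense (`IsWeakDivergence`), and so is the only identity that involves third
derivatives of `u` (`isWeakDivergence_fderiv_apply`). The divergence theorem for continuous fields with
a continuous weak divergence (`IsWeakDivergence.integral_eq`) is proved by localization to graphs,
where the test function is cut off in the vertical direction and the surface measure is identified by
the area formula (`comap_euclideanHausdorffMeasure`, `setIntegral_graph`).
-/

open scoped MeasureTheory InnerProductSpace Topology

noncomputable section

namespace NeumannRigidity

open MeasureTheory Measure Module Set Filter
open scoped ENNReal NNReal

/-! ### The area formula for expanding `C¹` maps -/

section AreaFormula

/-- If `f` is Lipschitz relative to `g`, then `f` factors on `A` through a Lipschitz map on the image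
of `g`, and the Hausdorff measures of the images compare. -/
theorem hausdorffMeasure_image_le_of_edist_le {X Y Z : Type*} [EMetricSpace X]
    [EMetricSpace Y] [MeasurableSpace Y] [BorelSpace Y]
    [EMetricSpace Z] [MeasurableSpace Z] [BorelSpace Z] {f : X → Y} {g : X → Z} {A : Set X}
    {c : ℝ≥0} (h : ∀ x ∈ A, ∀ y ∈ A, edist (f x) (f y) ≤ c * edist (g x) (g y)) {d : ℝ}
    (hd : 0 ≤ d) : μH[d] (f '' A) ≤ (c : ℝ≥0∞) ^ d * μH[d] (g '' A) := by
  rcases A.eq_empty_or_nonempty with rfl | ⟨a, -⟩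
  · simp
  have : Nonempty X := ⟨a⟩
  set k : Z → Y := f ∘ Function.invFunOn g A with hk
  have hmem : ∀ z ∈ g '' A, Function.invFunOn g A z ∈ A ∧ g (Function.invFunOn g A z) = z :=
    fun z hz => ⟨Function.invFunOn_mem hz, Function.invFunOn_eq hz⟩
  have hlip : LipschitzOnWith c k (g '' A) := by
    intro z hz z' hz'
    have := h _ (hmem z hz).1 _ (hmem z' hz').1
    rwa [(hmem z hz).2, (hmem z' hz').2] at this
  have himg : f '' A ⊆ k '' (g '' A) := by
    rintro _ ⟨x, hx, rfl⟩
    have hgx : g x ∈ g '' A := mem_image_of_mem g hx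
    refine ⟨g x, hgx, ?_⟩
    have := h _ (hmem _ hgx).1 _ hx
    rw [(hmem _ hgx).2, edist_self, mul_zero] at this
    exact edist_eq_zero.1 (le_antisymm this bot_le)
  exact (measure_mono himg).trans (hlip.hausdorffMeasure_image_le hd)

theorem euclideanHausdorffMeasure_image_le_of_edist_le {X Y Z : Type*} [EMetricSpace X]
    [EMetricSpace Y] [MeasurableSpace Y] [BorelSpace Y]
    [EMetricSpace Z] [MeasurableSpace Z] [BorelSpace Z] {f : X → Y} {g : X → Z} {A : Set X}
    {c : ℝ≥0} (h : ∀ x ∈ A, ∀ y ∈ A, edist (f x) (f y) ≤ c * edist (g x) (g y)) (d : ℕ) :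
    μHE[d] (f '' A) ≤ (c : ℝ≥0∞) ^ d * μHE[d] (g '' A) := by
  have := hausdorffMeasure_image_le_of_edist_le h (d := d) (by positivity)
  rw [ENNReal.rpow_natCast] at this
  simp_rw [euclideanHausdorffMeasure_def, Measure.smul_apply, nnreal_smul_coe_apply]
  rw [mul_left_comm]
  gcongr

/-- An inequality between measures can be checked locally. -/
theorem measure_le_of_locally_le {X : Type*} [TopologicalSpace X] [SecondCountableTopology X]
    [MeasurableSpace X] [OpensMeasurableSpace X] {μ ν : Measure X}
    (h : ∀ x, ∃ U ∈ 𝓝 x, ∀ A ⊆ U, MeasurableSet A → μ A ≤ ν A) : μ ≤ ν := by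
  choose U hU hle using h
  obtain ⟨s, hs, hcov⟩ := TopologicalSpace.countable_cover_nhds
    (f := fun x => interior (U x)) (fun x => interior_mem_nhds.2 (hU x))
  refine Measure.le_iff.2 fun A hA => ?_
  have : Countable s := hs.to_subtype
  rcases isEmpty_or_nonempty s with hse | hne
  · have : (univ : Set X) = ∅ := by
      rw [← hcov]; simp [isEmpty_coe_sort.1 hse]
    rw [show A = ∅ from subset_eq_empty (subset_univ A) this]; simp
  obtain ⟨enum, henum⟩ := exists_surjective_nat s
  set D : ℕ → Set X := disjointed fun n => interior (U (enum n)) with hD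
  have hDm : ∀ n, MeasurableSet (D n) :=
    fun n => MeasurableSet.disjointed (fun n => isOpen_interior.measurableSet) n
  have hcovD : ⋃ n, D n = univ := by
    rw [hD, iUnion_disjointed, ← hcov, biUnion_eq_iUnion]
    exact henum.iUnion_comp fun x : s => interior (U x)
  have hAD : A = ⋃ n, A ∩ D n := by rw [← inter_iUnion, hcovD, inter_univ]
  have hdis : Pairwise (Function.onFun Disjoint fun n => A ∩ D n) :=
    fun i j hij => (disjoint_disjointed _ hij).mono inter_subset_right inter_subset_right
  rw [hAD, measure_iUnion hdis fun n => hA.inter (hDm n),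
    measure_iUnion hdis fun n => hA.inter (hDm n)]
  refine ENNReal.tsum_le_tsum fun n => hle (enum n) _ ?_ (hA.inter (hDm n))
  exact inter_subset_right.trans ((disjointed_subset _ n).trans interior_subset)

theorem le_of_forall_one_lt_le_mul {a b : ℝ≥0∞} (h : ∀ c : ℝ≥0, 1 < c → a ≤ c * b) : a ≤ b := by
  have h1 : Tendsto (fun c : ℝ≥0 => (c : ℝ≥0∞) * b) (𝓝[>] 1) (𝓝 (1 * b)) := by
    refine ENNReal.Tendsto.mul_const ?_ (Or.inl one_ne_zero)
    have : Tendsto (fun c : ℝ≥0 => (c : ℝ≥0∞)) (𝓝 1) (𝓝 ((1 : ℝ≥0) : ℝ≥0∞)) :=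
      ENNReal.continuous_coe.tendsto 1
    exact this.mono_left nhdsWithin_le_nhds
  rw [one_mul] at h1
  have : (𝓝[>] (1 : ℝ≥0)).NeBot := nhdsGT_neBot 1
  exact ge_of_tendsto h1 (by filter_upwards [self_mem_nhdsWithin] with c hc using h c hc)

variable {K V : Type*} [NormedAddCommGroup K] [InnerProductSpace ℝ K] [NormedAddCommGroup V]
  [InnerProductSpace ℝ V]

/-- Near a point, an expanding differentiable map is bi-Lipschitz close to its derivative. -/
theorem eventually_bilipschitz {Y : K → V} {L : K →L[ℝ] V} {x₀ : K}
    (hY : HasStrictFDerivAt Y L x₀) (hexp : ∀ x y, ‖x - y‖ ≤ ‖Y x - Y y‖) (hL : ∀ v, ‖v‖ ≤ ‖L v‖)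
    {c : ℝ≥0} (hc : 1 < c) : ∃ U ∈ 𝓝 x₀, ∀ x ∈ U, ∀ y ∈ U,
      edist (Y x) (Y y) ≤ c * edist (L x) (L y) ∧ edist (L x) (L y) ≤ c * edist (Y x) (Y y) := by
  have hc' : (0 : ℝ) < c - 1 := by
    have : (1 : ℝ) < c := by exact_mod_cast hc
    linarith
  have h1 := hY.isLittleO.def hc'
  rw [nhds_prod_eq, Filter.eventually_prod_self_iff'] at h1
  obtain ⟨U, hU, h2⟩ := h1
  refine ⟨U, hU, fun x hx y hy => ?_⟩
  have h3 := h2 x hx y hy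
  simp only at h3
  have e1 : edist (Y x) (Y y) = ENNReal.ofReal ‖Y x - Y y‖ := by
    rw [edist_dist, dist_eq_norm]
  have e2 : edist (L x) (L y) = ENNReal.ofReal ‖L (x - y)‖ := by
    rw [edist_dist, dist_eq_norm, map_sub]
  have e3 : (c : ℝ≥0∞) = ENNReal.ofReal c := by simp
  have h4 := hexp x y
  have h5 := hL (x - y)
  have h6 : ‖Y x - Y y‖ ≤ ‖Y x - Y y - L (x - y)‖ + ‖L (x - y)‖ := by
    simpa using norm_add_le (Y x - Y y - L (x - y)) (L (x - y))
  have h7 : ‖L (x - y)‖ ≤ ‖Y x - Y y‖ + ‖Y x - Y y - L (x - y)‖ := by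
    simpa using norm_sub_le (Y x - Y y) (Y x - Y y - L (x - y))
  rw [e1, e2, e3, ← ENNReal.ofReal_mul (by positivity), ← ENNReal.ofReal_mul (by positivity)]
  constructor <;> apply ENNReal.ofReal_le_ofReal <;> nlinarith

variable [FiniteDimensional ℝ K]

/-- The volume factor of a linear map whose Gram matrix is a rank one perturbation of the identity,
such as the linear parametrization of a graph. -/
theorem normDet_sq_of_inner_eq {ι : Type*} [Fintype ι] [DecidableEq ι] (b : OrthonormalBasis ι ℝ K)
    (L : K →ₗ[ℝ] V) (l : K → ℝ) (h : ∀ v w, ⟪L v, L w⟫_ℝ = ⟪v, w⟫_ℝ + l v * l w) :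
    L.normDet ^ 2 = 1 + ∑ i, l (b i) ^ 2 := by
  have h1 := L.normDet_sq_eq_det_gram b
  have h2 : Matrix.gram ℝ (fun i => L (b i)) = 1 +
      Matrix.replicateCol Unit (fun i => l (b i)) * Matrix.replicateRow Unit (fun i => l (b i)) := by
    ext i j
    simp [Matrix.gram_apply, h, b.inner_eq_ite, Matrix.one_apply, Matrix.mul_apply]
  rw [h2, Matrix.det_one_add_replicateCol_mul_replicateRow] at h1
  simpa [dotProduct, sq] using h1

variable [MeasurableSpace K] [BorelSpace K] [MeasurableSpace V] [BorelSpace V]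

/-- The area formula for an expanding map of class `C¹`. Near each point the map is bi-Lipschitz close
to its derivative, for which the formula is known, and inequalities of measures are local. -/
theorem comap_euclideanHausdorffMeasure {Y : K → V} {Y' : K → K →L[ℝ] V}
    (hY : ∀ x, HasStrictFDerivAt Y (Y' x) x) (hexp : ∀ x y, ‖x - y‖ ≤ ‖Y x - Y y‖)
    (hL : ∀ x v, ‖v‖ ≤ ‖Y' x v‖) (hemb : MeasurableEmbedding Y)
    (hJ : Continuous fun x => (Y' x).toLinearMap.normDet) :
    (μHE[finrank ℝ K] : Measure V).comap Y =
      volume.withDensity fun x => ENNReal.ofReal (Y' x).toLinearMap.normDet := by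
  set d := finrank ℝ K
  set J : K → ℝ := fun x => (Y' x).toLinearMap.normDet with hJdef
  have hJpos : ∀ x, 0 < J x := fun x => by
    refine lt_of_le_of_ne (LinearMap.normDet_nonneg _) (Ne.symm ?_)
    refine ((Y' x).toLinearMap.normDet_ne_zero_tfae.out 0 4).2 ?_
    refine (injective_iff_map_eq_zero _).2 fun v hv => ?_
    have := hL x v
    rw [ContinuousLinearMap.coe_coe] at hv
    rw [hv, norm_zero] at this
    exact norm_le_zero_iff.1 this
  -- both measures are compared with the linear model near a point, up to a factor close to `1`
  have key : ∀ c : ℝ≥0, 1 < c → ∀ x₀, ∃ U ∈ 𝓝 x₀, ∀ A ⊆ U, MeasurableSet A →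
      μHE[d] (Y '' A) ≤ (c : ℝ≥0∞) ^ (d + 1) * ∫⁻ x in A, ENNReal.ofReal (J x) ∧
      ∫⁻ x in A, ENNReal.ofReal (J x) ≤ (c : ℝ≥0∞) ^ (d + 1) * μHE[d] (Y '' A) := by
    intro c hc x₀
    obtain ⟨U, hU, hbi⟩ := eventually_bilipschitz (hY x₀) hexp (hL x₀) hc
    have hc1 : (1 : ℝ) < c := by exact_mod_cast hc
    have hlt : J x₀ < c * J x₀ := by nlinarith [hJpos x₀]
    have hlt' : (c : ℝ)⁻¹ * J x₀ < J x₀ := by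
      have : (c : ℝ)⁻¹ < 1 := inv_lt_one_of_one_lt₀ hc1
      nlinarith [hJpos x₀]
    have hV : ∀ᶠ x in 𝓝 x₀, J x < c * J x₀ ∧ (c : ℝ)⁻¹ * J x₀ < J x :=
      (hJ.continuousAt.eventually_lt_const hlt).and (hJ.continuousAt.eventually_const_lt hlt')
    refine ⟨U ∩ {x | J x < c * J x₀ ∧ (c : ℝ)⁻¹ * J x₀ < J x}, inter_mem hU hV,
      fun A hA hAm => ?_⟩
    have hlin : μHE[d] (Y' x₀ '' A) = ENNReal.ofReal (J x₀) * volume A :=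
      (Y' x₀).toLinearMap.euclideanHausdorffMeasure_image_eq_normDet_mul_volume A
    have hcc : (c : ℝ≥0∞) = ENNReal.ofReal c := by simp
    have i1 : ENNReal.ofReal (J x₀) * volume A ≤ c * ∫⁻ x in A, ENNReal.ofReal (J x) := by
      rw [← setLIntegral_const, ← lintegral_const_mul _ hJ.measurable.ennreal_ofReal]
      refine setLIntegral_mono' hAm fun x hx => ?_
      rw [hcc, ← ENNReal.ofReal_mul (by positivity)]
      apply ENNReal.ofReal_le_ofReal
      have := (hA hx).2.2
      rw [inv_mul_lt_iff₀ (by positivity)] at this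
      exact this.le
    have i2 : ∫⁻ x in A, ENNReal.ofReal (J x) ≤ c * (ENNReal.ofReal (J x₀) * volume A) := by
      rw [← mul_assoc, ← setLIntegral_const]
      refine setLIntegral_mono' hAm fun x hx => ?_
      rw [hcc, ← ENNReal.ofReal_mul (by positivity)]
      exact ENNReal.ofReal_le_ofReal (hA hx).2.1.le
    have j1 : μHE[d] (Y '' A) ≤ (c : ℝ≥0∞) ^ d * μHE[d] (Y' x₀ '' A) :=
      euclideanHausdorffMeasure_image_le_of_edist_le
        (fun x hx y hy => (hbi x (hA hx).1 y (hA hy).1).1) d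
    have j2 : μHE[d] (Y' x₀ '' A) ≤ (c : ℝ≥0∞) ^ d * μHE[d] (Y '' A) :=
      euclideanHausdorffMeasure_image_le_of_edist_le
        (fun x hx y hy => (hbi x (hA hx).1 y (hA hy).1).2) d
    rw [hlin] at j1 j2
    constructor
    · calc μHE[d] (Y '' A) ≤ (c : ℝ≥0∞) ^ d * (ENNReal.ofReal (J x₀) * volume A) := j1
        _ ≤ (c : ℝ≥0∞) ^ d * (c * ∫⁻ x in A, ENNReal.ofReal (J x)) := by gcongr
        _ = _ := by rw [pow_succ, mul_assoc]
    · calc ∫⁻ x in A, ENNReal.ofReal (J x) ≤ c * (ENNReal.ofReal (J x₀) * volume A) := i2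
        _ ≤ c * ((c : ℝ≥0∞) ^ d * μHE[d] (Y '' A)) := by gcongr
        _ = _ := by rw [pow_succ']; ring
  have hglob : ∀ c : ℝ≥0, 1 < c →
      (μHE[d] : Measure V).comap Y ≤
        (c : ℝ≥0∞) ^ (d + 1) • volume.withDensity (fun x => ENNReal.ofReal (J x)) ∧
      volume.withDensity (fun x => ENNReal.ofReal (J x)) ≤
        (c : ℝ≥0∞) ^ (d + 1) • (μHE[d] : Measure V).comap Y := by
    intro c hc
    constructor <;> refine measure_le_of_locally_le fun x₀ => ?_
    all_goals
      obtain ⟨U, hU, h⟩ := key c hc x₀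
      refine ⟨U, hU, fun A hA hAm => ?_⟩
      rw [Measure.smul_apply, smul_eq_mul, hemb.comap_apply, withDensity_apply _ hAm]
    exacts [(h A hA hAm).1, (h A hA hAm).2]
  have hroot : ∀ c : ℝ≥0, 1 < c → ∃ b : ℝ≥0, 1 < b ∧ b ^ (d + 1) ≤ c := by
    intro c hc
    refine ⟨c ^ ((1 : ℝ) / (d + 1 : ℕ)), NNReal.one_lt_rpow hc (by positivity), ?_⟩
    rw [← NNReal.rpow_natCast, ← NNReal.rpow_mul, one_div, inv_mul_cancel₀ (by positivity),
      NNReal.rpow_one]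
  refine le_antisymm (Measure.le_iff.2 fun A _ => ?_) (Measure.le_iff.2 fun A _ => ?_) <;>
  · refine le_of_forall_one_lt_le_mul fun c hc => ?_
    obtain ⟨b, hb, hbc⟩ := hroot c hc
    have hbc' : (b : ℝ≥0∞) ^ (d + 1) ≤ c := by exact_mod_cast hbc
    first
    | exact ((hglob b hb).1 A).trans (by rw [Measure.smul_apply, smul_eq_mul]; gcongr)
    | exact ((hglob b hb).2 A).trans (by rw [Measure.smul_apply, smul_eq_mul]; gcongr)

end AreaFormula

/-! ### Graphs over hyperplanes and their surface measure -/

section Graph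

variable {E : Type*} [NormedAddCommGroup E] [InnerProductSpace ℝ E]

/-- The point at height `g y - t` above the point `y` of the hyperplane orthogonal to `e`. For
`t = 0` it runs through the graph of `g`, and `t` is the vertical distance to the graph. -/
def layerMap (e : E) (g : E → ℝ) (p : (ℝ ∙ e)ᗮ × ℝ) : E := (p.1 : E) + (g p.1 - p.2) • e

theorem inner_coe_orthogonal (e : E) (y : (ℝ ∙ e)ᗮ) : ⟪e, (y : E)⟫_ℝ = 0 :=
  Submodule.mem_orthogonal_singleton_iff_inner_right.1 y.2

theorem inner_layerMap {e : E} (he : ‖e‖ = 1) (g : E → ℝ) (p : (ℝ ∙ e)ᗮ × ℝ) :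
    ⟪e, layerMap e g p⟫_ℝ = g p.1 - p.2 := by
  simp [layerMap, inner_add_right, inner_coe_orthogonal, inner_smul_right, he]

theorem apply_layerMap {e : E} {g : E → ℝ} (hinv : ∀ (y : E) (t : ℝ), g (y + t • e) = g y)
    (p : (ℝ ∙ e)ᗮ × ℝ) : g (layerMap e g p) = g p.1 := hinv _ _

theorem continuous_layerMap (e : E) {g : E → ℝ} (hg : Continuous g) :
    Continuous (layerMap e g) := by
  unfold layerMap; fun_prop

theorem layerMap_projection {e : E} (he : ‖e‖ = 1) {g : E → ℝ}
    (hinv : ∀ (y : E) (t : ℝ), g (y + t • e) = g y) (x : E) :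
    ∃ y : (ℝ ∙ e)ᗮ, (y : E) = x - ⟪e, x⟫_ℝ • e ∧ layerMap e g (y, g x - ⟪e, x⟫_ℝ) = x := by
  have hmem : x - ⟪e, x⟫_ℝ • e ∈ (ℝ ∙ e)ᗮ := by
    rw [Submodule.mem_orthogonal_singleton_iff_inner_right]
    simp [inner_sub_right, inner_smul_right, he]
  refine ⟨⟨_, hmem⟩, rfl, ?_⟩
  have : g (x - ⟪e, x⟫_ℝ • e) = g x := by
    have := hinv x (-⟪e, x⟫_ℝ)
    rwa [neg_smul, ← sub_eq_add_neg] at this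
  simp [layerMap, this]

theorem norm_sub_le_norm_layerMap_sub (e : E) (g : E → ℝ) (p q : (ℝ ∙ e)ᗮ × ℝ) :
    ‖p.1 - q.1‖ ≤ ‖layerMap e g p - layerMap e g q‖ := by
  have h : layerMap e g p - layerMap e g q =
      ((p.1 - q.1 : (ℝ ∙ e)ᗮ) : E) + ((g p.1 - p.2) - (g q.1 - q.2)) • e := by
    simp only [layerMap, Submodule.coe_sub, sub_smul]; abel
  have h2 : ⟪((p.1 - q.1 : (ℝ ∙ e)ᗮ) : E), ((g p.1 - p.2) - (g q.1 - q.2)) • e⟫_ℝ = 0 := by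
    rw [inner_smul_right, real_inner_comm, inner_coe_orthogonal, mul_zero]
  have h3 := norm_add_sq_eq_norm_sq_add_norm_sq_real h2
  rw [← h] at h3
  change ‖((p.1 - q.1 : (ℝ ∙ e)ᗮ) : E)‖ ≤ _
  nlinarith [norm_nonneg (layerMap e g p - layerMap e g q),
    norm_nonneg ((p.1 - q.1 : (ℝ ∙ e)ᗮ) : E),
    mul_self_nonneg ‖((g p.1 - p.2) - (g q.1 - q.2)) • e‖]

variable [FiniteDimensional ℝ E] [MeasurableSpace E] [BorelSpace E]

/-- By Fubini, a vertical shear and a vertical reflection preserve the volume. -/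
theorem measurePreserving_layerMap {e : E} (he : ‖e‖ = 1) {g : E → ℝ} (hg : Continuous g) :
    MeasurePreserving (layerMap e g) volume volume := by
  set I : ℝ ≃ₗᵢ[ℝ] (ℝ ∙ e) := LinearIsometryEquiv.toSpanUnitSingleton e he
  have h1 := ((ℝ ∙ e).measurePreserving_measurableEquivProd (0 : E)).symm
  rw [InnerProductSpace.euclideanHausdorffMeasure_eq_volume] at h1
  have h2 : MeasurePreserving (fun p : (ℝ ∙ e)ᗮ × ℝ => (p.1, g p.1 - p.2))
      (volume.prod volume) (volume.prod volume) :=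
    (MeasurePreserving.id (volume : Measure (ℝ ∙ e)ᗮ)).skew_product (g := fun a t => g a - t)
      (by unfold Function.uncurry; fun_prop)
      (ae_of_all _ fun a => (Measure.measurePreserving_sub_left volume (g a)).map_eq)
  have h3 := (MeasurePreserving.id (volume : Measure (ℝ ∙ e)ᗮ)).prod I.measurePreserving
  have h4 : MeasurePreserving (Prod.swap : (ℝ ∙ e)ᗮ × (ℝ ∙ e) → (ℝ ∙ e) × (ℝ ∙ e)ᗮ)
    (volume.prod volume) (volume.prod volume) := Measure.measurePreserving_swap
  have := h1.comp (h4.comp (h3.comp h2))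
  convert! this using 1
  ext p
  simp [layerMap, I, LinearIsometryEquiv.toSpanUnitSingleton, add_comm]

theorem measurableEmbedding_layerMap {e : E} (he : ‖e‖ = 1) {g : E → ℝ} (hg : Continuous g) :
    MeasurableEmbedding (layerMap e g) := by
  refine (continuous_layerMap e hg).measurableEmbedding fun p q h => ?_
  have h1 : p.1 = q.1 := by
    have := norm_sub_le_norm_layerMap_sub e g p q
    rw [h, sub_self, norm_zero] at this
    exact sub_eq_zero.1 (norm_le_zero_iff.1 this)
  have h2 := congrArg (fun x => ⟪e, x⟫_ℝ) h
  simp only [inner_layerMap he, h1] at h2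
  exact Prod.ext h1 (by linarith)

theorem integral_eq_mul_integral_layerMap {e : E} (he : ‖e‖ = 1) {g : E → ℝ} (hg : Continuous g)
    {ε : ℝ} (hε : 0 < ε) (φ : E → ℝ) :
    ∫ x, φ x = ε * ∫ p : (ℝ ∙ e)ᗮ × ℝ, φ (layerMap e g (p.1, ε * p.2)) := by
  have hm : MeasurableEmbedding (Prod.map id (ε * ·) : (ℝ ∙ e)ᗮ × ℝ → (ℝ ∙ e)ᗮ × ℝ) :=
    ((Homeomorph.refl _).prodCongr (Homeomorph.mulLeft₀ ε hε.ne')).measurableEmbedding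
  have hmap : Measure.map (Prod.map id (ε * ·)) (volume : Measure ((ℝ ∙ e)ᗮ × ℝ)) =
      ENNReal.ofReal ε⁻¹ • (volume : Measure ((ℝ ∙ e)ᗮ × ℝ)) := by
    rw [Measure.volume_eq_prod, ← map_prod_map _ _ measurable_id (by fun_prop), Measure.map_id,
      Real.map_volume_mul_left hε.ne', prod_smul_right, abs_of_pos (inv_pos.2 hε)]
  rw [← (measurePreserving_layerMap he hg).integral_comp (measurableEmbedding_layerMap he hg) φ]
  have h := hm.integral_map (μ := volume) fun p : (ℝ ∙ e)ᗮ × ℝ => φ (layerMap e g p)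
  rw [hmap, integral_smul_measure, ENNReal.toReal_ofReal (by positivity)] at h
  simp only [Prod.map, id] at h
  rw [← h, smul_eq_mul, mul_inv_cancel_left₀ hε.ne']

/-- The derivative of the parametrization of the graph of `g`. -/
def graphDeriv (e : E) (g : E → ℝ) (y : (ℝ ∙ e)ᗮ) : (ℝ ∙ e)ᗮ →L[ℝ] E :=
  (ℝ ∙ e)ᗮ.subtypeL + ((fderiv ℝ g y).comp (ℝ ∙ e)ᗮ.subtypeL).smulRight e

omit [FiniteDimensional ℝ E] [MeasurableSpace E] [BorelSpace E] in
theorem hasStrictFDerivAt_graph (e : E) {g : E → ℝ} (hg : ContDiff ℝ 1 g) (y : (ℝ ∙ e)ᗮ) :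
    HasStrictFDerivAt (fun y : (ℝ ∙ e)ᗮ => layerMap e g (y, 0)) (graphDeriv e g y) y := by
  have h1 : HasStrictFDerivAt g (fderiv ℝ g y) (y : E) :=
    hg.contDiffAt.hasStrictFDerivAt one_ne_zero
  have h2 : HasStrictFDerivAt (fun y : (ℝ ∙ e)ᗮ => (y : E)) (ℝ ∙ e)ᗮ.subtypeL y :=
    (ℝ ∙ e)ᗮ.subtypeL.hasStrictFDerivAt
  have h3 := h2.add ((h1.comp y h2).smul_const e)
  simp only [layerMap, sub_zero]
  exact h3

omit [MeasurableSpace E] [BorelSpace E] in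
theorem inner_gradient_eq_zero_of_invariant {e : E} {g : E → ℝ} (hg : ContDiff ℝ 1 g)
    (hinv : ∀ (y : E) (t : ℝ), g (y + t • e) = g y) (y : E) : ⟪gradient g y, e⟫_ℝ = 0 := by
  have hd : DifferentiableAt ℝ g y := (hg.differentiable one_ne_zero) y
  have h1 : HasLineDerivAt ℝ g (fderiv ℝ g y e) y e := hd.hasFDerivAt.hasLineDerivAt e
  have h2 : HasLineDerivAt ℝ g 0 y e := by
    unfold HasLineDerivAt
    simp only [hinv]
    exact hasDerivAt_const _ _
  rw [gradient, InnerProductSpace.toDual_symm_apply, HasDerivAt.unique h1 h2]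

omit [MeasurableSpace E] [BorelSpace E] in
theorem sub_gradient_ne_zero {e : E} (he : ‖e‖ = 1) {g : E → ℝ} (hg : ContDiff ℝ 1 g)
    (hinv : ∀ (y : E) (t : ℝ), g (y + t • e) = g y) (y : E) : e - gradient g y ≠ 0 := by
  intro h
  have h1 := inner_gradient_eq_zero_of_invariant hg hinv y
  rw [← sub_eq_zero.1 h, real_inner_self_eq_norm_sq, he] at h1
  norm_num at h1

omit [MeasurableSpace E] [BorelSpace E] in
/-- The area element `√(1 + |∇g|²)` of the graph of `g`. -/
theorem normDet_graphDeriv {e : E} (he : ‖e‖ = 1) {g : E → ℝ} (hg : ContDiff ℝ 1 g)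
    (hinv : ∀ (y : E) (t : ℝ), g (y + t • e) = g y) (y : (ℝ ∙ e)ᗮ) :
    (graphDeriv e g y).toLinearMap.normDet = ‖e - gradient g (y : E)‖ := by
  set G := gradient g (y : E) with hG
  have hGe : ⟪G, e⟫_ℝ = 0 := inner_gradient_eq_zero_of_invariant hg hinv y
  have hGf : ∀ v : E, fderiv ℝ g y v = ⟪v, G⟫_ℝ := fun v => by
    rw [real_inner_comm, hG, gradient, InnerProductSpace.toDual_symm_apply]
  have hGmem : G ∈ (ℝ ∙ e)ᗮ := by
    rw [Submodule.mem_orthogonal_singleton_iff_inner_right, real_inner_comm]; exact hGe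
  have hL : ∀ v : (ℝ ∙ e)ᗮ, (graphDeriv e g y).toLinearMap v = (v : E) + ⟪(v : E), G⟫_ℝ • e :=
    fun v => by simp [graphDeriv, hGf]
  have h1 := normDet_sq_of_inner_eq (stdOrthonormalBasis ℝ (ℝ ∙ e)ᗮ)
    (graphDeriv e g y).toLinearMap (fun v => ⟪(v : E), G⟫_ℝ) (fun v w => by
      rw [hL, hL]
      simp only [inner_add_left, inner_add_right, inner_smul_left, inner_smul_right,
        real_inner_self_eq_norm_sq, he, inner_coe_orthogonal,
        real_inner_comm e (v : E), Submodule.coe_inner]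
      simp
      ring)
  have h2 : ∑ i, ⟪((stdOrthonormalBasis ℝ (ℝ ∙ e)ᗮ i : (ℝ ∙ e)ᗮ) : E), G⟫_ℝ ^ 2 = ‖G‖ ^ 2 := by
    have := (stdOrthonormalBasis ℝ (ℝ ∙ e)ᗮ).sum_sq_norm_inner_right ⟨G, hGmem⟩
    simpa [Submodule.coe_inner] using this
  have h3 : ‖e - G‖ ^ 2 = 1 + ‖G‖ ^ 2 := by
    rw [norm_sub_sq_real, he, real_inner_comm, hGe]; ring
  rw [h2, ← h3] at h1
  exact (sq_eq_sq₀ (LinearMap.normDet_nonneg _) (norm_nonneg _)).1 h1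

omit [MeasurableSpace E] [BorelSpace E] in
theorem continuous_gradient {g : E → ℝ} (hg : ContDiff ℝ 1 g) : Continuous (gradient g) :=
  (InnerProductSpace.toDual ℝ E).symm.continuous.comp (hg.continuous_fderiv one_ne_zero)

omit [FiniteDimensional ℝ E] [MeasurableSpace E] [BorelSpace E] in
theorem range_graph {e : E} (he : ‖e‖ = 1) {g : E → ℝ}
    (hinv : ∀ (y : E) (t : ℝ), g (y + t • e) = g y) :
    range (fun y : (ℝ ∙ e)ᗮ => layerMap e g (y, 0)) = {x | ⟪e, x⟫_ℝ = g x} := by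
  ext x
  constructor
  · rintro ⟨y, rfl⟩
    simp [inner_layerMap he, apply_layerMap hinv]
  · intro hx
    obtain ⟨y, -, hy⟩ := layerMap_projection he hinv x
    rw [show g x - ⟪e, x⟫_ℝ = 0 from sub_eq_zero.2 (Eq.symm hx)] at hy
    exact ⟨y, hy⟩

theorem measurableEmbedding_graph (e : E) {g : E → ℝ} (hg : Continuous g) :
    MeasurableEmbedding fun y : (ℝ ∙ e)ᗮ => layerMap e g (y, 0) := by
  refine ((continuous_layerMap e hg).comp (by fun_prop)).measurableEmbedding fun y z h => ?_
  have := norm_sub_le_norm_layerMap_sub e g (y, 0) (z, 0)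
  rw [show layerMap e g (y, 0) = layerMap e g (z, 0) from h, sub_self, norm_zero] at this
  exact sub_eq_zero.1 (norm_le_zero_iff.1 this)

/-- The surface measure of a graph in terms of its parametrization over a hyperplane. -/
theorem restrict_graph_euclideanHausdorffMeasure {e : E} (he : ‖e‖ = 1) {g : E → ℝ}
    (hg : ContDiff ℝ 1 g) (hinv : ∀ (y : E) (t : ℝ), g (y + t • e) = g y) :
    (μHE[finrank ℝ E - 1] : Measure E).restrict {x | ⟪e, x⟫_ℝ = g x} =
      Measure.map (fun y : (ℝ ∙ e)ᗮ => layerMap e g (y, 0))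
        (volume.withDensity fun y => ENNReal.ofReal ‖e - gradient g (y : E)‖) := by
  have hd : finrank ℝ E - 1 = finrank ℝ (ℝ ∙ e)ᗮ := by
    have h1 := (ℝ ∙ e).finrank_add_finrank_orthogonal
    rw [finrank_span_singleton (norm_ne_zero_iff.1 (by rw [he]; exact one_ne_zero))] at h1
    omega
  have hemb := measurableEmbedding_graph e hg.continuous
  have hnd : ∀ y, (graphDeriv e g y).toLinearMap.normDet = ‖e - gradient g (y : E)‖ :=
    normDet_graphDeriv he hg hinv
  have := comap_euclideanHausdorffMeasure (hasStrictFDerivAt_graph e hg)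
    (fun y z => norm_sub_le_norm_layerMap_sub e g (y, 0) (z, 0)) (fun y v => by
      have h := norm_sub_le_norm_layerMap_sub e (fderiv ℝ g y) (v, 0) (0, 0)
      simpa [layerMap, graphDeriv] using h) hemb (by
      simp only [hnd]
      exact (continuous_const.sub ((continuous_gradient hg).comp continuous_subtype_val)).norm)
  simp only [hnd] at this
  rw [hd, ← range_graph he hinv, ← hemb.map_comap, this]

theorem setIntegral_graph {e : E} (he : ‖e‖ = 1) {g : E → ℝ}
    (hg : ContDiff ℝ 1 g) (hinv : ∀ (y : E) (t : ℝ), g (y + t • e) = g y) (φ : E → ℝ) :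
    ∫ x in {x | ⟪e, x⟫_ℝ = g x}, φ x ∂μHE[finrank ℝ E - 1] =
      ∫ y : (ℝ ∙ e)ᗮ, ‖e - gradient g (y : E)‖ * φ (layerMap e g (y, 0)) := by
  rw [restrict_graph_euclideanHausdorffMeasure he hg hinv,
    (measurableEmbedding_graph e hg.continuous).integral_map,
    integral_withDensity_eq_integral_toReal_smul _ (by simp)]
  · simp
  · exact ((continuous_const.sub
      ((continuous_gradient hg).comp continuous_subtype_val)).norm).measurable.ennreal_ofReal

/-- Bounded pieces of a graph have finite surface measure. -/
theorem euclideanHausdorffMeasure_graph_inter_closedBall_lt_top {e : E} (he : ‖e‖ = 1) {g : E → ℝ}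
    (hg : ContDiff ℝ 1 g) (hinv : ∀ (y : E) (t : ℝ), g (y + t • e) = g y) (r : ℝ) :
    (μHE[finrank ℝ E - 1] : Measure E) (Metric.closedBall 0 r ∩ {x | ⟪e, x⟫_ℝ = g x}) < ∞ := by
  have hc : Continuous fun y : (ℝ ∙ e)ᗮ => ‖e - gradient g (y : E)‖ :=
    (continuous_const.sub ((continuous_gradient hg).comp continuous_subtype_val)).norm
  have hY : Continuous fun y : (ℝ ∙ e)ᗮ => layerMap e g (y, 0) :=
    (continuous_layerMap e hg.continuous).comp (by fun_prop)
  rw [← Measure.restrict_apply Metric.isClosed_closedBall.measurableSet,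
    restrict_graph_euclideanHausdorffMeasure he hg hinv,
    Measure.map_apply hY.measurable Metric.isClosed_closedBall.measurableSet]
  have hsub : (fun y : (ℝ ∙ e)ᗮ => layerMap e g (y, 0)) ⁻¹' Metric.closedBall 0 r ⊆
      Metric.closedBall 0 (r + ‖layerMap e g (0, 0)‖) := by
    intro y hy
    have h1 := norm_sub_le_norm_layerMap_sub e g (y, 0) (0, 0)
    have h2 := norm_sub_le (layerMap e g (y, 0)) (layerMap e g (0, 0))
    rw [mem_preimage, mem_closedBall_zero_iff] at hy
    rw [mem_closedBall_zero_iff]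
    simp only [sub_zero] at h1
    linarith
  refine (measure_mono hsub).trans_lt ?_
  rw [withDensity_apply _ Metric.isClosed_closedBall.measurableSet]
  have : IntegrableOn (fun y : (ℝ ∙ e)ᗮ => ‖e - gradient g (y : E)‖)
      (Metric.closedBall 0 (r + ‖layerMap e g (0, 0)‖)) :=
    hc.continuousOn.integrableOn_compact (isCompact_closedBall _ _)
  exact this.lintegral_lt_top

end Graph

/-! ### Weak divergence and the divergence theorem near a boundary point -/

section WeakDivergence

variable {E : Type*} [NormedAddCommGroup E] [InnerProductSpace ℝ E]

/-- The function `f` is the divergence of the vector field `F` in the open set `Ω` in the weak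
sense, tested against compactly supported functions of class `C²`. -/
def IsWeakDivergence [MeasureSpace E] (Ω : Set E) (F : E → E) (f : E → ℝ) : Prop :=
  ∀ η : E → ℝ, ContDiff ℝ 2 η → HasCompactSupport η → tsupport η ⊆ Ω →
    ∫ x in Ω, (η x * f x + fderiv ℝ η x (F x)) = 0

/-- A smooth step function which vanishes on `(-∞, 1]` and equals `1` on `[2, ∞)`. -/
def smoothStep (t : ℝ) : ℝ := Real.smoothTransition (t - 1)

theorem contDiff_smoothStep {n : ℕ∞} : ContDiff ℝ n smoothStep :=
  Real.smoothTransition.contDiff.comp (contDiff_id.sub contDiff_const)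

theorem smoothStep_of_le_one {t : ℝ} (h : t ≤ 1) : smoothStep t = 0 :=
  Real.smoothTransition.zero_of_nonpos (by linarith)

theorem smoothStep_of_two_le {t : ℝ} (h : 2 ≤ t) : smoothStep t = 1 :=
  Real.smoothTransition.one_of_one_le (by linarith)

theorem smoothStep_nonneg (t : ℝ) : 0 ≤ smoothStep t := Real.smoothTransition.nonneg _

theorem smoothStep_le_one (t : ℝ) : smoothStep t ≤ 1 := Real.smoothTransition.le_one _

theorem hasDerivAt_smoothStep (t : ℝ) : HasDerivAt smoothStep (deriv smoothStep t) t :=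
  ((contDiff_smoothStep (n := 1)).differentiable (by norm_num) t).hasDerivAt

theorem continuous_deriv_smoothStep : Continuous (deriv smoothStep) :=
  (contDiff_smoothStep (n := 1)).continuous_deriv (by norm_num)

theorem deriv_smoothStep_of_lt_one {t : ℝ} (h : t < 1) : deriv smoothStep t = 0 := by
  have : smoothStep =ᶠ[𝓝 t] fun _ => 0 := by
    filter_upwards [eventually_lt_nhds h] with s hs using smoothStep_of_le_one hs.le
  rw [this.deriv_eq, deriv_const]

theorem deriv_smoothStep_of_two_lt {t : ℝ} (h : 2 < t) : deriv smoothStep t = 0 := by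
  have : smoothStep =ᶠ[𝓝 t] fun _ => 1 := by
    filter_upwards [eventually_gt_nhds h] with s hs using smoothStep_of_two_le hs.le
  rw [this.deriv_eq, deriv_const]

theorem integrable_deriv_smoothStep : Integrable (deriv smoothStep) := by
  refine continuous_deriv_smoothStep.integrable_of_hasCompactSupport
    (HasCompactSupport.intro (isCompact_Icc (a := (1 : ℝ)) (b := 2)) fun t ht => ?_)
  rw [mem_Icc, not_and_or, not_le, not_le] at ht
  exact ht.elim deriv_smoothStep_of_lt_one deriv_smoothStep_of_two_lt

theorem integral_deriv_smoothStep : ∫ t, deriv smoothStep t = 1 := by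
  have := integral_of_hasDerivAt_of_tendsto hasDerivAt_smoothStep integrable_deriv_smoothStep
    (m := 0) (n := 1)
    (tendsto_const_nhds.congr' (by
      filter_upwards [eventually_le_atBot 1] with t ht using (smoothStep_of_le_one ht).symm))
    (tendsto_const_nhds.congr' (by
      filter_upwards [eventually_ge_atTop 2] with t ht using (smoothStep_of_two_le ht).symm))
  rw [this, sub_zero]

theorem tendsto_smoothStep_div {r : ℝ} (hr : 0 < r) :
    Tendsto (fun ε : ℝ => smoothStep (r / ε)) (𝓝[>] 0) (𝓝 1) := by
  refine tendsto_const_nhds.congr' ?_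
  have : ∀ᶠ ε : ℝ in 𝓝[>] 0, ε < r / 2 := (eventually_lt_nhds (half_pos hr)).filter_mono
    nhdsWithin_le_nhds
  filter_upwards [this, self_mem_nhdsWithin] with ε h1 h2
  have h2 : 0 < ε := h2
  rw [smoothStep_of_two_le]
  rw [le_div_iff₀ h2]; linarith

variable [FiniteDimensional ℝ E] [MeasurableSpace E] [BorelSpace E]

omit [MeasurableSpace E] [BorelSpace E] in
theorem gradient_layerMap {e : E} {g : E → ℝ}
    (hinv : ∀ (y : E) (t : ℝ), g (y + t • e) = g y) (p : (ℝ ∙ e)ᗮ × ℝ) :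
    gradient g (layerMap e g p) = gradient g (p.1 : E) := by
  have h : (fun x => g (x + (g p.1 - p.2) • e)) = g := funext fun x => hinv x _
  rw [gradient, gradient, layerMap, ← fderiv_comp_add_right, h]

omit [MeasurableSpace E] [BorelSpace E] in
theorem fderiv_graph_sub_inner {e : E} {g : E → ℝ} (hg : ContDiff ℝ 1 g) (x : E) :
    HasFDerivAt (fun y => g y - ⟪e, y⟫_ℝ) (-innerSL ℝ (e - gradient g x)) x := by
  have h1 := ((hg.differentiable one_ne_zero) x).hasFDerivAt
  have h2 := (innerSL ℝ e).hasFDerivAt (x := x)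
  convert! h1.sub h2 using 1
  ext v
  simp [gradient]

/-- The divergence theorem near a boundary point. The test function is cut off by a smooth step in
the vertical distance to the graph; the derivative of the step concentrates on the graph. -/
theorem IsWeakDivergence.integral_eq_integral_graph {Ω : Set E} {F : E → E} {f : E → ℝ}
    (hF : IsWeakDivergence Ω F f) (hΩ : IsOpen Ω) (hb : Bornology.IsBounded Ω)
    (hFc : ContinuousOn F (closure Ω)) (hfc : ContinuousOn f (closure Ω))
    {e : E} (he : ‖e‖ = 1) {g : E → ℝ} (hg : ContDiff ℝ 2 g)
    (hinv : ∀ (y : E) (t : ℝ), g (y + t • e) = g y) {V : Set E} (hV : IsOpen V)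
    (hVΩ : ∀ y ∈ V, (y ∈ Ω ↔ ⟪e, y⟫_ℝ < g y)) {θ : E → ℝ} (hθ : ContDiff ℝ 2 θ)
    (hθc : HasCompactSupport θ) (hθV : tsupport θ ⊆ V) :
    ∫ x in Ω, (θ x * f x + fderiv ℝ θ x (F x)) =
      ∫ x in {x | ⟪e, x⟫_ℝ = g x},
        θ x * ⟪F x, ‖e - gradient g x‖⁻¹ • (e - gradient g x)⟫_ℝ ∂μHE[finrank ℝ E - 1] := by
  have hg1 : ContDiff ℝ 1 g := hg.of_le (by norm_num)
  have hcpt : IsCompact (closure Ω) := hb.isCompact_closure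
  set ρ : E → ℝ := fun y => g y - ⟪e, y⟫_ℝ with hρ
  have hρC : ContDiff ℝ 2 ρ := hg.sub (innerSL ℝ e).contDiff
  have hρl : ∀ p, ρ (layerMap e g p) = p.2 := fun p => by
    simp only [hρ]
    rw [apply_layerMap hinv, inner_layerMap he]; ring
  set a : E → ℝ := fun x => θ x * f x + fderiv ℝ θ x (F x) with ha
  have hθ' : Continuous (fderiv ℝ θ) := hθ.continuous_fderiv (by norm_num)
  have hac : ContinuousOn a (closure Ω) :=
    (hθ.continuous.continuousOn.mul hfc).add (hθ'.continuousOn.clm_apply hFc)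
  have hai : IntegrableOn a Ω := (hac.integrableOn_compact hcpt).mono_set subset_closure
  have hGc : Continuous fun x => e - gradient g x :=
    continuous_const.sub (continuous_gradient hg1)
  set Ψ : E → ℝ := fun x => θ x * ⟪e - gradient g x, F x⟫_ℝ with hΨ
  have hΨc : ContinuousOn Ψ (closure Ω) :=
    hθ.continuous.continuousOn.mul (hGc.continuousOn.inner hFc)
  -- the identity for the test function `θ * smoothStep (ρ / ε)`
  have hid : ∀ ε : ℝ, 0 < ε → ∫ x in Ω, smoothStep (ρ x / ε) * a x =
      ∫ p : (ℝ ∙ e)ᗮ × ℝ, Ω.indicator Ψ (layerMap e g (p.1, ε * p.2)) * deriv smoothStep p.2 := by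
    intro ε hε
    have hsC : ContDiff ℝ 2 fun x => smoothStep (ρ x / ε) :=
      (contDiff_smoothStep (n := 2)).comp (hρC.div_const ε)
    have hsd : ∀ x, HasFDerivAt (fun x => smoothStep (ρ x / ε))
        ((deriv smoothStep (ρ x / ε) * ε⁻¹) • -innerSL ℝ (e - gradient g x)) x := fun x => by
      have h1 := (fderiv_graph_sub_inner (e := e) hg1 x).const_mul ε⁻¹
      have h2 : HasFDerivAt (fun x => ρ x / ε) (ε⁻¹ • -innerSL ℝ (e - gradient g x)) x := by
        simpa [div_eq_inv_mul] using h1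
      have h3 := (hasDerivAt_smoothStep (ρ x / ε)).comp_hasFDerivAt x h2
      rw [smul_smul] at h3
      exact h3
    have hsupp : tsupport (fun x => θ x * smoothStep (ρ x / ε)) ⊆ tsupport θ ∩ {x | ε ≤ ρ x} := by
      refine closure_minimal (fun x hx => ?_)
        ((isClosed_tsupport θ).inter (isClosed_le continuous_const hρC.continuous))
      rw [Function.mem_support] at hx
      refine ⟨subset_tsupport _ (left_ne_zero_of_mul hx), ?_⟩
      by_contra hc
      refine right_ne_zero_of_mul hx (smoothStep_of_le_one ?_)
      rw [div_le_one hε]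
      exact (not_le.1 hc).le
    have hz := hF (fun x => θ x * smoothStep (ρ x / ε)) (hθ.mul hsC) hθc.mul_right
      (hsupp.trans fun x hx => (hVΩ x (hθV hx.1)).2 (by
        have : ε ≤ g x - ⟪e, x⟫_ℝ := hx.2
        linarith))
    have hpt : ∀ x, θ x * smoothStep (ρ x / ε) * f x +
        fderiv ℝ (fun x => θ x * smoothStep (ρ x / ε)) x (F x) =
        smoothStep (ρ x / ε) * a x - ε⁻¹ * (Ψ x * deriv smoothStep (ρ x / ε)) := fun x => by
      have h1 := ((hθ.differentiable (by norm_num)) x).hasFDerivAt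
      rw [(h1.fun_mul (hsd x)).fderiv]
      simp only [ha, hΨ, _root_.add_apply, _root_.smul_apply,
        _root_.neg_apply, innerSL_apply_apply, smul_eq_mul]
      ring
    have hsdc : Continuous fun x => deriv smoothStep (ρ x / ε) :=
      continuous_deriv_smoothStep.comp (hρC.continuous.div_const ε)
    simp only [hpt] at hz
    rw [integral_sub, sub_eq_zero] at hz
    · rw [hz, integral_const_mul, ← integral_indicator hΩ.measurableSet,
        integral_eq_mul_integral_layerMap he hg1.continuous hε, inv_mul_cancel_left₀ hε.ne']
      refine integral_congr_ae (ae_of_all _ fun p => ?_)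
      by_cases hp : layerMap e g (p.1, ε * p.2) ∈ Ω
      · simp only [indicator_of_mem hp, hρl]
        rw [mul_div_cancel_left₀ _ hε.ne']
      · simp only [indicator_of_notMem hp, zero_mul]
    · exact ((hsC.continuous.continuousOn.mul hac).integrableOn_compact hcpt).mono_set
        subset_closure
    · exact ((continuousOn_const.mul (hΨc.mul hsdc.continuousOn)).integrableOn_compact
        hcpt).mono_set subset_closure
  have hlim1 : Tendsto (fun ε : ℝ => ∫ x in Ω, smoothStep (ρ x / ε) * a x) (𝓝[>] 0)
      (𝓝 (∫ x in Ω, a x)) := by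
    refine tendsto_integral_filter_of_dominated_convergence (fun x => ‖a x‖) ?_ ?_ hai.norm ?_
    · refine Eventually.of_forall fun ε => AEStronglyMeasurable.mul ?_ hai.aestronglyMeasurable
      exact ((contDiff_smoothStep (n := 0)).continuous.comp
        (hρC.continuous.div_const ε)).aestronglyMeasurable
    · refine Eventually.of_forall fun ε => ae_of_all _ fun x => ?_
      rw [norm_mul, Real.norm_of_nonneg (smoothStep_nonneg _)]
      exact mul_le_of_le_one_left (norm_nonneg _) (smoothStep_le_one _)
    · filter_upwards [ae_restrict_mem hΩ.measurableSet] with x hx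
      by_cases hxθ : x ∈ tsupport θ
      · have h0 : 0 < ρ x := sub_pos.2 ((hVΩ x (hθV hxθ)).1 hx)
        simpa using (tendsto_smoothStep_div h0).mul_const (a x)
      · have h0 : a x = 0 := by
          have h1 : fderiv ℝ θ x = 0 :=
            Function.notMem_support.1 fun h => hxθ (support_fderiv_subset ℝ h)
          simp [ha, image_eq_zero_of_notMem_tsupport hxθ, h1]
        simp [h0]
  have hlim2 : Tendsto (fun ε : ℝ => ∫ p : (ℝ ∙ e)ᗮ × ℝ,
      Ω.indicator Ψ (layerMap e g (p.1, ε * p.2)) * deriv smoothStep p.2) (𝓝[>] 0)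
      (𝓝 (∫ p : (ℝ ∙ e)ᗮ × ℝ, Ψ (layerMap e g (p.1, 0)) * deriv smoothStep p.2)) := by
    obtain ⟨M, hM⟩ := hcpt.exists_bound_of_continuousOn hΨc
    obtain ⟨r, hr⟩ := hb.subset_closedBall (0 : E)
    have hmeas : Measurable (Ω.indicator Ψ) := by
      classical
      rw [← piecewise_eq_indicator]
      exact (hΨc.mono subset_closure).measurable_piecewise continuousOn_const hΩ.measurableSet
    refine tendsto_integral_filter_of_dominated_convergence
      (fun p => (Metric.closedBall 0 r).indicator (fun _ => max M 0) p.1 *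
        ‖deriv smoothStep p.2‖) ?_ ?_ ?_ ?_
    · refine Eventually.of_forall fun ε => Measurable.aestronglyMeasurable ?_
      refine (hmeas.comp ?_).mul (continuous_deriv_smoothStep.measurable.comp measurable_snd)
      exact ((continuous_layerMap e hg1.continuous).comp (by fun_prop)).measurable
    · refine Eventually.of_forall fun ε => ae_of_all _ fun p => ?_
      rw [norm_mul]
      refine mul_le_mul_of_nonneg_right ?_ (norm_nonneg _)
      by_cases hp : layerMap e g (p.1, ε * p.2) ∈ Ω
      · have h1 : ‖p.1‖ ≤ r := by
          have h2 := norm_sub_le_norm_layerMap_sub e g (p.1, ε * p.2) (0, g 0)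
          have h3 : layerMap e g (0, g 0) = 0 := by simp [layerMap]
          rw [h3, sub_zero] at h2
          simp only [sub_zero] at h2
          exact h2.trans (mem_closedBall_zero_iff.1 (hr hp))
        rw [indicator_of_mem hp, indicator_of_mem (mem_closedBall_zero_iff.2 h1)]
        exact (hM _ (subset_closure hp)).trans (le_max_left _ _)
      · rw [indicator_of_notMem hp, norm_zero]
        exact indicator_nonneg (fun _ _ => le_max_right _ _) _
    · refine Integrable.mul_prod (μ := volume) (ν := volume) ?_ integrable_deriv_smoothStep.norm
      exact (integrable_indicator_iff Metric.isClosed_closedBall.measurableSet).2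
        (integrableOn_const (isCompact_closedBall _ _).measure_ne_top)
    · refine ae_of_all _ fun p => ?_
      rcases lt_or_ge p.2 1 with h1 | h1
      · simp [deriv_smoothStep_of_lt_one h1]
      refine Tendsto.mul_const _ ?_
      set x₀ := layerMap e g (p.1, 0) with hx₀
      have hpath : Tendsto (fun ε : ℝ => layerMap e g (p.1, ε * p.2)) (𝓝[>] 0) (𝓝 x₀) := by
        have hc : Continuous fun ε : ℝ => layerMap e g (p.1, ε * p.2) :=
          (continuous_layerMap e hg1.continuous).comp (by fun_prop)
        have := hc.tendsto 0
        simp only [zero_mul] at this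
        exact this.mono_left nhdsWithin_le_nhds
      by_cases hx : x₀ ∈ tsupport θ
      · have hin : ∀ᶠ ε : ℝ in 𝓝[>] 0, layerMap e g (p.1, ε * p.2) ∈ Ω := by
          filter_upwards [hpath.eventually (hV.mem_nhds (hθV hx)), self_mem_nhdsWithin] with ε h2 h3
          have h3 : 0 < ε := h3
          refine (hVΩ _ h2).2 (sub_pos.1 ?_)
          have := hρl (p.1, ε * p.2)
          simp only [hρ] at this
          rw [this]
          positivity
        have hcl : x₀ ∈ closure Ω := mem_closure_of_tendsto hpath hin
        have h4 : Tendsto (fun ε : ℝ => layerMap e g (p.1, ε * p.2)) (𝓝[>] 0)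
            (𝓝[closure Ω] x₀) := tendsto_nhdsWithin_iff.2
          ⟨hpath, hin.mono fun _ h => subset_closure h⟩
        refine ((hΨc x₀ hcl).tendsto.comp h4).congr' ?_
        filter_upwards [hin] with ε h5
        rw [Function.comp_apply, indicator_of_mem h5]
      · have h0 : Ψ x₀ = 0 := by simp [hΨ, image_eq_zero_of_notMem_tsupport hx]
        rw [h0]
        refine tendsto_const_nhds.congr' ?_
        filter_upwards [hpath.eventually ((isClosed_tsupport θ).isOpen_compl.mem_nhds hx)]
          with ε h5
        by_cases h6 : layerMap e g (p.1, ε * p.2) ∈ Ω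
        · rw [indicator_of_mem h6]
          simp [hΨ, image_eq_zero_of_notMem_tsupport h5]
        · rw [indicator_of_notMem h6]
  have hmain := tendsto_nhds_unique hlim1 (hlim2.congr' (by
    filter_upwards [self_mem_nhdsWithin] with ε hε using (hid ε hε).symm))
  rw [hmain, Measure.volume_eq_prod, integral_prod_mul (fun y => Ψ (layerMap e g (y, 0))),
    integral_deriv_smoothStep, mul_one, setIntegral_graph he hg1 hinv]
  refine integral_congr_ae (ae_of_all _ fun y => ?_)
  have hn := norm_ne_zero_iff.2 (sub_gradient_ne_zero he hg1 hinv (y : E))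
  simp only [hΨ, gradient_layerMap hinv, inner_smul_right]
  rw [real_inner_comm]
  field_simp

end WeakDivergence

/-! ### The divergence theorem on domains with `C²` boundary -/

section DivergenceTheorem

/-- A `C²` partition of unity in a neighborhood of a compact set, indexed by points of the set. The
sum is `1` near the set and not only on it, so that the derivatives add up to zero there. -/
theorem exists_contDiff_partition {E : Type*} [NormedAddCommGroup E] [NormedSpace ℝ E]
    [FiniteDimensional ℝ E] {K : Set E} (hK : IsCompact K) {U : E → Set E}
    (hU : ∀ x ∈ K, IsOpen (U x) ∧ x ∈ U x) :
    ∃ (t : Finset E) (θ : t → E → ℝ), (∀ i : t, (i : E) ∈ K) ∧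
      (∀ i, ContDiff ℝ 2 (θ i)) ∧ (∀ i, HasCompactSupport (θ i)) ∧
      (∀ i : t, tsupport (θ i) ⊆ U i) ∧ ∀ᶠ y in 𝓝ˢ K, ∑ i, θ i y = 1 := by
  obtain ⟨t, htK, ht⟩ := hK.elim_nhds_subcover U fun x hx => (hU x hx).1.mem_nhds (hU x hx).2
  have hopen : IsOpen (⋃ x ∈ t, U x) := isOpen_biUnion fun x hx => (hU x (htK x hx)).1
  obtain ⟨K', hK', hKK', hK'U⟩ := exists_compact_between hK hopen ht
  obtain ⟨r, hr⟩ := hK'.isBounded.subset_ball (0 : E)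
  obtain ⟨f, hf⟩ := SmoothPartitionOfUnity.exists_isSubordinate (modelWithCornersSelf ℝ E)
    hK'.isClosed (fun i : t => U i ∩ Metric.ball 0 r)
    (fun i => (hU i (htK i i.2)).1.inter Metric.isOpen_ball) (fun x hx => by
      obtain ⟨i, hi, hxi⟩ := mem_iUnion₂.1 (hK'U hx)
      exact mem_iUnion.2 ⟨⟨i, hi⟩, hxi, hr hx⟩)
  refine ⟨t, fun i => f i, fun i => htK i i.2,
    fun i => ((f i).contMDiff.contDiff).of_le (by norm_cast), fun i => ?_,
    fun i => (hf i).trans inter_subset_left, ?_⟩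
  · exact (isCompact_closedBall (0 : E) r).of_isClosed_subset (isClosed_tsupport _)
      (((hf i).trans inter_subset_right).trans Metric.ball_subset_closedBall)
  · filter_upwards [subset_interior_iff_mem_nhdsSet.1 hKK'] with y hy
    rw [← f.sum_eq_one hy, finsum_eq_sum_of_fintype]

variable {N : ℕ} {Ω : Set (EuclideanSpace ℝ (Fin N))}

/-- A `C²` boundary is near each of its points the graph of a `C²` function, whose normalized
upward normal is the exterior unit normal. -/
theorem HasC2Boundary.exists_graph (hΩ : HasC2Boundary Ω) {x : EuclideanSpace ℝ (Fin N)}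
    (hx : x ∈ frontier Ω) :
    ∃ (V : Set (EuclideanSpace ℝ (Fin N))) (e : EuclideanSpace ℝ (Fin N))
      (g : EuclideanSpace ℝ (Fin N) → ℝ), IsOpen V ∧ x ∈ V ∧ ‖e‖ = 1 ∧ ContDiff ℝ 2 g ∧
      (∀ (y : EuclideanSpace ℝ (Fin N)) (t : ℝ), g (y + t • e) = g y) ∧
      (∀ y ∈ V, (y ∈ Ω ↔ ⟪e, y⟫_ℝ < g y)) ∧ (∀ y ∈ V, (y ∈ frontier Ω ↔ ⟪e, y⟫_ℝ = g y)) ∧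
      ∀ y ∈ V, y ∈ frontier Ω →
        outerNormal Ω y = ‖e - gradient g y‖⁻¹ • (e - gradient g y) := by
  obtain ⟨e, he, g, hg, hinv, hloc⟩ := hΩ x hx
  have h1 := eventually_mem_frontier_iff he hg.continuous hinv hloc
  have h2 := eventually_isOuterUnitNormal he hg hinv hloc
  obtain ⟨V, hV, hVo, hxV⟩ := eventually_nhds_iff.1 (hloc.and (h1.and h2))
  refine ⟨V, e, g, hVo, hxV, he, hg, hinv, fun y hy => (hV y hy).1, fun y hy => (hV y hy).2.1,
    fun y hy hyf => ?_⟩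
  exact (isOuterUnitNormal_outerNormal hΩ hyf).unique ((hV y hy).2.2.2 hyf)

theorem contDiff_normalized_sub_gradient {e : EuclideanSpace ℝ (Fin N)} (he : ‖e‖ = 1)
    {g : EuclideanSpace ℝ (Fin N) → ℝ} (hg : ContDiff ℝ 2 g)
    (hinv : ∀ (y : EuclideanSpace ℝ (Fin N)) (t : ℝ), g (y + t • e) = g y) :
    ContDiff ℝ 1 fun y => ‖e - gradient g y‖⁻¹ • (e - gradient g y) := by
  have h1 : ContDiff ℝ 1 (fderiv ℝ g) := hg.fderiv_right (by norm_num)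
  have h2 : ContDiff ℝ 1 (gradient g) :=
    (InnerProductSpace.toDual ℝ (EuclideanSpace ℝ (Fin N))).symm.toContinuousLinearEquiv
      |>.contDiff.comp h1
  have hG : ContDiff ℝ 1 fun y => e - gradient g y := contDiff_const.sub h2
  have h0 := sub_gradient_ne_zero he (hg.of_le (by norm_num)) hinv
  exact ((hG.norm ℝ h0).inv fun y => norm_ne_zero_iff.2 (h0 y)).smul hG

theorem continuousOn_outerNormal (hΩ : HasC2Boundary Ω) :
    ContinuousOn (outerNormal Ω) (frontier Ω) := by
  intro x hx
  obtain ⟨V, e, g, hV, hxV, he, hg, hinv, -, -, hν⟩ := hΩ.exists_graph hx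
  refine ((contDiff_normalized_sub_gradient he hg hinv).continuous.continuousWithinAt
    (s := frontier Ω) (x := x)).congr_of_eventuallyEq ?_ (hν x hxV hx)
  filter_upwards [mem_nhdsWithin_of_mem_nhds (hV.mem_nhds hxV), self_mem_nhdsWithin] with y h1 h2
  exact hν y h1 h2

theorem euclideanHausdorffMeasure_frontier_lt_top (hΩ : HasC2Boundary Ω)
    (hb : Bornology.IsBounded Ω) :
    (μHE[N - 1] : Measure (EuclideanSpace ℝ (Fin N))) (frontier Ω) < ∞ := by
  have hK : IsCompact (frontier Ω) :=
    hb.isCompact_closure.of_isClosed_subset isClosed_frontier frontier_subset_closure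
  refine hK.measure_lt_top_of_nhdsWithin fun x hx => ?_
  obtain ⟨V, e, g, hV, hxV, he, hg, hinv, -, hfr, -⟩ := hΩ.exists_graph hx
  obtain ⟨r, hr⟩ := hK.isBounded.subset_closedBall (0 : EuclideanSpace ℝ (Fin N))
  refine ⟨frontier Ω ∩ V, inter_mem self_mem_nhdsWithin
    (mem_nhdsWithin_of_mem_nhds (hV.mem_nhds hxV)), ?_⟩
  have h := euclideanHausdorffMeasure_graph_inter_closedBall_lt_top he
    (hg.of_le (by norm_num)) hinv r
  rw [finrank_euclideanSpace_fin] at h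
  have hsub : frontier Ω ∩ V ⊆ Metric.closedBall 0 r ∩ {x | ⟪e, x⟫_ℝ = g x} :=
    fun y hy => ⟨hr hy.1, (hfr y hy.2).1 hy.1⟩
  exact (measure_mono hsub).trans_lt h

theorem ContinuousOn.integrableOn_frontier (hΩ : HasC2Boundary Ω)
    (hb : Bornology.IsBounded Ω) {φ : EuclideanSpace ℝ (Fin N) → ℝ}
    (hφ : ContinuousOn φ (frontier Ω)) : IntegrableOn φ (frontier Ω) μHE[N - 1] := by
  have hK : IsCompact (frontier Ω) :=
    hb.isCompact_closure.of_isClosed_subset isClosed_frontier frontier_subset_closure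
  obtain ⟨M, hM⟩ := hK.exists_bound_of_continuousOn hφ
  exact IntegrableOn.of_bound (euclideanHausdorffMeasure_frontier_lt_top hΩ hb)
    (hφ.aestronglyMeasurable hK.measurableSet) M (ae_restrict_of_forall_mem hK.measurableSet hM)

/-- The divergence theorem for a continuous field with a continuous weak divergence. It is localized
by a partition of unity. -/
theorem IsWeakDivergence.integral_eq {F : EuclideanSpace ℝ (Fin N) → EuclideanSpace ℝ (Fin N)}
    {f : EuclideanSpace ℝ (Fin N) → ℝ} (hF : IsWeakDivergence Ω F f) (hopen : IsOpen Ω)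
    (hb : Bornology.IsBounded Ω) (hΩ : HasC2Boundary Ω) (hFc : ContinuousOn F (closure Ω))
    (hfc : ContinuousOn f (closure Ω)) :
    ∫ x in Ω, f x = ∫ x in frontier Ω, ⟪F x, outerNormal Ω x⟫_ℝ ∂μHE[N - 1] := by
  have hcpt : IsCompact (closure Ω) := hb.isCompact_closure
  have hloc : ∀ x ∈ closure Ω, ∃ U : Set (EuclideanSpace ℝ (Fin N)), IsOpen U ∧ x ∈ U ∧
      ∀ θ : EuclideanSpace ℝ (Fin N) → ℝ, ContDiff ℝ 2 θ → HasCompactSupport θ → tsupport θ ⊆ U →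
        ∫ x in Ω, (θ x * f x + fderiv ℝ θ x (F x)) =
          ∫ x in frontier Ω, θ x * ⟪F x, outerNormal Ω x⟫_ℝ ∂μHE[N - 1] := by
    intro x hx
    by_cases hxΩ : x ∈ Ω
    · refine ⟨Ω, hopen, hxΩ, fun θ hθ hθc hθΩ => ?_⟩
      rw [hF θ hθ hθc hθΩ, eq_comm]
      refine setIntegral_eq_zero_of_forall_eq_zero fun y hy => ?_
      have : y ∉ tsupport θ := fun h => (hopen.frontier_eq ▸ hy).2 (hθΩ h)
      rw [image_eq_zero_of_notMem_tsupport this, zero_mul]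
    · obtain ⟨V, e, g, hV, hxV, he, hg, hinv, hVΩ, hfr, hν⟩ :=
        hΩ.exists_graph (x := x) (hopen.frontier_eq ▸ ⟨hx, hxΩ⟩)
      refine ⟨V, hV, hxV, fun θ hθ hθc hθV => ?_⟩
      rw [hF.integral_eq_integral_graph hopen hb hFc hfc he hg hinv hV hVΩ hθ hθc hθV,
        finrank_euclideanSpace_fin]
      have hgm : MeasurableSet {x | ⟪e, x⟫_ℝ = g x} :=
        (isClosed_eq (by fun_prop) hg.continuous).measurableSet
      rw [← integral_indicator hgm, ← integral_indicator isClosed_frontier.measurableSet]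
      congr 1
      ext y
      by_cases hy : y ∈ tsupport θ
      · by_cases hyf : y ∈ frontier Ω
        · have h1 : y ∈ {x | ⟪e, x⟫_ℝ = g x} := (hfr y (hθV hy)).1 hyf
          rw [indicator_of_mem hyf, indicator_of_mem h1, hν y (hθV hy) hyf]
        · have h1 : y ∉ {x | ⟪e, x⟫_ℝ = g x} := fun h => hyf ((hfr y (hθV hy)).2 h)
          rw [indicator_of_notMem hyf, indicator_of_notMem h1]
      · have h0 := image_eq_zero_of_notMem_tsupport hy
        rw [indicator_apply_eq_zero.2 fun _ => by rw [h0, zero_mul],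
          indicator_apply_eq_zero.2 fun _ => by rw [h0, zero_mul]]
  choose! U hU using hloc
  obtain ⟨t, θ, htK, hθ, hθc, hθU, hsum⟩ :=
    exists_contDiff_partition hcpt fun x hx => ⟨(hU x hx).1, (hU x hx).2.1⟩
  have hone : ∀ y ∈ closure Ω, ∑ i, θ i y = 1 ∧ ∑ i, fderiv ℝ (θ i) y = 0 := by
    intro y hy
    have h1 : ∀ᶠ y' in 𝓝 y, ∑ i, θ i y' = 1 := hsum.filter_mono (nhds_le_nhdsSet hy)
    refine ⟨h1.self_of_nhds, ?_⟩
    rw [← fderiv_fun_sum fun i _ => ((hθ i).differentiable (by norm_num)) y,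
      Filter.EventuallyEq.fderiv_eq (show (fun y => ∑ i, θ i y) =ᶠ[𝓝 y] fun _ => (1 : ℝ) from h1)]
    simp
  have hνc : ContinuousOn (fun x => ⟪F x, outerNormal Ω x⟫_ℝ) (frontier Ω) :=
    (hFc.mono frontier_subset_closure).inner (continuousOn_outerNormal hΩ)
  calc ∫ x in Ω, f x = ∫ x in Ω, ∑ i, (θ i x * f x + fderiv ℝ (θ i) x (F x)) := by
        refine setIntegral_congr_fun hopen.measurableSet fun x hx => ?_
        have h1 := hone x (subset_closure hx)
        rw [Finset.sum_add_distrib, ← Finset.sum_mul, h1.1, one_mul,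
          ← _root_.sum_apply, h1.2]
        simp
    _ = ∑ i, ∫ x in Ω, (θ i x * f x + fderiv ℝ (θ i) x (F x)) := by
        refine integral_finsetSum _ fun i _ => ?_
        refine IntegrableOn.mono_set (ContinuousOn.integrableOn_compact hcpt ?_) subset_closure
        exact ((hθ i).continuous.continuousOn.mul hfc).add
          (((hθ i).continuous_fderiv (by norm_num)).continuousOn.clm_apply hFc)
    _ = ∑ i, ∫ x in frontier Ω, θ i x * ⟪F x, outerNormal Ω x⟫_ℝ ∂μHE[N - 1] :=
        Finset.sum_congr rfl fun i _ => (hU i (htK i)).2.2 _ (hθ i) (hθc i) (hθU i)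
    _ = ∫ x in frontier Ω, ∑ i, θ i x * ⟪F x, outerNormal Ω x⟫_ℝ ∂μHE[N - 1] := by
        refine (integral_finsetSum _ fun i _ => ?_).symm
        exact ContinuousOn.integrableOn_frontier hΩ hb
          ((hθ i).continuous.continuousOn.mul hνc)
    _ = _ := by
        refine setIntegral_congr_fun isClosed_frontier.measurableSet fun x hx => ?_
        rw [← Finset.sum_mul, (hone x (frontier_subset_closure hx)).1, one_mul]

end DivergenceTheorem

/-! ### Calculus of weak divergences -/

section WeakDivergenceCalculus

theorem contDiff_of_tsupport_subset {E F : Type*} [NormedAddCommGroup E] [NormedSpace ℝ E]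
    [NormedAddCommGroup F] [NormedSpace ℝ F] {n : WithTop ℕ∞} {Ω : Set E} {f : E → F}
    (hΩ : IsOpen Ω) (hf : ContDiffOn ℝ n f Ω) (hs : tsupport f ⊆ Ω) : ContDiff ℝ n f := by
  refine contDiff_iff_contDiffAt.2 fun x => ?_
  by_cases hx : x ∈ tsupport f
  · exact hf.contDiffAt (hΩ.mem_nhds (hs hx))
  · exact contDiffAt_const.congr_of_eventuallyEq (notMem_tsupport_iff_eventuallyEq.1 hx)

variable {E : Type*} [NormedAddCommGroup E] [InnerProductSpace ℝ E]

/-- The trace of a continuous linear endomorphism. -/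
def tr (L : E →L[ℝ] E) : ℝ := LinearMap.trace ℝ E L.toLinearMap

@[simp] theorem tr_add (L M : E →L[ℝ] E) : tr (L + M) = tr L + tr M := by simp [tr]

@[simp] theorem tr_sub (L M : E →L[ℝ] E) : tr (L - M) = tr L - tr M := by simp [tr]

@[simp] theorem tr_smul (c : ℝ) (L : E →L[ℝ] E) : tr (c • L) = c * tr L := by simp [tr]

theorem tr_eq_sum {ι : Type*} [Fintype ι] (b : OrthonormalBasis ι ℝ E) (L : E →L[ℝ] E) :
    tr L = ∑ i, ⟪b i, L (b i)⟫_ℝ := LinearMap.trace_eq_sum_inner L.toLinearMap b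

variable [FiniteDimensional ℝ E]

@[simp] theorem tr_smulRight (l : E →L[ℝ] ℝ) (v : E) : tr (l.smulRight v) = l v :=
  LinearMap.trace_smulRight l.toLinearMap v

theorem tr_id : tr (ContinuousLinearMap.id ℝ E) = finrank ℝ E := LinearMap.trace_id ℝ E

theorem continuous_tr : Continuous (tr : (E →L[ℝ] E) → ℝ) := by
  have : (tr : (E →L[ℝ] E) → ℝ) =
      fun L => ∑ i, ⟪stdOrthonormalBasis ℝ E i, L (stdOrthonormalBasis ℝ E i)⟫_ℝ :=
    funext fun L => tr_eq_sum (stdOrthonormalBasis ℝ E) L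
  rw [this]
  fun_prop

variable [MeasurableSpace E] [BorelSpace E]

theorem integral_fderiv_apply_eq_zero {φ : E → ℝ} (hφ : ContDiff ℝ 1 φ)
    (hc : HasCompactSupport φ) (v : E) : ∫ x, fderiv ℝ φ x v = 0 := by
  have hd : Continuous fun x => fderiv ℝ φ x v :=
    (hφ.continuous_fderiv one_ne_zero).clm_apply continuous_const
  have h := integral_mul_fderiv_eq_neg_fderiv_mul_of_integrable (μ := (volume : Measure E))
    (f := fun _ => (1 : ℝ)) (g := φ) (v := v) (by simp)
    (by simpa using hd.integrable_of_hasCompactSupport (hc.fderiv_apply ℝ v))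
    (by simpa using hφ.continuous.integrable_of_hasCompactSupport hc)
    (fun x _ => differentiableAt_const _) (fun x _ => hφ.differentiable one_ne_zero x)
  simpa using h

theorem integral_tr_fderiv_eq_zero {ξ : E → E} (hξ : ContDiff ℝ 1 ξ)
    (hc : HasCompactSupport ξ) : ∫ x, tr (fderiv ℝ ξ x) = 0 := by
  set b := stdOrthonormalBasis ℝ E
  have hcomp : ∀ i, ContDiff ℝ 1 fun x => ⟪b i, ξ x⟫_ℝ := fun i => contDiff_const.inner ℝ hξ
  have hcs : ∀ i, HasCompactSupport fun x => ⟪b i, ξ x⟫_ℝ := fun i =>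
    hc.comp_left (g := fun v => ⟪b i, v⟫_ℝ) (inner_zero_right _)
  have hd : ∀ i x, ⟪b i, fderiv ℝ ξ x (b i)⟫_ℝ = fderiv ℝ (fun x => ⟪b i, ξ x⟫_ℝ) x (b i) :=
    fun i x => by
      rw [fderiv_inner_apply ℝ (differentiableAt_const _) (hξ.differentiable one_ne_zero x)]
      simp
  simp only [tr_eq_sum b, hd]
  rw [integral_finsetSum]
  · exact Finset.sum_eq_zero fun i _ => integral_fderiv_apply_eq_zero (hcomp i) (hcs i) _
  · intro i _
    exact (((hcomp i).continuous_fderiv one_ne_zero).clm_apply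
      continuous_const).integrable_of_hasCompactSupport ((hcs i).fderiv_apply ℝ _)

/-- A `C¹` field whose support is a compact subset of the open set `Ω` has total divergence
zero. -/
theorem setIntegral_tr_fderiv_eq_zero {Ω : Set E} (hΩ : IsOpen Ω) {ξ : E → E}
    (hξ : ContDiffOn ℝ 1 ξ Ω) {η : E → ℝ} (hc : HasCompactSupport η) (hη : tsupport η ⊆ Ω)
    (h0 : ∀ x ∉ tsupport η, ξ x = 0) : ∫ x in Ω, tr (fderiv ℝ ξ x) = 0 := by
  have hts : tsupport ξ ⊆ tsupport η := by
    refine closure_minimal (fun x hx => ?_) (isClosed_tsupport η)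
    by_contra h
    exact hx (h0 x h)
  have hC : ContDiff ℝ 1 ξ := contDiff_of_tsupport_subset hΩ hξ (hts.trans hη)
  rw [setIntegral_eq_integral_of_forall_compl_eq_zero fun x hx => ?_]
  · exact integral_tr_fderiv_eq_zero hC (hc.mono' (subset_closure.trans hts))
  · have h1 : fderiv ℝ ξ x = 0 := Function.notMem_support.1 fun h =>
      hx (hη (hts (support_fderiv_subset ℝ h)))
    rw [h1]; simp [tr]

variable {Ω : Set E}

theorem IsWeakDivergence.congr {F F' : E → E} {f f' : E → ℝ} (h : IsWeakDivergence Ω F f)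
    (hΩ : IsOpen Ω) (hF : ∀ x ∈ Ω, F x = F' x) (hf : ∀ x ∈ Ω, f x = f' x) :
    IsWeakDivergence Ω F' f' := fun η h1 h2 h3 => by
  rw [← h η h1 h2 h3]
  refine setIntegral_congr_fun hΩ.measurableSet fun x hx => ?_
  rw [hF x hx, hf x hx]

theorem IsWeakDivergence.add {F F' : E → E} {f f' : E → ℝ} (h : IsWeakDivergence Ω F f)
    (h' : IsWeakDivergence Ω F' f') (hb : Bornology.IsBounded Ω)
    (hF : ContinuousOn F (closure Ω)) (hF' : ContinuousOn F' (closure Ω))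
    (hf : ContinuousOn f (closure Ω)) (hf' : ContinuousOn f' (closure Ω)) :
    IsWeakDivergence Ω (fun x => F x + F' x) (fun x => f x + f' x) := fun η h1 h2 h3 => by
  have hi : ∀ (G : E → E) (k : E → ℝ), ContinuousOn G (closure Ω) → ContinuousOn k (closure Ω) →
      IntegrableOn (fun x => η x * k x + fderiv ℝ η x (G x)) Ω := fun G k hG hk =>
    (((h1.continuous.continuousOn.mul hk).add
      ((h1.continuous_fderiv (by norm_num)).continuousOn.clm_apply hG)).integrableOn_compact
        hb.isCompact_closure).mono_set subset_closure
  have h4 := integral_add (hi F f hF hf) (hi F' f' hF' hf')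
  rw [h η h1 h2 h3, h' η h1 h2 h3, add_zero] at h4
  rw [← h4]
  refine integral_congr_ae (ae_of_all _ fun x => ?_)
  simp only [map_add]
  ring

/-- The product rule for weak divergences. -/
theorem IsWeakDivergence.mul {F : E → E} {f : E → ℝ} (h : IsWeakDivergence Ω F f)
    (hΩ : IsOpen Ω) {θ : E → ℝ} (hθ : ContDiffOn ℝ 2 θ Ω) :
    IsWeakDivergence Ω (fun x => θ x • F x) (fun x => θ x * f x + fderiv ℝ θ x (F x)) := by
  intro η h1 h2 h3
  rw [← h (fun x => η x * θ x) (contDiff_of_tsupport_subset hΩ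
    (h1.contDiffOn.mul hθ) (tsupport_mul_subset_left.trans h3)) h2.mul_right
    ((tsupport_mul_subset_left).trans h3)]
  refine setIntegral_congr_fun hΩ.measurableSet fun x hx => ?_
  have hd := (h1.differentiable (by norm_num) x).hasFDerivAt.fun_mul
    ((hθ.contDiffAt (hΩ.mem_nhds hx)).differentiableAt (by norm_num)).hasFDerivAt
  simp only
  rw [hd.fderiv]
  simp only [_root_.add_apply, _root_.smul_apply, smul_eq_mul, map_smul]
  ring

/-- The divergence of a `C¹` field is a weak divergence. -/
theorem isWeakDivergence_of_contDiffOn (hΩ : IsOpen Ω) {F : E → E} (hF : ContDiffOn ℝ 1 F Ω) :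
    IsWeakDivergence Ω F (fun x => tr (fderiv ℝ F x)) := by
  intro η h1 h2 h3
  have hη1 : ContDiff ℝ 1 η := h1.of_le (by norm_num)
  rw [← setIntegral_tr_fderiv_eq_zero hΩ (hη1.contDiffOn.smul hF) h2 h3 fun x hx => by
    simp [image_eq_zero_of_notMem_tsupport hx]]
  refine setIntegral_congr_fun hΩ.measurableSet fun x hx => ?_
  have hd := (h1.differentiable (by norm_num) x).hasFDerivAt.smul
    ((hF.contDiffAt (hΩ.mem_nhds hx)).differentiableAt one_ne_zero).hasFDerivAt
  simp only
  rw [hd.fderiv]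
  simp

/-- The exterior product `a ∧ P` of two `C¹` fields has a divergence which is again a field, and
this field is divergence free in the weak sense. -/
theorem isWeakDivergence_wedge (hΩ : IsOpen Ω) {a P : E → E} (ha : ContDiffOn ℝ 1 a Ω)
    (hP : ContDiffOn ℝ 1 P Ω) :
    IsWeakDivergence Ω (fun x => tr (fderiv ℝ a x) • P x + fderiv ℝ P x (a x) -
      tr (fderiv ℝ P x) • a x - fderiv ℝ a x (P x)) (fun _ => 0) := by
  intro η h1 h2 h3
  have hη' : ContDiff ℝ 1 (fderiv ℝ η) := h1.fderiv_right (by norm_num)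
  -- the second derivatives of `η` cancel in the divergence of `(∂_P η) a - (∂_a η) P`
  refine Eq.trans ?_ (setIntegral_tr_fderiv_eq_zero hΩ
    (ξ := fun x => fderiv ℝ η x (P x) • a x - fderiv ℝ η x (a x) • P x)
    (((hη'.contDiffOn.clm_apply hP).smul ha).sub ((hη'.contDiffOn.clm_apply ha).smul hP))
    h2 h3 fun x hx => by
      have h4 : fderiv ℝ η x = 0 :=
        Function.notMem_support.1 fun h => hx (support_fderiv_subset ℝ h)
      simp [h4])
  refine setIntegral_congr_fun hΩ.measurableSet fun x hx => ?_
  have hda := ((ha.contDiffAt (hΩ.mem_nhds hx)).differentiableAt one_ne_zero).hasFDerivAt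
  have hdP := ((hP.contDiffAt (hΩ.mem_nhds hx)).differentiableAt one_ne_zero).hasFDerivAt
  have hdη := (hη'.differentiable one_ne_zero x).hasFDerivAt
  have hd := ((hdη.clm_apply hdP).smul hda).sub ((hdη.clm_apply hda).smul hdP)
  have hsymm : fderiv ℝ (fderiv ℝ η) x (P x) (a x) = fderiv ℝ (fderiv ℝ η) x (a x) (P x) :=
    (h1.contDiffAt.isSymmSndFDerivAt (by simp)) (P x) (a x)
  have hfd : fderiv ℝ (fun x => fderiv ℝ η x (P x) • a x - fderiv ℝ η x (a x) • P x) x = _ :=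
    hd.fderiv
  simp only
  rw [hfd]
  simp [hsymm]
  ring

/-- For functions which are only of class `C¹`, mixed second derivatives commute in the weak
sense: this is integration by parts for the difference quotients in the direction `w`. -/
theorem integral_fderiv_mul_fderiv_comm {φ ψ : E → ℝ} (hφ : ContDiff ℝ 1 φ)
    (hφc : HasCompactSupport φ) (hψ : ContDiff ℝ 1 ψ) (hψc : HasCompactSupport ψ) (v w : E) :
    ∫ x, fderiv ℝ ψ x w * fderiv ℝ φ x v = ∫ x, fderiv ℝ φ x w * fderiv ℝ ψ x v := by
  obtain ⟨C, hC⟩ := ContDiff.lipschitzWith_of_hasCompactSupport hφc hφ (by norm_num)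
  obtain ⟨D, hD⟩ := ContDiff.lipschitzWith_of_hasCompactSupport hψc hψ (by norm_num)
  have hφd : Continuous fun x => fderiv ℝ φ x v :=
    (hφ.continuous_fderiv one_ne_zero).clm_apply continuous_const
  have hψd : Continuous fun x => fderiv ℝ ψ x v :=
    (hψ.continuous_fderiv one_ne_zero).clm_apply continuous_const
  have hφi : Integrable fun x => fderiv ℝ φ x v :=
    hφd.integrable_of_hasCompactSupport (hφc.fderiv_apply ℝ v)
  have hψi : Integrable fun x => fderiv ℝ ψ x v :=
    hψd.integrable_of_hasCompactSupport (hψc.fderiv_apply ℝ v)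
  have h1 := hD.integral_inv_smul_sub_mul_tendsto_integral_lineDeriv_mul hφi w
  have h2 := hC.integral_inv_smul_sub_mul_tendsto_integral_lineDeriv_mul hψi (-w)
  have hl : ∀ {f : E → ℝ} (hf : ContDiff ℝ 1 f) (x u : E), lineDeriv ℝ f x u = fderiv ℝ f x u :=
    fun hf x u => (hf.differentiable one_ne_zero x).lineDeriv_eq_fderiv
  simp only [hl hφ, hl hψ, map_neg, neg_mul, integral_neg] at h1 h2
  refine tendsto_nhds_unique h1 ?_
  rw [← neg_neg (∫ x, fderiv ℝ φ x w * fderiv ℝ ψ x v)]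
  refine h2.neg.congr fun t => ?_
  -- integrate by parts, and shift the difference quotient to the other factor
  have hψt : ContDiff ℝ 1 fun x => ψ (x + t • w) := hψ.comp (contDiff_id.add contDiff_const)
  have hψtd : ∀ x, fderiv ℝ (fun x => ψ (x + t • w)) x v = fderiv ℝ ψ (x + t • w) v := fun x => by
    rw [fderiv_comp_add_right]
  have hip : ∀ {χ : E → ℝ}, ContDiff ℝ 1 χ →
      Integrable (fun x => χ x * fderiv ℝ φ x v) ∧ Integrable (fun x => fderiv ℝ χ x v * φ x) ∧
      ∫ x, χ x * fderiv ℝ φ x v = -∫ x, fderiv ℝ χ x v * φ x := by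
    intro χ hχ
    have hχd : Continuous fun x => fderiv ℝ χ x v :=
      (hχ.continuous_fderiv one_ne_zero).clm_apply continuous_const
    have i1 : Integrable (fun x => χ x * fderiv ℝ φ x v) :=
      (hχ.continuous.mul hφd).integrable_of_hasCompactSupport (hφc.fderiv_apply ℝ v).mul_left
    have i2 : Integrable (fun x => fderiv ℝ χ x v * φ x) :=
      (hχd.mul hφ.continuous).integrable_of_hasCompactSupport hφc.mul_left
    exact ⟨i1, i2, integral_mul_fderiv_eq_neg_fderiv_mul_of_integrable i2 i1
      ((hχ.continuous.mul hφ.continuous).integrable_of_hasCompactSupport hφc.mul_left)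
      (fun x _ => hχ.differentiable one_ne_zero x) (fun x _ => hφ.differentiable one_ne_zero x)⟩
  have hshift : ∫ x, fderiv ℝ ψ (x + t • w) v * φ x = ∫ x, φ (x + t • -w) * fderiv ℝ ψ x v := by
    rw [← integral_add_right_eq_self _ (t • -w)]
    refine integral_congr_ae (ae_of_all _ fun x => ?_)
    simp [mul_comm]
  have i3 : Integrable fun x => φ (x + t • -w) * fderiv ℝ ψ x v :=
    ((hφ.continuous.comp (by fun_prop)).mul hψd).integrable_of_hasCompactSupport
      (hψc.fderiv_apply ℝ v).mul_left
  have i4 : Integrable fun x => φ x * fderiv ℝ ψ x v :=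
    (hφ.continuous.mul hψd).integrable_of_hasCompactSupport (hψc.fderiv_apply ℝ v).mul_left
  have e1 : ∫ x, t⁻¹ • (ψ (x + t • w) - ψ x) * fderiv ℝ φ x v =
      t⁻¹ * ((∫ x, ψ (x + t • w) * fderiv ℝ φ x v) - ∫ x, ψ x * fderiv ℝ φ x v) := by
    rw [← integral_sub (hip hψt).1 (hip hψ).1, ← integral_const_mul]
    refine integral_congr_ae (ae_of_all _ fun x => ?_)
    simp only [smul_eq_mul]; ring
  have e2 : ∫ x, t⁻¹ • (φ (x + t • -w) - φ x) * fderiv ℝ ψ x v =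
      t⁻¹ * ((∫ x, φ (x + t • -w) * fderiv ℝ ψ x v) - ∫ x, φ x * fderiv ℝ ψ x v) := by
    rw [← integral_sub i3 i4, ← integral_const_mul]
    refine integral_congr_ae (ae_of_all _ fun x => ?_)
    simp only [smul_eq_mul]; ring
  rw [e1, e2, (hip hψt).2.2, (hip hψ).2.2]
  simp only [hψtd]
  rw [hshift]
  simp only [mul_comm (fderiv ℝ ψ _ v) (φ _)]
  ring

end WeakDivergenceCalculus

/-! ### The weak divergence of a directional derivative -/

section WeakBochner

variable {E : Type*} [NormedAddCommGroup E] [InnerProductSpace ℝ E] [FiniteDimensional ℝ E]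
  [MeasurableSpace E] [BorelSpace E]

omit [MeasurableSpace E] [BorelSpace E] in
theorem exists_contDiff_cutoff {K Ω : Set E} (hK : IsCompact K) (hΩ : IsOpen Ω) (hKΩ : K ⊆ Ω) :
    ∃ χ : E → ℝ, ContDiff ℝ 2 χ ∧ HasCompactSupport χ ∧ tsupport χ ⊆ Ω ∧
      ∀ x ∈ K, ∀ᶠ y in 𝓝 x, χ y = 1 := by
  obtain ⟨t, θ, -, hθ, hθc, hθU, hsum⟩ :=
    exists_contDiff_partition (U := fun _ => Ω) hK fun x hx => ⟨hΩ, hKΩ hx⟩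
  have hts : tsupport (fun y => ∑ i, θ i y) ⊆ ⋃ i, tsupport (θ i) := by
    refine closure_minimal (fun y hy => ?_) (isClosed_iUnion_of_finite fun i => isClosed_tsupport _)
    obtain ⟨i, -, hi⟩ := Finset.exists_ne_zero_of_sum_ne_zero hy
    exact mem_iUnion.2 ⟨i, subset_tsupport _ hi⟩
  exact ⟨fun y => ∑ i, θ i y, ContDiff.sum fun i _ => hθ i,
    (isCompact_iUnion fun i => hθc i).of_isClosed_subset (isClosed_tsupport _) hts,
    hts.trans (iUnion_subset hθU), fun x hx => hsum.filter_mono (nhds_le_nhdsSet hx)⟩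

variable {Ω : Set E}

/-- If the `C¹` field `P` is divergence free, then `div ((DP) p) = tr ((DP) (Dp))` in the weak sense,
although second derivatives of `P` need not exist. In coordinates, the weak commutation of the mixed
second derivatives of the components of `P` moves the divergence onto `P` itself. -/
theorem isWeakDivergence_fderiv_apply (hΩ : IsOpen Ω) {p P : E → E} (hp : ContDiffOn ℝ 1 p Ω)
    (hP : ContDiffOn ℝ 1 P Ω) (hdiv : ∀ x ∈ Ω, tr (fderiv ℝ P x) = 0) :
    IsWeakDivergence Ω (fun x => fderiv ℝ P x (p x))
      (fun x => tr (fderiv ℝ P x ∘L fderiv ℝ p x)) := by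
  intro η h1 h2 h3
  obtain ⟨χ, hχ, hχc, hχΩ, hχ1⟩ := exists_contDiff_cutoff h2 hΩ h3
  set b := stdOrthonormalBasis ℝ E with hb
  set φ : Fin (finrank ℝ E) → E → ℝ := fun j x => η x * ⟪b j, p x⟫_ℝ with hφdef
  -- the cutoff makes the components of `P` compactly supported, without changing them near the
  -- support of `η`
  set ψ : Fin (finrank ℝ E) → E → ℝ := fun i x => χ x * ⟪b i, P x⟫_ℝ with hψdef
  have hη1 : ContDiff ℝ 1 η := h1.of_le (by norm_num)
  have hφ : ∀ j, ContDiff ℝ 1 (φ j) := fun j => contDiff_of_tsupport_subset hΩ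
    (hη1.contDiffOn.mul (contDiffOn_const.inner ℝ hp)) (tsupport_mul_subset_left.trans h3)
  have hψ : ∀ i, ContDiff ℝ 1 (ψ i) := fun i => contDiff_of_tsupport_subset hΩ
    ((hχ.of_le (by norm_num)).contDiffOn.mul (contDiffOn_const.inner ℝ hP))
    (tsupport_mul_subset_left.trans hχΩ)
  have hφc : ∀ j, HasCompactSupport (φ j) := fun j => h2.mul_right
  have hψc : ∀ i, HasCompactSupport (ψ i) := fun i => hχc.mul_right
  have hφ0 : ∀ j, ∀ x ∉ tsupport η, fderiv ℝ (φ j) x = 0 := fun j x hx =>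
    Function.notMem_support.1 fun h =>
      hx (tsupport_mul_subset_left (support_fderiv_subset ℝ h))
  have hdP : ∀ x ∈ Ω, HasFDerivAt P (fderiv ℝ P x) x := fun x hx =>
    ((hP.contDiffAt (hΩ.mem_nhds hx)).differentiableAt one_ne_zero).hasFDerivAt
  have hdp : ∀ x ∈ Ω, HasFDerivAt p (fderiv ℝ p x) x := fun x hx =>
    ((hp.contDiffAt (hΩ.mem_nhds hx)).differentiableAt one_ne_zero).hasFDerivAt
  have hφ' : ∀ j, ∀ x ∈ Ω, ∀ v, fderiv ℝ (φ j) x v =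
      η x * ⟪b j, fderiv ℝ p x v⟫_ℝ + fderiv ℝ η x v * ⟪b j, p x⟫_ℝ := fun j x hx v => by
    have := (h1.differentiable (by norm_num) x).hasFDerivAt.fun_mul
      ((innerSL ℝ (b j)).hasFDerivAt.comp x (hdp x hx))
    have h' : fderiv ℝ (φ j) x = _ := this.fderiv
    rw [h']
    simp [mul_comm]
  have hψ' : ∀ i, ∀ x ∈ tsupport η, ∀ v, fderiv ℝ (ψ i) x v = ⟪b i, fderiv ℝ P x v⟫_ℝ := by
    intro i x hx v
    have h4 : ψ i =ᶠ[𝓝 x] fun x => ⟪b i, P x⟫_ℝ := by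
      filter_upwards [hχ1 x hx] with y hy
      simp [hψdef, hy]
    have h5 : HasFDerivAt (fun x => ⟪b i, P x⟫_ℝ) _ x :=
      (innerSL ℝ (b i)).hasFDerivAt.comp x (hdP x (h3 hx))
    rw [h4.fderiv_eq, h5.fderiv]
    simp
  have hint : ∀ i j v w, Integrable fun x => fderiv ℝ (ψ i) x v * fderiv ℝ (φ j) x w :=
    fun i j v w =>
    ((((hψ i).continuous_fderiv one_ne_zero).clm_apply continuous_const).mul
      (((hφ j).continuous_fderiv one_ne_zero).clm_apply
        continuous_const)).integrable_of_hasCompactSupport ((hφc j).fderiv_apply ℝ w).mul_left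
  have hcomm : ∑ j, ∑ i, ∫ x, fderiv ℝ (ψ i) x (b j) * fderiv ℝ (φ j) x (b i) = 0 := by
    refine Finset.sum_eq_zero fun j _ => ?_
    have h4 : ∀ i, ∫ x, fderiv ℝ (ψ i) x (b j) * fderiv ℝ (φ j) x (b i) =
        ∫ x, fderiv ℝ (ψ i) x (b i) * fderiv ℝ (φ j) x (b j) := fun i => by
      rw [integral_fderiv_mul_fderiv_comm (hφ j) (hφc j) (hψ i) (hψc i)]
      simp only [mul_comm]
    rw [Finset.sum_congr rfl fun i _ => h4 i,
      ← integral_finsetSum _ fun i _ => hint i j _ _]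
    refine integral_eq_zero_of_ae (ae_of_all _ fun x => ?_)
    simp only [Pi.zero_apply]
    rw [← Finset.sum_mul]
    by_cases hx : x ∈ tsupport η
    · rw [Finset.sum_congr rfl fun i _ => hψ' i x hx (b i), ← tr_eq_sum b, hdiv x (h3 hx), zero_mul]
    · simp [hφ0 j x hx]
  rw [← hcomm]
  simp only [← integral_finsetSum _ fun i (_ : i ∈ Finset.univ) => hint i _ _ _]
  rw [← integral_finsetSum]
  swap
  · intro j _
    exact integrable_finsetSum _ fun i _ => hint i j _ _
  refine Eq.trans ?_ (setIntegral_eq_integral_of_forall_compl_eq_zero (s := Ω) fun x hx => by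
    simp [hφ0 _ x fun h => hx (h3 h)])
  refine setIntegral_congr_fun hΩ.measurableSet fun x hx => ?_
  by_cases hxη : x ∈ tsupport η
  · have e1 : ∀ v, ∑ i, ⟪b i, v⟫_ℝ * fderiv ℝ η x (b i) = fderiv ℝ η x v := fun v => by
      conv_rhs => rw [← b.sum_repr' v]
      simp
    have e2 : ∀ v, ∑ j, ⟪b j, v⟫_ℝ • fderiv ℝ P x (b j) = fderiv ℝ P x v := fun v => by
      conv_rhs => rw [← b.sum_repr' v]
      simp
    have e3 : ∀ i, ∑ j, fderiv ℝ (ψ i) x (b j) * fderiv ℝ (φ j) x (b i) =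
        η x * ⟪b i, (fderiv ℝ P x ∘L fderiv ℝ p x) (b i)⟫_ℝ +
          ⟪b i, fderiv ℝ P x (p x)⟫_ℝ * fderiv ℝ η x (b i) := fun i => by
      rw [ContinuousLinearMap.comp_apply, ← e2 (p x), ← e2 (fderiv ℝ p x (b i)), inner_sum,
        inner_sum, Finset.mul_sum, Finset.sum_mul, ← Finset.sum_add_distrib]
      refine Finset.sum_congr rfl fun j _ => ?_
      rw [hψ' i x hxη, hφ' j x hx, inner_smul_right, inner_smul_right]
      ring
    rw [Finset.sum_comm, Finset.sum_congr rfl fun i _ => e3 i, Finset.sum_add_distrib,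
      ← Finset.mul_sum, ← tr_eq_sum b, e1]
  · have h4 : fderiv ℝ η x = 0 := Function.notMem_support.1 fun h =>
      hxη (support_fderiv_subset ℝ h)
    simp [hφ0 _ x hxη, image_eq_zero_of_notMem_tsupport hxη, h4]

end WeakBochner

/-! ### Tangential differentiation and a global extension of the normal -/

section BoundaryGeometry

variable {N : ℕ} {Ω : Set (EuclideanSpace ℝ (Fin N))}

/-- The tangent cone of the closure at a boundary point contains an open half-space. -/
theorem uniqueDiffOn_closure (hopen : IsOpen Ω) (hΩ : HasC2Boundary Ω) :
    UniqueDiffOn ℝ (closure Ω) := by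
  intro x hx
  by_cases hxΩ : x ∈ Ω
  · exact uniqueDiffWithinAt_of_mem_nhds (mem_of_superset (hopen.mem_nhds hxΩ) subset_closure)
  have hν := isOuterUnitNormal_outerNormal hΩ (x := x) (hopen.frontier_eq ▸ ⟨hx, hxΩ⟩)
  set ν := outerNormal Ω x
  have hν2 : ⟪ν, ν⟫_ℝ = 1 := by rw [real_inner_self_eq_norm_sq, hν.1]; norm_num
  have hcone : ∀ v, ⟪v, ν⟫_ℝ < 0 → v ∈ tangentConeAt ℝ (closure Ω) x := fun v hv => by
    refine mem_tangentConeAt_of_add_smul_mem (l := 𝓝[>] (0 : ℝ)) (c := id)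
      (tendsto_nhdsWithin_mono_right (fun t ht => ne_of_gt ht) tendsto_id) ?_
    filter_upwards [hν.2.1 v hv] with t ht using subset_closure ht
  refine ⟨?_, subset_closure hx⟩
  have htop : Submodule.span ℝ (tangentConeAt ℝ (closure Ω) x) = ⊤ := by
    refine (Submodule.eq_top_iff').2 fun v => ?_
    have h1 : -ν ∈ Submodule.span ℝ (tangentConeAt ℝ (closure Ω) x) :=
      Submodule.subset_span (hcone _ (by rw [inner_neg_left, hν2]; norm_num))
    have h2 : v - (⟪v, ν⟫_ℝ + 1) • ν ∈ Submodule.span ℝ (tangentConeAt ℝ (closure Ω) x) :=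
      Submodule.subset_span (hcone _ (by
        rw [inner_sub_left, inner_smul_left, hν2]; simp))
    have h3 := Submodule.sub_mem _ h2 (Submodule.smul_mem _ (⟪v, ν⟫_ℝ + 1) h1)
    rwa [smul_neg, sub_neg_eq_add, sub_add_cancel] at h3
  rw [htop]
  exact dense_univ

/-- Every tangent vector is the velocity of a curve on the boundary. -/
theorem exists_curve_mem_frontier (hΩ : HasC2Boundary Ω) {x τ : EuclideanSpace ℝ (Fin N)}
    (hx : x ∈ frontier Ω) (hτ : ⟪τ, outerNormal Ω x⟫_ℝ = 0) :
    ∃ γ : ℝ → EuclideanSpace ℝ (Fin N), γ 0 = x ∧ HasDerivAt γ τ 0 ∧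
      ∀ᶠ t in 𝓝 (0 : ℝ), γ t ∈ frontier Ω := by
  obtain ⟨V, e, g, hV, hxV, he, hg, hinv, -, hfr, hν⟩ := hΩ.exists_graph hx
  have hG0 := sub_gradient_ne_zero he (hg.of_le (by norm_num)) hinv x
  have hτ0 : ⟪τ, e - gradient g x⟫_ℝ = 0 := by
    rw [hν x hxV hx, inner_smul_right] at hτ
    exact (mul_eq_zero.1 hτ).resolve_left (inv_ne_zero (norm_ne_zero_iff.2 hG0))
  set γ : ℝ → EuclideanSpace ℝ (Fin N) :=
    fun t => x + t • τ - (⟪e, x + t • τ⟫_ℝ - g (x + t • τ)) • e with hγ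
  have hγ0 : γ 0 = x := by
    have := (hfr x hxV).1 hx
    simp [hγ, this]
  have hγd : HasDerivAt γ τ 0 := by
    have h1 := hasDerivAt_graph e hg x τ
    rw [hτ0] at h1
    have h2 : HasDerivAt (fun t : ℝ => x + t • τ) ((1 : ℝ) • τ) 0 :=
      ((hasDerivAt_id (0 : ℝ)).smul_const τ).const_add x
    have h3 := h2.sub (h1.smul_const e)
    rw [one_smul, zero_smul, sub_zero] at h3
    exact h3
  refine ⟨γ, hγ0, hγd, ?_⟩
  have hγt : Tendsto γ (𝓝 0) (𝓝 x) := by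
    have := hγd.continuousAt.tendsto
    rwa [hγ0] at this
  filter_upwards [hγt.eventually (hV.mem_nhds hxV)] with t ht
  rw [hfr _ ht]
  have hgt : g (γ t) = g (x + t • τ) := by
    have := hinv (x + t • τ) (-(⟪e, x + t • τ⟫_ℝ - g (x + t • τ)))
    rwa [neg_smul, ← sub_eq_add_neg] at this
  rw [hgt, hγ]
  simp only [inner_sub_right, inner_smul_right, real_inner_self_eq_norm_sq, he]
  ring

/-- A function which is constant on the boundary has no tangential derivative. -/
theorem apply_eq_zero_of_const_on_frontier (hΩ : HasC2Boundary Ω)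
    {x τ : EuclideanSpace ℝ (Fin N)} (hx : x ∈ frontier Ω) (hτ : ⟪τ, outerNormal Ω x⟫_ℝ = 0)
    {φ : EuclideanSpace ℝ (Fin N) → ℝ} {L : EuclideanSpace ℝ (Fin N) →L[ℝ] ℝ}
    (hφ : HasFDerivWithinAt φ L (closure Ω) x) {c : ℝ} (hc : ∀ y ∈ frontier Ω, φ y = c) :
    L τ = 0 := by
  obtain ⟨γ, hγ0, hγd, hγf⟩ := exists_curve_mem_frontier hΩ hx hτ
  rw [← hγ0] at hφ
  have h1 := hφ.comp_hasDerivAt 0 hγd (hγf.mono fun t ht => frontier_subset_closure ht)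
  have h2 : HasDerivAt (φ ∘ γ) 0 0 := (hasDerivAt_const (0 : ℝ) c).congr_of_eventuallyEq
    (hγf.mono fun t ht => hc _ ht)
  exact h1.unique h2

theorem isNormalExtensionAt_epsilon (hΩ : HasC2Boundary Ω) {x : EuclideanSpace ℝ (Fin N)}
    (hx : x ∈ frontier Ω) : IsNormalExtensionAt Ω x (Classical.epsilon (IsNormalExtensionAt Ω x)) :=
  Classical.epsilon_spec (exists_isNormalExtensionAt hΩ hx)

theorem exists_contDiff_isNormalExtensionAt (hΩ : HasC2Boundary Ω) {x : EuclideanSpace ℝ (Fin N)}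
    (hx : x ∈ frontier Ω) : ∃ (V : Set (EuclideanSpace ℝ (Fin N)))
      (m : EuclideanSpace ℝ (Fin N) → EuclideanSpace ℝ (Fin N)),
      IsOpen V ∧ x ∈ V ∧ ContDiff ℝ 1 m ∧
        ∀ y ∈ V, y ∈ frontier Ω → IsNormalExtensionAt Ω y m := by
  obtain ⟨V, e, g, hV, hxV, he, hg, hinv, -, hfr, hν⟩ := hΩ.exists_graph hx
  have hm := contDiff_normalized_sub_gradient he hg hinv
  refine ⟨V, _, hV, hxV, hm, fun y hy hyf => ⟨hm.contDiffAt, ?_⟩⟩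
  filter_upwards [hV.mem_nhds hy] with y' hy'
  refine ⟨?_, fun hf => ?_⟩
  · rw [norm_smul, norm_inv, norm_norm, inv_mul_cancel₀ (norm_ne_zero_iff.2
      (sub_gradient_ne_zero he (hg.of_le (by norm_num)) hinv y'))]
  · rw [← hν y' hy' hf]
    exact isOuterUnitNormal_outerNormal hΩ hf

/-- The exterior normal extends to a global `C¹` field whose derivative on the boundary has the
properties of the Jacobian of a unit extension. The local extensions are glued by a partition of
unity; as they agree on the boundary, the derivatives of the partition functions cancel there. -/
theorem exists_contDiff_normal (hb : Bornology.IsBounded Ω) (hΩ : HasC2Boundary Ω) :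
    ∃ n : EuclideanSpace ℝ (Fin N) → EuclideanSpace ℝ (Fin N), ContDiff ℝ 1 n ∧
      ∀ x ∈ frontier Ω, n x = outerNormal Ω x ∧ (∀ v, ⟪outerNormal Ω x, fderiv ℝ n x v⟫_ℝ = 0) ∧
        tr (fderiv ℝ n x) = tr (normalJacobian Ω x) ∧
        ∀ τ, ⟪τ, outerNormal Ω x⟫_ℝ = 0 → fderiv ℝ n x τ = normalJacobian Ω x τ := by
  have hK : IsCompact (frontier Ω) :=
    hb.isCompact_closure.of_isClosed_subset isClosed_frontier frontier_subset_closure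
  choose! V m hV hxV hm hext using fun x (hx : x ∈ frontier Ω) =>
    exists_contDiff_isNormalExtensionAt hΩ hx
  obtain ⟨t, θ, htK, hθ, -, hθV, hsum⟩ :=
    exists_contDiff_partition hK fun x hx => ⟨hV x hx, hxV x hx⟩
  have hθ1 : ∀ i, ContDiff ℝ 1 (θ i) := fun i => (hθ i).of_le (by norm_num)
  refine ⟨fun x => ∑ i, θ i x • m i x,
    ContDiff.sum fun i _ => (hθ1 i).smul (hm i (htK i)), fun x hx => ?_⟩
  have hsx : ∀ᶠ y in 𝓝 x, ∑ i, θ i y = 1 := hsum.filter_mono (nhds_le_nhdsSet hx)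
  have hsum1 : ∑ i, θ i x = 1 := hsx.self_of_nhds
  have hsum0 : ∑ i, fderiv ℝ (θ i) x = 0 := by
    rw [← fderiv_fun_sum fun i _ => (hθ1 i).differentiable one_ne_zero x,
      Filter.EventuallyEq.fderiv_eq (show (fun y => ∑ i, θ i y) =ᶠ[𝓝 x] fun _ => (1 : ℝ) from hsx)]
    simp
  have hi : ∀ i, θ i x = 0 ∧ fderiv ℝ (θ i) x = 0 ∨ IsNormalExtensionAt Ω x (m i) := fun i => by
    by_cases hxi : x ∈ tsupport (θ i)
    · exact Or.inr (hext i (htK i) x (hθV i hxi) hx)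
    · exact Or.inl ⟨image_eq_zero_of_notMem_tsupport hxi,
        Function.notMem_support.1 fun h => hxi (support_fderiv_subset ℝ h)⟩
  have hd : fderiv ℝ (fun x => ∑ i, θ i x • m i x) x = ∑ i, θ i x • fderiv ℝ (m i) x := by
    have h1 : ∀ i, HasFDerivAt (fun x => θ i x • m i x)
        (θ i x • fderiv ℝ (m i) x + (fderiv ℝ (θ i) x).smulRight (outerNormal Ω x)) x := by
      intro i
      have h2 := ((hθ1 i).differentiable one_ne_zero x).hasFDerivAt.smul
        ((hm i (htK i)).differentiable one_ne_zero x).hasFDerivAt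
      rcases hi i with h3 | h3
      · have h4 : (fderiv ℝ (θ i) x).smulRight (outerNormal Ω x) =
            (fderiv ℝ (θ i) x).smulRight (m i x) := by
          rw [h3.2]; ext1 v; simp
        rw [h4]
        exact h2
      · rw [← h3.apply_eq hΩ hx]
        exact h2
    rw [(HasFDerivAt.fun_sum fun i _ => h1 i).fderiv, Finset.sum_add_distrib, add_eq_left]
    ext1 v
    rw [_root_.sum_apply]
    simp only [ContinuousLinearMap.smulRight_apply]
    rw [← Finset.sum_smul, ← _root_.sum_apply, hsum0]
    simp
  rw [hd]
  have hnj := isNormalExtensionAt_epsilon hΩ hx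
  refine ⟨?_, fun v => ?_, ?_, fun τ hτ => ?_⟩
  · have : ∀ i, θ i x • m i x = θ i x • outerNormal Ω x := fun i => by
      rcases hi i with h3 | h3
      · simp [h3.1]
      · rw [h3.apply_eq hΩ hx]
    change ∑ i, θ i x • m i x = _
    rw [Finset.sum_congr rfl fun i _ => this i, ← Finset.sum_smul, hsum1, one_smul]
  · rw [_root_.sum_apply, inner_sum]
    refine Finset.sum_eq_zero fun i _ => ?_
    rcases hi i with h3 | h3
    · simp [h3.1]
    · rw [_root_.smul_apply, inner_smul_right, ← h3.apply_eq hΩ hx, h3.inner_fderiv_eq_zero,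
        mul_zero]
  · have h2 : ∀ i, tr (θ i x • fderiv ℝ (m i) x) = θ i x * tr (normalJacobian Ω x) := fun i => by
      rw [tr_smul]
      rcases hi i with h3 | h3
      · simp [h3.1]
      · rw [show tr (fderiv ℝ (m i) x) = tr (normalJacobian Ω x) from h3.trace_fderiv_eq hΩ hx hnj]
    have h4 : ∀ s : Finset t, tr (∑ i ∈ s, θ i x • fderiv ℝ (m i) x) =
        ∑ i ∈ s, tr (θ i x • fderiv ℝ (m i) x) := fun s => by
      simp [tr]
    rw [h4, Finset.sum_congr rfl fun i _ => h2 i, ← Finset.sum_mul, hsum1, one_mul]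
  · have h2 : ∀ i, (θ i x • fderiv ℝ (m i) x) τ = θ i x • normalJacobian Ω x τ := fun i => by
      rw [_root_.smul_apply]
      rcases hi i with h3 | h3
      · simp [h3.1]
      · rw [h3.fderiv_eq_of_inner_eq_zero hΩ hx hnj hτ]; rfl
    rw [_root_.sum_apply, Finset.sum_congr rfl fun i _ => h2 i, ← Finset.sum_smul, hsum1, one_smul]

end BoundaryGeometry

/-! ### The gradient and the Hessian of a function on the closure -/

section Regularity

variable {N : ℕ} {Ω : Set (EuclideanSpace ℝ (Fin N))} {u : EuclideanSpace ℝ (Fin N) → ℝ}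

theorem contDiffOn_gradientWithin (hopen : IsOpen Ω) (hΩ : HasC2Boundary Ω)
    (hu : ContDiffOn ℝ 2 u (closure Ω)) : ContDiffOn ℝ 1 (gradientWithin u (closure Ω))
      (closure Ω) := by
  have h1 : ContDiffOn ℝ 1 (fderivWithin ℝ u (closure Ω)) (closure Ω) :=
    hu.fderivWithin (uniqueDiffOn_closure hopen hΩ) (by norm_num)
  exact (InnerProductSpace.toDual ℝ
    (EuclideanSpace ℝ (Fin N))).symm.toContinuousLinearEquiv.contDiff.comp_contDiffOn h1

theorem closure_mem_nhds (hopen : IsOpen Ω) {x : EuclideanSpace ℝ (Fin N)} (hx : x ∈ Ω) :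
    closure Ω ∈ 𝓝 x := mem_of_superset (hopen.mem_nhds hx) subset_closure

theorem fderiv_eq_innerSL_gradientWithin (hopen : IsOpen Ω) {x : EuclideanSpace ℝ (Fin N)}
    (hx : x ∈ Ω) : fderiv ℝ u x = innerSL ℝ (gradientWithin u (closure Ω) x) := by
  ext v
  rw [innerSL_apply_apply, inner_gradientWithin_left,
    fderivWithin_of_mem_nhds (closure_mem_nhds hopen hx)]

theorem inner_fderiv_gradientWithin (hopen : IsOpen Ω) (hΩ : HasC2Boundary Ω)
    (hu : ContDiffOn ℝ 2 u (closure Ω)) {x : EuclideanSpace ℝ (Fin N)} (hx : x ∈ Ω)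
    (v w : EuclideanSpace ℝ (Fin N)) :
    ⟪fderiv ℝ (gradientWithin u (closure Ω)) x v, w⟫_ℝ = fderiv ℝ (fderiv ℝ u) x v w := by
  have h1 : fderiv ℝ u =ᶠ[𝓝 x] fun y => innerSL ℝ (gradientWithin u (closure Ω) y) := by
    filter_upwards [hopen.mem_nhds hx] with y hy using fderiv_eq_innerSL_gradientWithin hopen hy
  have h2 := (((contDiffOn_gradientWithin hopen hΩ hu).contDiffAt
    (closure_mem_nhds hopen hx)).differentiableAt one_ne_zero).hasFDerivAt
  have h3 := (innerSL ℝ (E := EuclideanSpace ℝ (Fin N))).hasFDerivAt.comp x h2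
  have h4 : fderiv ℝ (fun y => innerSL ℝ (gradientWithin u (closure Ω) y)) x = _ := h3.fderiv
  rw [h1.fderiv_eq, h4]
  rfl

theorem inner_fderiv_gradientWithin_comm (hopen : IsOpen Ω) (hΩ : HasC2Boundary Ω)
    (hu : ContDiffOn ℝ 2 u (closure Ω)) {x : EuclideanSpace ℝ (Fin N)} (hx : x ∈ Ω)
    (v w : EuclideanSpace ℝ (Fin N)) :
    ⟪fderiv ℝ (gradientWithin u (closure Ω)) x v, w⟫_ℝ =
      ⟪v, fderiv ℝ (gradientWithin u (closure Ω)) x w⟫_ℝ := by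
  rw [inner_fderiv_gradientWithin hopen hΩ hu hx, real_inner_comm,
    inner_fderiv_gradientWithin hopen hΩ hu hx]
  exact ((hu.contDiffAt (closure_mem_nhds hopen hx)).isSymmSndFDerivAt (by simp)) v w

theorem tr_fderiv_gradientWithin (hopen : IsOpen Ω) (hΩ : HasC2Boundary Ω)
    (hu : ContDiffOn ℝ 2 u (closure Ω)) {x : EuclideanSpace ℝ (Fin N)} (hx : x ∈ Ω) :
    tr (fderiv ℝ (gradientWithin u (closure Ω)) x) = Laplacian.laplacian u x := by
  rw [InnerProductSpace.laplacian_eq_iteratedFDeriv_orthonormalBasis u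
    (stdOrthonormalBasis ℝ (EuclideanSpace ℝ (Fin N))),
    tr_eq_sum (stdOrthonormalBasis ℝ (EuclideanSpace ℝ (Fin N)))]
  refine Finset.sum_congr rfl fun i _ => ?_
  rw [iteratedFDeriv_two_apply, real_inner_comm, inner_fderiv_gradientWithin hopen hΩ hu hx]
  simp

end Regularity

/-! ### The vector field of the Neumann identity -/

section NeumannIdentity

variable {N : ℕ}

/-- The Hessian of `u` on the closure of `Ω`, as the derivative of the gradient. -/
def hessian (Ω : Set (EuclideanSpace ℝ (Fin N))) (u : EuclideanSpace ℝ (Fin N) → ℝ)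
    (x : EuclideanSpace ℝ (Fin N)) : EuclideanSpace ℝ (Fin N) →L[ℝ] EuclideanSpace ℝ (Fin N) :=
  fderivWithin ℝ (gradientWithin u (closure Ω)) (closure Ω) x

/-- The gradient of `h = q - u`. -/
def gradDiff (Ω : Set (EuclideanSpace ℝ (Fin N))) (u : EuclideanSpace ℝ (Fin N) → ℝ)
    (z x : EuclideanSpace ℝ (Fin N)) : EuclideanSpace ℝ (Fin N) :=
  x - z - gradientWithin u (closure Ω) x

/-- The Hessian of `h = q - u`. -/
def hessDiff (Ω : Set (EuclideanSpace ℝ (Fin N))) (u : EuclideanSpace ℝ (Fin N) → ℝ)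
    (x : EuclideanSpace ℝ (Fin N)) : EuclideanSpace ℝ (Fin N) →L[ℝ] EuclideanSpace ℝ (Fin N) :=
  ContinuousLinearMap.id ℝ _ - hessian Ω u x

/-- The vector field whose divergence is `(c - u) |∇²h|²` and whose normal component on the boundary
is the integrand of the Neumann identity. With `w = c - u`, the first line is `-w (∇²h) ∇u`, the
second line is a field built from `∇u` and `∇h` only, and the last two lines are `R` times the
divergence of the exterior product of `w n` and `∇h`, where `n` extends the normal. The divergence
`Δh` of `∇h` is zero and does not appear. -/
def neumannField (Ω : Set (EuclideanSpace ℝ (Fin N))) (u : EuclideanSpace ℝ (Fin N) → ℝ)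
    (n : EuclideanSpace ℝ (Fin N) → EuclideanSpace ℝ (Fin N)) (z : EuclideanSpace ℝ (Fin N))
    (c R : ℝ) (x : EuclideanSpace ℝ (Fin N)) : EuclideanSpace ℝ (Fin N) :=
  (u x - c) • hessDiff Ω u x (gradientWithin u (closure Ω) x) +
  ((‖gradientWithin u (closure Ω) x‖ ^ 2 / 2 - N * (c - u x) + R ^ 2 / 2) • gradDiff Ω u z x -
    ⟪gradientWithin u (closure Ω) x, gradDiff Ω u z x⟫_ℝ • gradientWithin u (closure Ω) x) +
  R • ((-⟪gradientWithin u (closure Ω) x, n x⟫_ℝ + (c - u x) * tr (fderiv ℝ n x)) • gradDiff Ω u z x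
    + (c - u x) • hessDiff Ω u x (n x) +
    ⟪gradientWithin u (closure Ω) x, gradDiff Ω u z x⟫_ℝ • n x -
    (c - u x) • fderiv ℝ n x (gradDiff Ω u z x))

variable {Ω : Set (EuclideanSpace ℝ (Fin N))} {u : EuclideanSpace ℝ (Fin N) → ℝ}
  {n : EuclideanSpace ℝ (Fin N) → EuclideanSpace ℝ (Fin N)}

theorem contDiffOn_gradDiff (hopen : IsOpen Ω) (hΩ : HasC2Boundary Ω)
    (hu : ContDiffOn ℝ 2 u (closure Ω)) (z : EuclideanSpace ℝ (Fin N)) :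
    ContDiffOn ℝ 1 (gradDiff Ω u z) (closure Ω) :=
  (contDiffOn_id.sub contDiffOn_const).sub (contDiffOn_gradientWithin hopen hΩ hu)

theorem hessian_eq_fderiv (hopen : IsOpen Ω) {x : EuclideanSpace ℝ (Fin N)} (hx : x ∈ Ω) :
    hessian Ω u x = fderiv ℝ (gradientWithin u (closure Ω)) x :=
  fderivWithin_of_mem_nhds (closure_mem_nhds hopen hx)

theorem hasFDerivAt_gradientWithin (hopen : IsOpen Ω) (hΩ : HasC2Boundary Ω)
    (hu : ContDiffOn ℝ 2 u (closure Ω)) {x : EuclideanSpace ℝ (Fin N)} (hx : x ∈ Ω) :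
    HasFDerivAt (gradientWithin u (closure Ω)) (hessian Ω u x) x := by
  rw [hessian_eq_fderiv hopen hx]
  exact (((contDiffOn_gradientWithin hopen hΩ hu).contDiffAt
    (closure_mem_nhds hopen hx)).differentiableAt one_ne_zero).hasFDerivAt

theorem hasFDerivAt_gradDiff (hopen : IsOpen Ω) (hΩ : HasC2Boundary Ω)
    (hu : ContDiffOn ℝ 2 u (closure Ω)) {x : EuclideanSpace ℝ (Fin N)} (hx : x ∈ Ω)
    (z : EuclideanSpace ℝ (Fin N)) : HasFDerivAt (gradDiff Ω u z) (hessDiff Ω u x) x :=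
  ((hasFDerivAt_id x).sub_const z).sub (hasFDerivAt_gradientWithin hopen hΩ hu hx)

theorem hasFDerivAt_of_mem (hopen : IsOpen Ω) (hu : ContDiffOn ℝ 2 u (closure Ω))
    {x : EuclideanSpace ℝ (Fin N)} (hx : x ∈ Ω) :
    HasFDerivAt u (innerSL ℝ (gradientWithin u (closure Ω) x)) x := by
  rw [← fderiv_eq_innerSL_gradientWithin hopen hx]
  exact ((hu.contDiffAt (closure_mem_nhds hopen hx)).differentiableAt (by norm_num)).hasFDerivAt

theorem continuousOn_hessian (hopen : IsOpen Ω) (hΩ : HasC2Boundary Ω)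
    (hu : ContDiffOn ℝ 2 u (closure Ω)) : ContinuousOn (hessian Ω u) (closure Ω) :=
  (contDiffOn_gradientWithin hopen hΩ hu).continuousOn_fderivWithin
    (uniqueDiffOn_closure hopen hΩ) le_rfl

theorem continuousOn_hessDiff (hopen : IsOpen Ω) (hΩ : HasC2Boundary Ω)
    (hu : ContDiffOn ℝ 2 u (closure Ω)) : ContinuousOn (hessDiff Ω u) (closure Ω) :=
  continuousOn_const.sub (continuousOn_hessian hopen hΩ hu)

theorem continuousOn_tr_hessDiff_sq (hopen : IsOpen Ω) (hΩ : HasC2Boundary Ω)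
    (hu : ContDiffOn ℝ 2 u (closure Ω)) :
    ContinuousOn (fun x => tr (hessDiff Ω u x ∘L hessDiff Ω u x)) (closure Ω) :=
  continuous_tr.comp_continuousOn
    ((continuousOn_hessDiff hopen hΩ hu).clm_comp (continuousOn_hessDiff hopen hΩ hu))

theorem inner_hessian_comm (hopen : IsOpen Ω) (hΩ : HasC2Boundary Ω)
    (hu : ContDiffOn ℝ 2 u (closure Ω)) {x : EuclideanSpace ℝ (Fin N)} (hx : x ∈ Ω)
    (v w : EuclideanSpace ℝ (Fin N)) : ⟪hessian Ω u x v, w⟫_ℝ = ⟪v, hessian Ω u x w⟫_ℝ := by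
  rw [hessian_eq_fderiv hopen hx]
  exact inner_fderiv_gradientWithin_comm hopen hΩ hu hx v w

theorem tr_hessDiff (hopen : IsOpen Ω) (hΩ : HasC2Boundary Ω) (hu : ContDiffOn ℝ 2 u (closure Ω))
    (hPoisson : ∀ x ∈ Ω, Laplacian.laplacian u x = N) {x : EuclideanSpace ℝ (Fin N)}
    (hx : x ∈ Ω) : tr (hessDiff Ω u x) = 0 := by
  rw [hessDiff, tr_sub, tr_id, hessian_eq_fderiv hopen hx, tr_fderiv_gradientWithin hopen hΩ hu hx,
    hPoisson x hx, finrank_euclideanSpace_fin, sub_self]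

/-- Continuity of the three summands of `neumannField`, for arbitrary continuous ingredients. -/
theorem continuousOn_neumannField_aux (hn : ContDiff ℝ 1 n) {c R : ℝ}
    {S : Set (EuclideanSpace ℝ (Fin N))} {p P : EuclideanSpace ℝ (Fin N) → EuclideanSpace ℝ (Fin N)}
    {M : EuclideanSpace ℝ (Fin N) → EuclideanSpace ℝ (Fin N) →L[ℝ] EuclideanSpace ℝ (Fin N)}
    (h1 : ContinuousOn u S) (h2 : ContinuousOn p S) (h3 : ContinuousOn P S)
    (h4 : ContinuousOn M S) :
    ContinuousOn (fun x => (u x - c) • M x (p x)) S ∧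
    ContinuousOn (fun x => (‖p x‖ ^ 2 / 2 - N * (c - u x) + R ^ 2 / 2) • P x -
      ⟪p x, P x⟫_ℝ • p x) S ∧
    ContinuousOn (fun x => R • ((-⟪p x, n x⟫_ℝ + (c - u x) * tr (fderiv ℝ n x)) • P x
      + (c - u x) • M x (n x) + ⟪p x, P x⟫_ℝ • n x - (c - u x) • fderiv ℝ n x (P x))) S := by
  have h5 : ContinuousOn n S := hn.continuous.continuousOn
  have h6 : ContinuousOn (fderiv ℝ n) S := (hn.continuous_fderiv one_ne_zero).continuousOn
  have h7 : ContinuousOn (fun x => tr (fderiv ℝ n x)) S := continuous_tr.comp_continuousOn h6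
  have hw : ContinuousOn (fun x => c - u x) S := continuousOn_const.sub h1
  have hpP : ContinuousOn (fun x => ⟪p x, P x⟫_ℝ) S := h2.inner h3
  have hpn : ContinuousOn (fun x => ⟪p x, n x⟫_ℝ) S := h2.inner h5
  have hMp : ContinuousOn (fun x => M x (p x)) S := h4.clm_apply h2
  have hMn : ContinuousOn (fun x => M x (n x)) S := h4.clm_apply h5
  have hDP : ContinuousOn (fun x => fderiv ℝ n x (P x)) S := h6.clm_apply h3
  have hN : ContinuousOn (fun x => ‖p x‖ ^ 2) S := h2.norm.pow 2
  refine ⟨(h1.sub continuousOn_const).smul hMp, ?_, ?_⟩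
  · exact ((((hN.div_const 2).sub (continuousOn_const.mul hw)).add
      continuousOn_const).smul h3).sub (hpP.smul h2)
  · exact ((((hpn.neg.add (hw.mul h7)).smul h3).add (hw.smul hMn) |>.add
      (hpP.smul h5)).sub (hw.smul hDP)).const_smul R

theorem continuousOn_neumannField (hopen : IsOpen Ω) (hΩ : HasC2Boundary Ω)
    (hu : ContDiffOn ℝ 2 u (closure Ω)) (hn : ContDiff ℝ 1 n) (z : EuclideanSpace ℝ (Fin N))
    (c R : ℝ) : ContinuousOn (neumannField Ω u n z c R) (closure Ω) := by
  obtain ⟨c1, c2, c3⟩ := continuousOn_neumannField_aux hn (c := c) (R := R) hu.continuousOn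
    (contDiffOn_gradientWithin hopen hΩ hu).continuousOn
    (contDiffOn_gradDiff hopen hΩ hu z).continuousOn (continuousOn_hessDiff hopen hΩ hu)
  exact (c1.add c2).add c3

/-- The three lines of `neumannField` have the divergences `w |∇²h|² + ⟨p, (∇²h) p⟩`,
`-⟨p, (∇²h) p⟩` and `0`, where `p = ∇u` and `w = c - u`. -/
theorem isWeakDivergence_neumannField (hopen : IsOpen Ω) (hb : Bornology.IsBounded Ω)
    (hΩ : HasC2Boundary Ω) (hu : ContDiffOn ℝ 2 u (closure Ω))
    (hPoisson : ∀ x ∈ Ω, Laplacian.laplacian u x = N) (hn : ContDiff ℝ 1 n)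
    (z : EuclideanSpace ℝ (Fin N)) (c R : ℝ) :
    IsWeakDivergence Ω (neumannField Ω u n z c R)
      (fun x => (c - u x) * tr (hessDiff Ω u x ∘L hessDiff Ω u x)) := by
  have hu1 := hu.continuousOn
  have hp1 := contDiffOn_gradientWithin hopen hΩ hu
  have hP1 := contDiffOn_gradDiff hopen hΩ hu z
  have hMc := continuousOn_hessDiff hopen hΩ hu
  have hMsq := continuousOn_tr_hessDiff_sq hopen hΩ hu
  have hn' := hn.continuous_fderiv one_ne_zero
  have hwc : ContinuousOn (fun x => c - u x) (closure Ω) := continuousOn_const.sub hu1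
  have huΩ : ContDiffOn ℝ 1 u Ω := (hu.mono subset_closure).of_le (by norm_num)
  have hdu := fun x (hx : x ∈ Ω) => hasFDerivAt_of_mem hopen hu hx
  have hdp := fun x (hx : x ∈ Ω) => hasFDerivAt_gradientWithin hopen hΩ hu hx
  have hdP := fun x (hx : x ∈ Ω) => hasFDerivAt_gradDiff hopen hΩ hu hx z
  have htr := fun x (hx : x ∈ Ω) => tr_hessDiff hopen hΩ hu hPoisson hx
  have hsymm := fun x (hx : x ∈ Ω) => inner_hessian_comm hopen hΩ hu hx
  set p := gradientWithin u (closure Ω) with hp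
  set P := gradDiff Ω u z with hP
  set M := hessDiff Ω u with hM
  obtain ⟨c1, c2, c3⟩ := continuousOn_neumannField_aux hn (c := c) (R := R) hu1 hp1.continuousOn
    hP1.continuousOn hMc
  have hpMp : ContinuousOn (fun x => ⟪p x, M x (p x)⟫_ℝ) (closure Ω) :=
    hp1.continuousOn.inner (hMc.clm_apply hp1.continuousOn)
  -- the field `(u - c) (∇²h) ∇u`
  have w1 : IsWeakDivergence Ω (fun x => (u x - c) • M x (p x))
      (fun x => (c - u x) * tr (M x ∘L M x) + ⟪p x, M x (p x)⟫_ℝ) := by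
    refine ((isWeakDivergence_fderiv_apply hopen (hp1.mono subset_closure)
      (hP1.mono subset_closure) fun x hx => ?_).mul (θ := fun x => u x - c) hopen
        ((hu.mono subset_closure).sub contDiffOn_const)).congr hopen (fun x hx => ?_)
        (fun x hx => ?_)
    · rw [(hdP x hx).fderiv, htr x hx]
    · rw [(hdP x hx).fderiv]
    · have hB : hessian Ω u x = ContinuousLinearMap.id ℝ _ - M x := by
        rw [hM, hessDiff, sub_sub_cancel]
      rw [(hdP x hx).fderiv, (hdp x hx).fderiv, hB, ContinuousLinearMap.comp_sub, tr_sub,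
        ContinuousLinearMap.comp_id, htr x hx, ((hdu x hx).sub_const c).fderiv]
      simp only [innerSL_apply_apply]
      ring
  -- the field built from first derivatives only
  have w2 : IsWeakDivergence Ω (fun x => (‖p x‖ ^ 2 / 2 - N * (c - u x) + R ^ 2 / 2) • P x -
      ⟪p x, P x⟫_ℝ • p x) (fun x => -⟪p x, M x (p x)⟫_ℝ) := by
    have hpΩ := hp1.mono (subset_closure (s := Ω))
    have hPΩ := hP1.mono (subset_closure (s := Ω))
    refine (isWeakDivergence_of_contDiffOn hopen (((((hpΩ.norm_sq ℝ).div_const 2).sub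
      (contDiffOn_const.mul (contDiffOn_const.sub huΩ))).add contDiffOn_const).smul hPΩ
        |>.sub ((hpΩ.inner ℝ hPΩ).smul hpΩ))).congr hopen (fun x hx => rfl) (fun x hx => ?_)
    have d1 := ((((hdp x hx).norm_sq).mul_const (2 : ℝ)⁻¹).sub
      (((hdu x hx).const_sub c).const_mul (N : ℝ))).add_const (R ^ 2 / 2)
    have d2 := (d1.smul (hdP x hx)).sub (((hdp x hx).inner ℝ (hdP x hx)).smul (hdp x hx))
    have d3 : fderiv ℝ (fun x => (‖p x‖ ^ 2 / 2 - N * (c - u x) + R ^ 2 / 2) • P x -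
      ⟪p x, P x⟫_ℝ • p x) x = _ := d2.fderiv
    have hB : tr (hessian Ω u x) = N := by
      have := htr x hx
      rw [hM, hessDiff, tr_sub, tr_id, finrank_euclideanSpace_fin] at this
      linarith
    change tr (fderiv ℝ (fun x => (‖p x‖ ^ 2 / 2 - N * (c - u x) + R ^ 2 / 2) • P x -
      ⟪p x, P x⟫_ℝ • p x) x) = _
    rw [d3]
    simp [htr x hx, hB]
    rw [hsymm x hx (p x) (P x)]
    ring
  -- the field which comes from the exterior product
  have w3 : IsWeakDivergence Ω (fun x => R • ((-⟪p x, n x⟫_ℝ + (c - u x) * tr (fderiv ℝ n x)) • P x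
      + (c - u x) • M x (n x) + ⟪p x, P x⟫_ℝ • n x - (c - u x) • fderiv ℝ n x (P x)))
      (fun _ => 0) := by
    have ha : ContDiffOn ℝ 1 (fun x => (R * (c - u x)) • n x) Ω :=
      (contDiffOn_const.mul (contDiffOn_const.sub huΩ)).smul hn.contDiffOn
    refine (isWeakDivergence_wedge hopen ha (hP1.mono subset_closure)).congr hopen
      (fun x hx => ?_) (fun x hx => rfl)
    have d1 := (((hdu x hx).const_sub c).const_mul R).smul
      (hn.differentiable one_ne_zero x).hasFDerivAt
    have d2 : fderiv ℝ (fun x => (R * (c - u x)) • n x) x = _ := d1.fderiv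
    rw [d2, (hdP x hx).fderiv, htr x hx]
    simp
    module
  refine ((w1.add w2 hb ?_ ?_ ?_ ?_).add w3 hb ?_ ?_ ?_ ?_).congr hopen (fun x hx => rfl)
    (fun x hx => by ring)
  · exact c1
  · exact c2
  · exact (hwc.mul hMsq).add hpMp
  · exact hpMp.neg
  · exact c1.add c2
  · exact c3
  · exact ((hwc.mul hMsq).add hpMp).add hpMp.neg
  · exact continuousOn_const

end NeumannIdentity

/-! ### The normal component of the field and the Neumann identity -/

section BoundaryIdentity

variable {N : ℕ} {Ω : Set (EuclideanSpace ℝ (Fin N))} {u : EuclideanSpace ℝ (Fin N) → ℝ}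
  {n : EuclideanSpace ℝ (Fin N) → EuclideanSpace ℝ (Fin N)}

theorem hasFDerivWithinAt_closure (hu : ContDiffOn ℝ 2 u (closure Ω))
    {x : EuclideanSpace ℝ (Fin N)} (hx : x ∈ closure Ω) :
    HasFDerivWithinAt u (innerSL ℝ (gradientWithin u (closure Ω) x)) (closure Ω) x := by
  have h := ((hu x hx).differentiableWithinAt (by norm_num)).hasGradientWithinAt
  exact h.hasFDerivWithinAt

theorem hasFDerivAt_quadratic (z : EuclideanSpace ℝ (Fin N)) (a : ℝ)
    (x : EuclideanSpace ℝ (Fin N)) : HasFDerivAt (quadratic z a) (innerSL ℝ (x - z)) x := by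
  have h := ((((hasFDerivAt_id x).sub_const z).norm_sq).mul_const (2 : ℝ)⁻¹).add_const a
  refine h.congr_fderiv ?_
  ext v
  simp

theorem normalDeriv_quadratic_sub (hopen : IsOpen Ω) (hΩ : HasC2Boundary Ω)
    (hu : ContDiffOn ℝ 2 u (closure Ω)) (z : EuclideanSpace ℝ (Fin N)) (a : ℝ)
    {x : EuclideanSpace ℝ (Fin N)} (hx : x ∈ closure Ω) :
    normalDeriv Ω (fun y => quadratic z a y - u y) x = ⟪gradDiff Ω u z x, outerNormal Ω x⟫_ℝ := by
  have h := ((hasFDerivAt_quadratic z a x).hasFDerivWithinAt (s := closure Ω)).sub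
    (hasFDerivWithinAt_closure hu hx)
  have h' : fderivWithin ℝ (fun y => quadratic z a y - u y) (closure Ω) x =
    innerSL ℝ (gradDiff Ω u z x) := by
    refine (h.fderivWithin (uniqueDiffOn_closure hopen hΩ x hx)).trans ?_
    rw [gradDiff, map_sub (innerSL ℝ) (x - z)]
  rw [normalDeriv, gradientWithin, h']
  congr 1
  exact (InnerProductSpace.toDual ℝ _).symm_apply_apply _

/-- The normal component of `neumannField` on the boundary. The second derivatives of `u` enter only
through `⟪(∇²u) τ, ν⟫` with `τ` tangential, and differentiating the Neumann condition along the
boundary expresses this number through `∇ν`. -/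
theorem inner_neumannField (hopen : IsOpen Ω) (hΩ : HasC2Boundary Ω)
    (hu : ContDiffOn ℝ 2 u (closure Ω)) {R : ℝ} (hR : ∀ x ∈ frontier Ω, normalDeriv Ω u x = R)
    (hn : ContDiff ℝ 1 n) (hnν : ∀ x ∈ frontier Ω, n x = outerNormal Ω x)
    (z : EuclideanSpace ℝ (Fin N)) (c : ℝ) {x : EuclideanSpace ℝ (Fin N)} (hx : x ∈ frontier Ω)
    (hD : ∀ v, ⟪outerNormal Ω x, fderiv ℝ n x v⟫_ℝ = 0) :
    ⟪neumannField Ω u n z c R x, outerNormal Ω x⟫_ℝ =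
      1 / 2 * (‖tangentialGradient Ω u x‖ ^ 2 * ⟪gradDiff Ω u z x, outerNormal Ω x⟫_ℝ) +
      (c - u x) * (R * tr (fderiv ℝ n x) - N) * ⟪gradDiff Ω u z x, outerNormal Ω x⟫_ℝ -
      (c - u x) * ⟪fderiv ℝ n x (tangentialGradient Ω u x), tangentialGradient Ω u x⟫_ℝ := by
  have hxc := frontier_subset_closure hx
  have hν := (isOuterUnitNormal_outerNormal hΩ hx).1
  have hτ : tangentialGradient Ω u x = gradientWithin u (closure Ω) x - R • outerNormal Ω x := by
    rw [tangentialGradient, hR x hx]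
  have hpR := hR x hx
  rw [normalDeriv] at hpR
  have hnx := hnν x hx
  set ν := outerNormal Ω x
  have hτν : ⟪tangentialGradient Ω u x, ν⟫_ℝ = 0 := by
    rw [hτ, inner_sub_left, inner_smul_left, hpR, real_inner_self_eq_norm_sq, hν]
    simp
  have hp : HasFDerivWithinAt (gradientWithin u (closure Ω)) (hessian Ω u x) (closure Ω) x :=
    (((contDiffOn_gradientWithin hopen hΩ hu) x hxc).differentiableWithinAt
      one_ne_zero).hasFDerivWithinAt
  have hφ := hp.inner ℝ ((hn.differentiable one_ne_zero x).hasFDerivAt.hasFDerivWithinAt)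
  have h0 := apply_eq_zero_of_const_on_frontier hΩ hx hτν hφ (c := R) fun y hy => by
    rw [hnν y hy]; exact hR y hy
  simp only [ContinuousLinearMap.coe_comp, Function.comp_apply, ContinuousLinearMap.prod_apply,
    fderivInnerCLM_apply, hnx] at h0
  have hpp : gradientWithin u (closure Ω) x = tangentialGradient Ω u x + R • ν := by
    rw [hτ, sub_add_cancel]
  have hself : ⟪ν, ν⟫_ℝ = 1 := by rw [real_inner_self_eq_norm_sq, hν]; norm_num
  have hsq : ‖gradientWithin u (closure Ω) x‖ ^ 2 = ‖tangentialGradient Ω u x‖ ^ 2 + R ^ 2 := by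
    rw [hpp, ← real_inner_self_eq_norm_sq, ← real_inner_self_eq_norm_sq]
    simp only [inner_add_left, inner_add_right, inner_smul_left, inner_smul_right, hself, hτν,
      real_inner_comm (tangentialGradient Ω u x) ν, conj_trivial]
    ring
  have hD' : ∀ v, ⟪fderiv ℝ n x v, ν⟫_ℝ = 0 := fun v => by rw [real_inner_comm, hD]
  have hMτ : ⟪hessDiff Ω u x (tangentialGradient Ω u x), ν⟫_ℝ =
      ⟪fderiv ℝ n x (tangentialGradient Ω u x), tangentialGradient Ω u x⟫_ℝ := by
    rw [hpp, inner_add_left, inner_smul_left, hD] at h0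
    rw [hessDiff, _root_.sub_apply, inner_sub_left, ContinuousLinearMap.id_apply, hτν,
      real_inner_comm (tangentialGradient Ω u x)]
    simp only [mul_zero, add_zero] at h0
    linarith
  have hMp : ⟪hessDiff Ω u x (gradientWithin u (closure Ω) x), ν⟫_ℝ =
      ⟪fderiv ℝ n x (tangentialGradient Ω u x), tangentialGradient Ω u x⟫_ℝ +
        R * ⟪hessDiff Ω u x ν, ν⟫_ℝ := by
    rw [← hMτ]
    conv_lhs => rw [hpp]
    rw [map_add, map_smul, inner_add_left, inner_smul_left]
    simp
  simp only [neumannField, inner_add_left, inner_sub_left, inner_smul_left, conj_trivial, hnx, hself,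
    hD', hpR, hMp, hsq]
  ring

/-- Integrated over `Ω`, the divergence of `neumannField` gives the Neumann identity. -/
theorem integral_mul_tr_hessDiff_sq (hN : 2 ≤ N) (hopen : IsOpen Ω) (hb : Bornology.IsBounded Ω)
    (hΩ : HasC2Boundary Ω) (hu : ContDiffOn ℝ 2 u (closure Ω))
    (hPoisson : ∀ x ∈ Ω, Laplacian.laplacian u x = N)
    (hNeumann : ∀ x ∈ frontier Ω, normalDeriv Ω u x = neumannConstant Ω)
    (z : EuclideanSpace ℝ (Fin N)) (a : ℝ) :
    ∫ x in Ω, (maxOnClosure Ω u - u x) * tr (hessDiff Ω u x ∘L hessDiff Ω u x) =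
      neumannBoundarySide Ω u z a := by
  obtain ⟨n, hn, hext⟩ := exists_contDiff_normal hb hΩ
  set c := maxOnClosure Ω u with hc
  set R := neumannConstant Ω with hR
  have hsub : frontier Ω ⊆ closure Ω := frontier_subset_closure
  have hu1 : ContinuousOn u (frontier Ω) := hu.continuousOn.mono hsub
  have hp1 := (contDiffOn_gradientWithin hopen hΩ hu).continuousOn.mono hsub
  have hP1 := (contDiffOn_gradDiff hopen hΩ hu z).continuousOn.mono hsub
  have hn1 : ContinuousOn n (frontier Ω) := hn.continuous.continuousOn
  have hD1 : ContinuousOn (fderiv ℝ n) (frontier Ω) :=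
    (hn.continuous_fderiv one_ne_zero).continuousOn
  have hT1 : ContinuousOn (fun x => tr (fderiv ℝ n x)) (frontier Ω) :=
    continuous_tr.comp_continuousOn hD1
  have hw1 : ContinuousOn (fun x => c - u x) (frontier Ω) := continuousOn_const.sub hu1
  have hτ1 : ContinuousOn (tangentialGradient Ω u) (frontier Ω) := by
    refine (hp1.sub (hn1.const_smul R)).congr fun x hx => ?_
    simp only [tangentialGradient, hNeumann x hx, Pi.sub_apply, Pi.smul_apply, (hext x hx).1]
  have hPn1 : ContinuousOn (fun x => ⟪gradDiff Ω u z x, outerNormal Ω x⟫_ℝ) (frontier Ω) :=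
    hP1.inner (continuousOn_outerNormal hΩ)
  have hDτ1 : ContinuousOn (fun x => ⟪fderiv ℝ n x (tangentialGradient Ω u x),
      tangentialGradient Ω u x⟫_ℝ) (frontier Ω) := (hD1.clm_apply hτ1).inner hτ1
  have hsq1 : ContinuousOn (fun x => ‖tangentialGradient Ω u x‖ ^ 2) (frontier Ω) := hτ1.norm.pow 2
  have i1 : IntegrableOn (fun x => ‖tangentialGradient Ω u x‖ ^ 2 *
      ⟪gradDiff Ω u z x, outerNormal Ω x⟫_ℝ) (frontier Ω) μHE[N - 1] :=
    ContinuousOn.integrableOn_frontier hΩ hb (hsq1.mul hPn1)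
  have i2 : IntegrableOn (fun x => (c - u x) * (R * tr (fderiv ℝ n x) - N) *
      ⟪gradDiff Ω u z x, outerNormal Ω x⟫_ℝ) (frontier Ω) μHE[N - 1] :=
    ContinuousOn.integrableOn_frontier hΩ hb
    ((hw1.mul ((continuousOn_const (c := R).mul hT1).sub
      (continuousOn_const (c := (N : ℝ))))).mul hPn1)
  have i3 : IntegrableOn (fun x => (c - u x) * ⟪fderiv ℝ n x (tangentialGradient Ω u x),
      tangentialGradient Ω u x⟫_ℝ) (frontier Ω) μHE[N - 1] :=
    ContinuousOn.integrableOn_frontier hΩ hb (hw1.mul hDτ1)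
  have i12 : IntegrableOn (fun x => 1 / 2 * (‖tangentialGradient Ω u x‖ ^ 2 *
      ⟪gradDiff Ω u z x, outerNormal Ω x⟫_ℝ) + (c - u x) * (R * tr (fderiv ℝ n x) - N) *
      ⟪gradDiff Ω u z x, outerNormal Ω x⟫_ℝ) (frontier Ω) μHE[N - 1] := (i1.const_mul _).add i2
  have hmeas : MeasurableSet (frontier Ω) := isClosed_frontier.measurableSet
  have hN1 : (N : ℝ) - 1 ≠ 0 := by
    have : (2 : ℝ) ≤ N := by exact_mod_cast hN
    linarith
  have e1 : ∫ x in frontier Ω, ‖tangentialGradient Ω u x‖ ^ 2 *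
      normalDeriv Ω (fun y => quadratic z a y - u y) x ∂μHE[N - 1] =
      ∫ x in frontier Ω, ‖tangentialGradient Ω u x‖ ^ 2 *
        ⟪gradDiff Ω u z x, outerNormal Ω x⟫_ℝ ∂μHE[N - 1] :=
    setIntegral_congr_fun hmeas fun x hx => by
      simp only [normalDeriv_quadratic_sub hopen hΩ hu z a (hsub hx)]
  have e2 : ∫ x in frontier Ω, (c - u x) * (((N : ℝ) - 1) * R * meanCurvature Ω x - N) *
      normalDeriv Ω (fun y => quadratic z a y - u y) x ∂μHE[N - 1] =
      ∫ x in frontier Ω, (c - u x) * (R * tr (fderiv ℝ n x) - N) *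
        ⟪gradDiff Ω u z x, outerNormal Ω x⟫_ℝ ∂μHE[N - 1] :=
    setIntegral_congr_fun hmeas fun x hx => by
      have : ((N : ℝ) - 1) * R * meanCurvature Ω x = R * tr (fderiv ℝ n x) := by
        rw [(hext x hx).2.2.1, meanCurvature, tr]
        field_simp
      simp only [normalDeriv_quadratic_sub hopen hΩ hu z a (hsub hx), this]
  have e3 : ∫ x in frontier Ω, (c - u x) *
      ⟪normalJacobian Ω x (tangentialGradient Ω u x), tangentialGradient Ω u x⟫_ℝ ∂μHE[N - 1] =
      ∫ x in frontier Ω, (c - u x) *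
      ⟪fderiv ℝ n x (tangentialGradient Ω u x), tangentialGradient Ω u x⟫_ℝ ∂μHE[N - 1] :=
    setIntegral_congr_fun hmeas fun x hx => by
      have hτν : ⟪tangentialGradient Ω u x, outerNormal Ω x⟫_ℝ = 0 := by
        rw [tangentialGradient, normalDeriv, inner_sub_left, inner_smul_left,
          real_inner_self_eq_norm_sq, (isOuterUnitNormal_outerNormal hΩ hx).1]
        simp
      simp only [(hext x hx).2.2.2 _ hτν]
  have e4 : ∫ x in frontier Ω, ⟪neumannField Ω u n z c R x, outerNormal Ω x⟫_ℝ ∂μHE[N - 1] = _ :=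
    setIntegral_congr_fun hmeas fun x hx => inner_neumannField hopen hΩ hu hNeumann hn
      (fun y hy => (hext y hy).1) z c hx (hext x hx).2.1
  rw [neumannBoundarySide, e1, e2, e3, (isWeakDivergence_neumannField hopen hb hΩ hu hPoisson hn z c
    R).integral_eq hopen hb hΩ (continuousOn_neumannField hopen hΩ hu hn z c R)
    ((continuousOn_const.sub hu.continuousOn).mul (continuousOn_tr_hessDiff_sq hopen hΩ hu)), e4,
    integral_sub i12 i3, integral_add (i1.const_mul _) i2, integral_const_mul]

end BoundaryIdentity

/-! ### Rigidity -/

section Rigidity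

variable {N : ℕ} {Ω : Set (EuclideanSpace ℝ (Fin N))} {u : EuclideanSpace ℝ (Fin N) → ℝ}

theorem tr_comp_self_eq_sum_norm_sq {E ι : Type*} [NormedAddCommGroup E] [InnerProductSpace ℝ E]
    [FiniteDimensional ℝ E] [Fintype ι] (b : OrthonormalBasis ι ℝ E) {M : E →L[ℝ] E}
    (hM : ∀ v w, ⟪M v, w⟫_ℝ = ⟪v, M w⟫_ℝ) : tr (M ∘L M) = ∑ i, ‖M (b i)‖ ^ 2 := by
  rw [tr_eq_sum b]
  refine Finset.sum_congr rfl fun i _ => ?_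
  rw [ContinuousLinearMap.comp_apply, ← hM, real_inner_self_eq_norm_sq]

theorem tr_comp_self_nonneg {E : Type*} [NormedAddCommGroup E] [InnerProductSpace ℝ E]
    [FiniteDimensional ℝ E] {M : E →L[ℝ] E} (hM : ∀ v w, ⟪M v, w⟫_ℝ = ⟪v, M w⟫_ℝ) :
    0 ≤ tr (M ∘L M) := by
  rw [tr_comp_self_eq_sum_norm_sq (stdOrthonormalBasis ℝ E) hM]
  exact Finset.sum_nonneg fun i _ => sq_nonneg _

theorem eq_zero_of_tr_comp_self_eq_zero {E : Type*} [NormedAddCommGroup E] [InnerProductSpace ℝ E]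
    [FiniteDimensional ℝ E] {M : E →L[ℝ] E} (hM : ∀ v w, ⟪M v, w⟫_ℝ = ⟪v, M w⟫_ℝ)
    (h : tr (M ∘L M) = 0) : M = 0 := by
  rw [tr_comp_self_eq_sum_norm_sq (stdOrthonormalBasis ℝ E) hM,
    Finset.sum_eq_zero_iff_of_nonneg fun i _ => sq_nonneg _] at h
  refine ContinuousLinearMap.coe_injective
    ((stdOrthonormalBasis ℝ E).toBasis.ext fun i => ?_)
  have := h i (Finset.mem_univ i)
  simpa using this

theorem inner_hessDiff_comm (hopen : IsOpen Ω) (hΩ : HasC2Boundary Ω)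
    (hu : ContDiffOn ℝ 2 u (closure Ω)) {x : EuclideanSpace ℝ (Fin N)} (hx : x ∈ Ω)
    (v w : EuclideanSpace ℝ (Fin N)) : ⟪hessDiff Ω u x v, w⟫_ℝ = ⟪v, hessDiff Ω u x w⟫_ℝ := by
  simp only [hessDiff, _root_.sub_apply, inner_sub_left, inner_sub_right,
    ContinuousLinearMap.id_apply, inner_hessian_comm hopen hΩ hu hx]

theorem le_maxOnClosure (hb : Bornology.IsBounded Ω) (hu : ContinuousOn u (closure Ω))
    {x : EuclideanSpace ℝ (Fin N)} (hx : x ∈ closure Ω) : u x ≤ maxOnClosure Ω u :=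
  le_csSup (hb.isCompact_closure.image_of_continuousOn hu).bddAbove (mem_image_of_mem u hx)

/-- A function with positive Laplacian has no interior maximum: along some coordinate line the
second derivative would be positive, so that the maximum would also be a minimum and the function
constant near the point. -/
theorem lt_maxOnClosure (hN : 2 ≤ N) (hopen : IsOpen Ω) (hb : Bornology.IsBounded Ω)
    (hΩ : HasC2Boundary Ω) (hu : ContDiffOn ℝ 2 u (closure Ω))
    (hPoisson : ∀ x ∈ Ω, Laplacian.laplacian u x = N) {x : EuclideanSpace ℝ (Fin N)}
    (hx : x ∈ Ω) : u x < maxOnClosure Ω u := by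
  refine (le_maxOnClosure hb hu.continuousOn (subset_closure hx)).lt_of_ne fun heq => ?_
  have hmax : ∀ y ∈ Ω, u y ≤ u x := fun y hy =>
    heq ▸ le_maxOnClosure hb hu.continuousOn (subset_closure hy)
  have htr : ∑ i, ⟪EuclideanSpace.basisFun (Fin N) ℝ i,
      hessian Ω u x (EuclideanSpace.basisFun (Fin N) ℝ i)⟫_ℝ = N := by
    rw [← tr_eq_sum, hessian_eq_fderiv hopen hx, tr_fderiv_gradientWithin hopen hΩ hu hx,
      hPoisson x hx]
  obtain ⟨i, hi⟩ : ∃ i, 0 < ⟪EuclideanSpace.basisFun (Fin N) ℝ i,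
      hessian Ω u x (EuclideanSpace.basisFun (Fin N) ℝ i)⟫_ℝ := by
    by_contra! hc
    have h1 := Finset.sum_nonpos fun i (_ : i ∈ Finset.univ) => hc i
    rw [htr] at h1
    have : (2 : ℝ) ≤ N := by exact_mod_cast hN
    linarith
  set b := EuclideanSpace.basisFun (Fin N) ℝ i
  have hl : ∀ t : ℝ, HasDerivAt (fun t : ℝ => x + t • b) b t := fun t => by
    simpa using ((hasDerivAt_id t).smul_const b).const_add x
  have hl0 : x + (0 : ℝ) • b = x := by simp
  have hmem : ∀ᶠ t in 𝓝 (0 : ℝ), x + t • b ∈ Ω :=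
    (hl 0).continuousAt.eventually_mem (by rw [hl0]; exact hopen.mem_nhds hx)
  have hd1 : ∀ᶠ t in 𝓝 (0 : ℝ), deriv (fun t : ℝ => u (x + t • b)) t =
      ⟪gradientWithin u (closure Ω) (x + t • b), b⟫_ℝ := by
    filter_upwards [hmem] with t ht
    exact ((hasFDerivAt_of_mem hopen hu ht).comp_hasDerivAt t (hl t)).deriv
  have hd2 : deriv (deriv fun t : ℝ => u (x + t • b)) 0 = ⟪b, hessian Ω u x b⟫_ℝ := by
    rw [EventuallyEq.deriv_eq hd1]
    have h1 := hasFDerivAt_gradientWithin hopen hΩ hu hx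
    rw [← hl0] at h1
    have h2 := (h1.comp_hasDerivAt 0 (hl 0)).inner ℝ (hasDerivAt_const (0 : ℝ) b)
    rw [hl0] at h2
    refine h2.deriv.trans ?_
    simp [real_inner_comm]
  have hlmax : IsLocalMax (fun t : ℝ => u (x + t • b)) 0 := by
    filter_upwards [hmem] with t ht
    simpa using hmax _ ht
  have hcont : ContinuousAt (fun t : ℝ => u (x + t • b)) 0 := by
    have h1 := (hasFDerivAt_of_mem hopen hu hx)
    rw [← hl0] at h1
    exact (h1.comp_hasDerivAt 0 (hl 0)).continuousAt
  have hlmin := isLocalMin_of_deriv_deriv_pos (by rw [hd2]; exact hi) hlmax.deriv_eq_zero hcont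
  have hconst : (fun t : ℝ => u (x + t • b)) =ᶠ[𝓝 0] fun _ => u (x + (0 : ℝ) • b) := by
    filter_upwards [hlmax, hlmin] with t h1 h2 using le_antisymm h1 h2
  have h0 : deriv (deriv fun t : ℝ => u (x + t • b)) 0 = 0 := by
    rw [hconst.deriv.deriv_eq]
    simp
  rw [← hd2, h0] at hi
  exact lt_irrefl _ hi

/-- If the boundary side of the Neumann identity is nonpositive, the Hessian of `h` vanishes. -/
theorem hessDiff_eq_zero (hN : 2 ≤ N) (hopen : IsOpen Ω) (hb : Bornology.IsBounded Ω)
    (hΩ : HasC2Boundary Ω) (hu : ContDiffOn ℝ 2 u (closure Ω))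
    (hPoisson : ∀ x ∈ Ω, Laplacian.laplacian u x = N)
    (hNeumann : ∀ x ∈ frontier Ω, normalDeriv Ω u x = neumannConstant Ω)
    {z : EuclideanSpace ℝ (Fin N)} {a : ℝ} (hsign : neumannBoundarySide Ω u z a ≤ 0)
    {x : EuclideanSpace ℝ (Fin N)} (hx : x ∈ Ω) : hessDiff Ω u x = 0 := by
  rw [← integral_mul_tr_hessDiff_sq hN hopen hb hΩ hu hPoisson hNeumann] at hsign
  have hc : ContinuousOn (fun x => (maxOnClosure Ω u - u x) *
      tr (hessDiff Ω u x ∘L hessDiff Ω u x)) (closure Ω) :=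
    (continuousOn_const.sub hu.continuousOn).mul (continuousOn_tr_hessDiff_sq hopen hΩ hu)
  have hint := (hc.integrableOn_compact (μ := volume) hb.isCompact_closure).mono_set subset_closure
  have hnn : ∀ y ∈ Ω, 0 ≤ (maxOnClosure Ω u - u y) * tr (hessDiff Ω u y ∘L hessDiff Ω u y) :=
    fun y hy => mul_nonneg
      (sub_nonneg.2 (le_maxOnClosure hb hu.continuousOn (subset_closure hy)))
      (tr_comp_self_nonneg (inner_hessDiff_comm hopen hΩ hu hy))
  have h0 := le_antisymm hsign (setIntegral_nonneg hopen.measurableSet hnn)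
  rw [setIntegral_eq_zero_iff_of_nonneg_ae
    (ae_restrict_of_forall_mem hopen.measurableSet hnn) hint] at h0
  have h1 := Measure.eqOn_open_of_ae_eq h0 hopen (hc.mono subset_closure) continuousOn_const hx
  exact eq_zero_of_tr_comp_self_eq_zero (inner_hessDiff_comm hopen hΩ hu hx)
    ((mul_eq_zero.1 h1).resolve_left
      (sub_pos.2 (lt_maxOnClosure hN hopen hb hΩ hu hPoisson hx)).ne')

/-- If the Hessian of `h = q - u` vanishes on a connected set, then `∇h` is constant and `h` is affine,
up to the boundary by continuity. -/
theorem exists_gradDiff_eq_const (hopen : IsOpen Ω) (hconn : IsConnected Ω)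
    (hΩ : HasC2Boundary Ω) (hu : ContDiffOn ℝ 2 u (closure Ω))
    (hM : ∀ x ∈ Ω, hessDiff Ω u x = 0) (z : EuclideanSpace ℝ (Fin N)) (a : ℝ) :
    ∃ (v : EuclideanSpace ℝ (Fin N)) (b : ℝ), (∀ x ∈ closure Ω, gradDiff Ω u z x = v) ∧
      ∀ x ∈ closure Ω, quadratic z a x - u x = ⟪v, x⟫_ℝ + b := by
  obtain ⟨v, hv⟩ := hopen.exists_is_const_of_fderiv_eq_zero hconn.isPreconnected
    (f := gradDiff Ω u z) (𝕜 := ℝ)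
    (fun x hx => (hasFDerivAt_gradDiff hopen hΩ hu hx z).differentiableAt.differentiableWithinAt)
    (fun x hx => by rw [(hasFDerivAt_gradDiff hopen hΩ hu hx z).fderiv, hM x hx]; rfl)
  have hd : ∀ x ∈ Ω, HasFDerivAt (fun y => quadratic z a y - u y - ⟪v, y⟫_ℝ)
      (0 : EuclideanSpace ℝ (Fin N) →L[ℝ] ℝ) x := fun x hx => by
    refine (((hasFDerivAt_quadratic z a x).sub (hasFDerivAt_of_mem hopen hu hx)).sub
      (innerSL ℝ v).hasFDerivAt).congr_fderiv ?_
    rw [← hv x hx, gradDiff, map_sub (innerSL ℝ) (x - z), sub_self]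
  obtain ⟨b, hb⟩ := hopen.exists_is_const_of_fderiv_eq_zero hconn.isPreconnected
    (f := fun y => quadratic z a y - u y - ⟪v, y⟫_ℝ) (𝕜 := ℝ)
    (fun x hx => (hd x hx).differentiableAt.differentiableWithinAt)
    (fun x hx => (hd x hx).fderiv)
  have hq : ContinuousOn (fun y => quadratic z a y - u y) (closure Ω) :=
    (continuous_iff_continuousAt.2 fun y =>
      (hasFDerivAt_quadratic z a y).continuousAt).continuousOn.sub hu.continuousOn
  have hv' : EqOn (gradDiff Ω u z) (fun _ => v) (closure Ω) :=
    EqOn.of_subset_closure hv (contDiffOn_gradDiff hopen hΩ hu z).continuousOn continuousOn_const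
      subset_closure subset_rfl
  have hb' : EqOn (fun y => quadratic z a y - u y) (fun y => ⟪v, y⟫_ℝ + b) (closure Ω) := by
    refine EqOn.of_subset_closure (s := Ω) (fun x hx => ?_) hq (by fun_prop)
      subset_closure subset_rfl
    exact sub_eq_iff_eq_add'.1 (hb x hx)
  exact ⟨v, b, hv', hb'⟩

/-- A domain with constant support function `⟪x - z₀, ν⟫` is a ball: at a point of the boundary
farthest from `z₀`, the vector `x - z₀` is normal, so that the maximal distance is `R`, and it is
also the least possible distance on the boundary. -/
theorem eq_ball_of_inner_outerNormal_eq (hN : 2 ≤ N) (hopen : IsOpen Ω) (hconn : IsConnected Ω)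
    (hb : Bornology.IsBounded Ω) (hΩ : HasC2Boundary Ω) {z₀ : EuclideanSpace ℝ (Fin N)} {R : ℝ}
    (h : ∀ x ∈ frontier Ω, ⟪x - z₀, outerNormal Ω x⟫_ℝ = R) : Ω = Metric.ball z₀ R := by
  have : Nonempty (Fin N) := ⟨⟨0, by lia⟩⟩
  obtain ⟨x₁, hx₁, hmax⟩ := hb.isCompact_closure.exists_isMaxOn hconn.nonempty.closure
    (f := fun x => dist x z₀) (by fun_prop)
  have hsub : Ω ⊆ Metric.ball z₀ (dist x₁ z₀) := by
    rw [← interior_closedBall', hopen.subset_interior_iff]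
    exact fun y hy => hmax (subset_closure hy)
  have hx₁f : x₁ ∈ frontier Ω := by
    rw [hopen.frontier_eq]
    exact ⟨hx₁, fun hc => lt_irrefl _ (Metric.mem_ball.1 (hsub hc))⟩
  have hν := isOuterUnitNormal_outerNormal hΩ hx₁f
  have hR := h x₁ hx₁f
  set ν := outerNormal Ω x₁
  set d := x₁ - z₀ with hd
  have hνν : ⟪ν, ν⟫_ℝ = 1 := by rw [real_inner_self_eq_norm_sq, hν.1]; norm_num
  have hle : ∀ v, ⟪v, ν⟫_ℝ < 0 → ⟪d, v⟫_ℝ ≤ 0 := fun v hv => by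
    have hev : ∀ᶠ t : ℝ in 𝓝[>] 0, 2 * ⟪d, v⟫_ℝ + t * ‖v‖ ^ 2 ≤ 0 := by
      filter_upwards [hν.2.1 v hv, self_mem_nhdsWithin] with t ht ht0
      have h1 := Metric.mem_ball.1 (hsub ht)
      rw [dist_eq_norm, dist_eq_norm, ← hd, add_sub_right_comm, ← hd] at h1
      have h2 : ‖d + t • v‖ ^ 2 ≤ ‖d‖ ^ 2 := by gcongr
      rw [norm_add_sq_real, inner_smul_right, norm_smul, mul_pow, Real.norm_eq_abs, sq_abs] at h2
      have ht0' : (0 : ℝ) < t := ht0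
      by_contra! hc
      nlinarith [mul_pos ht0' hc]
    have hlim : Tendsto (fun t : ℝ => 2 * ⟪d, v⟫_ℝ + t * ‖v‖ ^ 2) (𝓝[>] 0)
        (𝓝 (2 * ⟪d, v⟫_ℝ + 0 * ‖v‖ ^ 2)) :=
      (Continuous.tendsto (by fun_prop) 0).mono_left nhdsWithin_le_nhds
    have := le_of_tendsto hlim hev
    linarith
  have hR0 : 0 ≤ R := by
    have := hle (-ν) (by rw [inner_neg_left, hνν]; norm_num)
    rw [inner_neg_right, hR] at this
    linarith
  have hdν : d = R • ν := by
    set τ := d - R • ν with hτ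
    have hτν : ⟪τ, ν⟫_ℝ = 0 := by
      rw [hτ, inner_sub_left, inner_smul_left, hνν, hR]; simp
    have hdτ : ⟪d, τ⟫_ℝ = ‖τ‖ ^ 2 := by
      have : d = τ + R • ν := by rw [hτ, sub_add_cancel]
      conv_lhs => rw [this]
      rw [inner_add_left, inner_smul_left, real_inner_comm τ ν, hτν, real_inner_self_eq_norm_sq]
      simp
    have hlim : Tendsto (fun s : ℝ => ‖τ‖ ^ 2 - s * R) (𝓝[>] 0) (𝓝 (‖τ‖ ^ 2 - 0 * R)) :=
      (Continuous.tendsto (by fun_prop) 0).mono_left nhdsWithin_le_nhds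
    have h0 : ‖τ‖ ^ 2 - 0 * R ≤ 0 := by
      refine le_of_tendsto hlim ?_
      filter_upwards [self_mem_nhdsWithin] with s hs
      have hs' : (0 : ℝ) < s := hs
      have := hle (τ - s • ν) (by
        rw [inner_sub_left, inner_smul_left, hτν, hνν]; simpa using hs')
      rwa [inner_sub_right, inner_smul_right, hdτ, hR] at this
    have h1 : ‖τ‖ = 0 := by nlinarith [norm_nonneg τ]
    exact sub_eq_zero.1 (norm_eq_zero.1 h1)
  have hdist : dist x₁ z₀ = R := by
    rw [dist_eq_norm, ← hd, hdν, norm_smul, hν.1, mul_one, Real.norm_of_nonneg hR0]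
  rw [hdist] at hsub
  refine hsub.antisymm ?_
  obtain ⟨y, hy⟩ := hconn.nonempty
  refine (convex_ball z₀ R).isPreconnected.subset_of_closure_inter_subset hopen
    ⟨y, hsub hy, hy⟩ fun x hx => ?_
  by_contra hxΩ
  have hxf : x ∈ frontier Ω := hopen.frontier_eq ▸ ⟨hx.1, hxΩ⟩
  have h1 := real_inner_le_norm (x - z₀) (outerNormal Ω x)
  rw [h x hxf, (isOuterUnitNormal_outerNormal hΩ hxf).1, mul_one, ← dist_eq_norm] at h1
  exact absurd (Metric.mem_ball.1 hx.2) (not_lt.2 h1)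

end Rigidity

end NeumannRigidity

end

open NeumannRigidity
theorem theorem1p3 (N : ℕ) (hN : 2 ≤ N) (Ω : Set (EuclideanSpace ℝ (Fin N)))
    (hopen : IsOpen Ω) (hconn : IsConnected Ω) (hbdd : Bornology.IsBounded Ω)
    (hC2 : HasC2Boundary Ω)
    (u : EuclideanSpace ℝ (Fin N) → ℝ) (hu : ContDiffOn ℝ 2 u (closure Ω))
    (hPoisson : ∀ x ∈ Ω, Laplacian.laplacian u x = N)
    (hNeumann : ∀ x ∈ frontier Ω, normalDeriv Ω u x = neumannConstant Ω)
    (z : EuclideanSpace ℝ (Fin N)) (a : ℝ)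
    (hsign : neumannBoundarySide Ω u z a ≤ 0) :
    (∃ A : EuclideanSpace ℝ (Fin N) →ᵃ[ℝ] ℝ,
      ∀ x ∈ closure Ω, quadratic z a x - u x = A x) ∧
    ∃ (z₀ : EuclideanSpace ℝ (Fin N)) (a₀ : ℝ),
      (∀ x ∈ closure Ω, u x = quadratic z₀ a₀ x) ∧
      Ω = Metric.ball z₀ (neumannConstant Ω) := by
  obtain ⟨v, b, hv, hb⟩ := exists_gradDiff_eq_const hopen hconn hC2 hu
    (fun x hx => hessDiff_eq_zero hN hopen hbdd hC2 hu hPoisson hNeumann hsign hx) z a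
  refine ⟨⟨(innerSL ℝ v).toLinearMap.toAffineMap + AffineMap.const ℝ _ b, fun x hx => ?_⟩,
    z + v, a - b - inner ℝ v z - ‖v‖ ^ 2 / 2, fun x hx => ?_, ?_⟩
  · rw [hb x hx]
    simp
  · have h1 := hb x hx
    have h2 : ‖x - (z + v)‖ ^ 2 = ‖x - z‖ ^ 2 - 2 * (inner ℝ v x - inner ℝ v z) + ‖v‖ ^ 2 := by
      rw [← sub_sub, norm_sub_sq_real, real_inner_comm, inner_sub_right]
    rw [quadratic] at h1 ⊢
    rw [h2]
    linarith
  · refine eq_ball_of_inner_outerNormal_eq hN hopen hconn hbdd hC2 fun x hx => ?_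
    have h1 := hv x (frontier_subset_closure hx)
    rw [← hNeumann x hx, normalDeriv, ← sub_sub, ← h1, gradDiff, sub_sub_cancel]
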